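/- Notation. For $d\ge 0$ and $n\ge 1$ let $\mathcal L_n(\mathbb R^d,0)\cong\mathbb R^{nd}$ be the space of truncated arcs $\gamma(t)=\mathbf a_1t+\cdots+\mathbf a_nt^n$, $\mathbf a_i\in\mathbb R^d$. For a real analytic function germ $f:(\mathbb R^d,0)\to(\mathbb R,0)$ let $\mathcal X_{n,+}(f)$, $\mathcal X_{n,-}(f)$, $\mathcal X_n(f)$ be the sets of $\gamma\in\mathcal L_n(\mathbb R^d,0)$ with $f(\gamma(t))=ct^n+(\text{terms of higher order})$ where $c>0$, $c<0$, $c\ne0$ respectively. The positive, negative and total zeta functions of $f$ are the power series $$Z_{f,\pm}(T)=\sum_{n\ge1}(-1)^{-nd}\chi^c(\mathcal X_{n,\pm}(f))\,T^n,\qquad Z_f(T)=\sum_{n\ge1}(-1)^{-nd}\chi^c(\mathcal X_n(f))\,T^n ,$$ where $\chi^c(X)=\sum_p(-1)^p\operatorname{rank}H^p_c(X;\mathbb Z)$ is the Euler characteristic with compact supports. Theorem. Let $f:(\mathbb R^{d_1},0)\to(\mathbb R,0)$ and $g:(\mathbb R^{d_2},0)\to(\mathbb R,0)$ be real analytic function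 germs and let $(f*g)(x,y)=f(x)+g(y)$ on $\mathbb R^{d_1+d_2}$. The Euler characteristics above are well defined for $f$, $g$ and $f*g$ (the groups $H^p_c$ involved have finite rank, and almost all of these ranks are zero). Write $$Z_{f,\pm}=\sum_{i\ge1} a_i^\pm T^i,\quad Z_{g,\pm}=\sum_{i\ge1} b_i^\pm T^i,\quad Z_{f*g,\pm}=\sum_{i\ge1} c_i^\pm T^i,\quad Z_f=\sum_{i\ge1} a_iT^i,\quad Z_g=\sum_{i\ge1} b_iT^i,\quad Z_{f*g}=\sum_{i\ge1} c_iT^i,$$ and $A_n=1-\sum_{i=1}^na_i$, $B_n=1-\sum_{i=1}^nb_i$. Then for every $n\ge1$ $$c_n^+=a_n^+b_n^++a_n^+B_n+A_nb_n^++\sum_{i=1}^n(-1)^{n-i}(a_i^+b_i^-+a_i^-b_i^+),$$ $$c_n^-=a_n^-b_n^-+a_n^-B_n+A_nb_n^-+\sum_{i=1}^n(-1)^{n-i}(a_i^+b_i^-+a_i^-b_i^+),$$ $$c_n=a_n^+b_n^++a_n^-b_n^-+a_nB_n+A_nb_n+2\sum_{i=1}^n(-1)^{n-i}(a_i^+b_i^-+a_i^-b_i^+).$$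 -/

import Mathlib

open Filter Topology

noncomputable section

namespace ThomSebastiani

/-! ### Alexander-Spanier cohomology with compact supports and integer coefficients

For a locally compact (Hausdorff, paracompact) space this is the explicit complex computing the
sheaf cohomology with compact supports of the constant sheaf `ℤ`. -/

section Cohomology

variable (X : Type*) [TopologicalSpace X]

/-- Not necessarily continuous functions of `p + 1` points of `X`. -/
abbrev Cochain (p : ℕ) : Type _ := (Fin (p + 1) → X) → ℤ

/-- The coboundary `(dφ)(x₀, …, x_{p+1}) = ∑ᵢ (-1)^i φ(x₀, …, x̂ᵢ, …, x_{p+1})`. -/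
def coboundary (p : ℕ) : Cochain X p →ₗ[ℤ] Cochain X (p + 1) where
  toFun φ := fun x => ∑ i : Fin (p + 2), (-1) ^ (i : ℕ) * φ (fun j => x (i.succAbove j))
  map_add' φ ψ := by
    funext x
    simp [mul_add, Finset.sum_add_distrib]
  map_smul' c φ := by
    funext x
    simp only [Pi.smul_apply, smul_eq_mul, RingHom.id_apply, Finset.mul_sum]
    exact Finset.sum_congr rfl fun i _ => by ring

variable {X}

/-- The support of a cochain: a point lies outside it when the cochain vanishes
on all tuples of points of some neighbourhood of that point. -/
def cochainSupport {p : ℕ} (φ : Cochain X p) : Set X :=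
  {x | ∀ U ∈ 𝓝 x, ∃ v : Fin (p + 1) → X, (∀ i, v i ∈ U) ∧ φ v ≠ 0}

theorem notMem_cochainSupport {p : ℕ} {φ : Cochain X p} {x : X} :
    x ∉ cochainSupport φ ↔ ∃ U ∈ 𝓝 x, ∀ v : Fin (p + 1) → X, (∀ i, v i ∈ U) → φ v = 0 := by
  simp [cochainSupport]

theorem isClosed_cochainSupport {p : ℕ} (φ : Cochain X p) : IsClosed (cochainSupport φ) := by
  rw [← isOpen_compl_iff, isOpen_iff_mem_nhds]
  intro x hx
  obtain ⟨U, hU, h⟩ := notMem_cochainSupport.1 hx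
  filter_upwards [eventually_mem_nhds_iff.2 hU] with y hy
  exact notMem_cochainSupport.2 ⟨U, hy, h⟩

theorem cochainSupport_zero {p : ℕ} : cochainSupport (0 : Cochain X p) = ∅ := by
  ext x
  simp [cochainSupport]
  exact ⟨Set.univ, univ_mem⟩

theorem cochainSupport_add {p : ℕ} (φ ψ : Cochain X p) :
    cochainSupport (φ + ψ) ⊆ cochainSupport φ ∪ cochainSupport ψ := by
  intro x hx
  by_contra hn
  rw [Set.mem_union, not_or] at hn
  obtain ⟨U, hU, h⟩ := notMem_cochainSupport.1 hn.1
  obtain ⟨V, hV, k⟩ := notMem_cochainSupport.1 hn.2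
  refine notMem_cochainSupport.2 ⟨U ∩ V, inter_mem hU hV, fun v hv => ?_⟩ hx
  simp [h v fun i => (hv i).1, k v fun i => (hv i).2]

theorem cochainSupport_smul {p : ℕ} (c : ℤ) (φ : Cochain X p) :
    cochainSupport (c • φ) ⊆ cochainSupport φ := by
  intro x hx
  by_contra hn
  obtain ⟨U, hU, h⟩ := notMem_cochainSupport.1 hn
  exact notMem_cochainSupport.2 ⟨U, hU, fun v hv => by simp [h v hv]⟩ hx

variable (X)

/-- Cochains with compact support. -/
def compactCochains (p : ℕ) : Submodule ℤ (Cochain X p) where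
  carrier := {φ | IsCompact (cochainSupport φ)}
  zero_mem' := by simp [cochainSupport_zero]
  add_mem' {φ ψ} hφ hψ :=
    (IsCompact.union hφ hψ).of_isClosed_subset (isClosed_cochainSupport _)
      (cochainSupport_add φ ψ)
  smul_mem' c φ hφ :=
    IsCompact.of_isClosed_subset hφ (isClosed_cochainSupport _) (cochainSupport_smul c φ)

/-- Locally zero cochains, i.e. those with empty support. -/
def locallyZeroCochains (p : ℕ) : Submodule ℤ (Cochain X p) where
  carrier := {φ | cochainSupport φ = ∅}
  zero_mem' := cochainSupport_zero
  add_mem' {φ ψ} hφ hψ := by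
    have h := cochainSupport_add φ ψ
    rw [Set.mem_ofPred_eq] at hφ hψ ⊢
    rw [hφ, hψ, Set.union_empty] at h
    exact Set.subset_empty_iff.1 h
  smul_mem' c φ hφ := by
    have h := cochainSupport_smul c φ
    rw [Set.mem_ofPred_eq] at hφ ⊢
    rw [hφ] at h
    exact Set.subset_empty_iff.1 h

/-- Representatives of cocycles of the complex (compactly supported)/(locally zero). -/
def compactCocycles (p : ℕ) : Submodule ℤ (Cochain X p) :=
  compactCochains X p ⊓ (locallyZeroCochains X (p + 1)).comap (coboundary X p)

/-- Representatives of coboundaries of the complex (compactly supported)/(locally zero). -/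
def compactCoboundaries : (p : ℕ) → Submodule ℤ (Cochain X p)
  | 0 => locallyZeroCochains X 0
  | p + 1 => locallyZeroCochains X (p + 1) ⊔ (compactCochains X p).map (coboundary X p)

/-- The cohomology group `H_c^p(X; ℤ)`. -/
abbrev CompactCohomology (p : ℕ) : Type _ :=
  compactCocycles X p ⧸ (compactCoboundaries X p).submoduleOf (compactCocycles X p)

/-- All groups `H_c^p(X; ℤ)` have finite rank and almost all have rank zero,
so that the Euler characteristic with compact supports of `X` is defined. -/
def HasEulerCharC : Prop :=
  (∀ p, Module.rank ℤ (CompactCohomology X p) < Cardinal.aleph0) ∧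
    {p | Module.rank ℤ (CompactCohomology X p) ≠ 0}.Finite

/-- The Euler characteristic with compact supports `χ^c(X) = ∑ₚ (-1)^p rank H_c^p(X; ℤ)`. -/
def eulerCharC : ℤ :=
  ∑ᶠ p : ℕ, (-1) ^ p * (Module.finrank ℤ (CompactCohomology X p) : ℤ)

end Cohomology

/-! ### Arcs and zeta functions -/

/-- The space `𝓛ₙ` of truncated arcs at the origin of `ℝ^d`, with the topology of `ℝ^(nd)`;
the entry `a k` is the coefficient of `t^(k+1)`. -/
abbrev TruncArc (n d : ℕ) : Type := Fin n → Fin d → ℝ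

/-- The arc `γ(t) = a₁ t + ⋯ + aₙ tⁿ`. -/
def arc {n d : ℕ} (a : TruncArc n d) (t : ℝ) : Fin d → ℝ :=
  ∑ k : Fin n, t ^ ((k : ℕ) + 1) • a k

/-- `h(t) = c tⁿ + (terms of higher order)` as analytic germs at `t = 0`. -/
def HasLeadingTerm (h : ℝ → ℝ) (n : ℕ) (c : ℝ) : Prop :=
  ∃ u : ℝ → ℝ, AnalyticAt ℝ u 0 ∧ u 0 = c ∧ ∀ᶠ t in 𝓝 (0 : ℝ), h t = t ^ n * u t

variable {d : ℕ}

/-- `𝓧_{n,+}(f)`. -/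
def arcsPos (f : (Fin d → ℝ) → ℝ) (n : ℕ) : Set (TruncArc n d) :=
  {a | ∃ c, 0 < c ∧ HasLeadingTerm (fun t => f (arc a t)) n c}

/-- `𝓧_{n,-}(f)`. -/
def arcsNeg (f : (Fin d → ℝ) → ℝ) (n : ℕ) : Set (TruncArc n d) :=
  {a | ∃ c, c < 0 ∧ HasLeadingTerm (fun t => f (arc a t)) n c}

/-- `𝓧_n(f)`. -/
def arcsAll (f : (Fin d → ℝ) → ℝ) (n : ℕ) : Set (TruncArc n d) :=
  {a | ∃ c, c ≠ 0 ∧ HasLeadingTerm (fun t => f (arc a t)) n c}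

/-- The power series `∑_{n ≥ 1} (-1)^{-nd} χ^c(S n) Tⁿ`; note that `(-1)^{-nd} = (-1)^{nd}`. -/
def arcSeries (S : (n : ℕ) → Set (TruncArc n d)) : PowerSeries ℤ :=
  PowerSeries.mk fun n => if n = 0 then 0 else (-1) ^ (n * d) * eulerCharC (S n)

/-- The positive zeta function `Z_{f,+}`. -/
def zetaPos (f : (Fin d → ℝ) → ℝ) : PowerSeries ℤ := arcSeries (arcsPos f)

/-- The negative zeta function `Z_{f,-}`. -/
def zetaNeg (f : (Fin d → ℝ) → ℝ) : PowerSeries ℤ := arcSeries (arcsNeg f)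

/-- The total zeta function `Z_f`. -/
def zeta (f : (Fin d → ℝ) → ℝ) : PowerSeries ℤ := arcSeries (arcsAll f)

/-- All Euler characteristics occurring in the zeta functions of `f` are defined. -/
def ZetaDefined (f : (Fin d → ℝ) → ℝ) : Prop :=
  ∀ n, 1 ≤ n → HasEulerCharC (arcsPos f n) ∧ HasEulerCharC (arcsNeg f n) ∧
    HasEulerCharC (arcsAll f n)

/-- `A_n = 1 - ∑_{i=1}^n a_i`, where `a_i` are the coefficients of `Z_f`. -/
def partialCoeff (f : (Fin d → ℝ) → ℝ) (n : ℕ) : ℤ :=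
  1 - ∑ i ∈ Finset.Icc 1 n, PowerSeries.coeff i (zeta f)

/-- `(f * g)(x, y) = f(x) + g(y)` on `ℝ^{d₁ + d₂}`. -/
def thomSebastianiSum {d₁ d₂ : ℕ} (f : (Fin d₁ → ℝ) → ℝ) (g : (Fin d₂ → ℝ) → ℝ) :
    (Fin (d₁ + d₂) → ℝ) → ℝ :=
  fun z => f (fun i => z (Fin.castAdd d₂ i)) + g (fun j => z (Fin.natAdd d₁ j))

end ThomSebastiani

end

/-! The Euler characteristic with compact supports is additive along closed subsets and, on the sets
that occur here, multiplicative. The theorem then comes from cutting the arcs of `f * g` into pieces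
that are products.

Up to order `n`, the vanishing order and leading coefficient of `f(γ(t))` depend only on the
coefficients `P j` of `F(γ(t))`, where `F` is a Taylor polynomial of `f`. These are polynomial
functions of `γ`; let `Q j` be the analogues for `g`. A pair of arcs is in the positive set of the
sum when `P j + Q j = 0` for `j < n` and `P n + Q n > 0`. Sort such pairs by the order of the first
component. If both orders are at least `n`, the signs of `P n` and `Q n` give the terms `a⁺b⁺`,
`a⁺B`, `Ab⁺` and the summand `i = n`. Otherwise the two components have the same order `i < n`, with
leading coefficients of opposite sign, and they cancel up to order `n - 1`.

The cancelling pairs are counted by reparametrizing the second arc (`eulerCharC_crossing_step`). The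
substitution `t ↦ t - s t^(k-i+1)`, or a scaling of `t` when `k = i`, moves `Q k` while preserving
the conditions already imposed. So the pairs cancelling below order `k` form a line times the pairs
cancelling up to order `k`, and the condition `P k + Q k > 0` cuts out a half-line times the same
set. Each cancelled order costs a factor `-1`, and the order-`i` summand is `(-1)^(n-i)` times a
product of Euler characteristics (`eulerCharC_crossing`, `eulerCharC_ordPos_sumCoeff`). The
normalization `(-1)^(nd)` makes zeta coefficients independent of the truncation level, and `A n`
becomes the normalized Euler characteristic of the arcs of order greater than `n`. The negative
formula is the positive one for `-f` and `-g`; the total one is their sum.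

Two foundations carry this. Additivity is the long exact sequence of a closed subset
(`exists_long_exact_sequence`), proved for Alexander-Spanier cochains with discontinuous maps close
to the identity and the prism homotopy; acyclicity of `[0, ∞) × Y` then gives `χ(ℝ × Y) = -χ(Y)`.
Finiteness and multiplicativity hold for locally closed semialgebraic sets by a cylindrical
decomposition into graphs and bands (`exists_slicedBy`, `tame_of_mvPolynomial`). -/

open TopologicalSpace

namespace ThomSebastiani

/-! ### The prism operator -/

section Prism

variable {X : Type*}

/-- The alternating sum over faces, on functions of `p` points (including `p = 0`). -/
def faceSum (X : Type*) (p : ℕ) : ((Fin p → X) → ℤ) →ₗ[ℤ] ((Fin (p + 1) → X) → ℤ) where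
  toFun φ := fun x => ∑ i : Fin (p + 1), (-1) ^ (i : ℕ) * φ (fun j => x (i.succAbove j))
  map_add' φ ψ := by
    funext x
    simp [mul_add, Finset.sum_add_distrib]
  map_smul' c φ := by
    funext x
    simp only [Pi.smul_apply, smul_eq_mul, RingHom.id_apply, Finset.mul_sum]
    exact Finset.sum_congr rfl fun i _ => by ring

/-- Face `0` drops `x`; every other face keeps `x` and is a face of `v`. This recursion turns the
simplicial identities below into inductions on `p`. -/
theorem faceSum_cons (p : ℕ) (φ : (Fin (p + 1) → X) → ℤ) (x : X) (v : Fin (p + 1) → X) :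
    faceSum X (p + 1) φ (Fin.cons x v) = φ v - faceSum X p (fun u => φ (Fin.cons x u)) v := by
  simp only [faceSum, LinearMap.coe_mk, AddHom.coe_mk]
  rw [Fin.sum_univ_succ, sub_eq_add_neg, ← Finset.sum_neg_distrib]
  congr 1
  · simp
  · refine Finset.sum_congr rfl fun i _ => ?_
    have : (fun j => (Fin.cons x v : Fin (p + 2) → X) (i.succ.succAbove j)) =
        Fin.cons x (fun j => v (i.succAbove j)) := by
      funext j
      refine Fin.cases ?_ (fun j => ?_) j
      · simp
      · simp
    rw [this, Fin.val_succ, pow_succ]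
    ring

theorem faceSum_zero_apply (φ : (Fin 0 → X) → ℤ) (v : Fin 1 → X) (w : Fin 0 → X) :
    faceSum X 0 φ v = φ w := by
  simp [faceSum, Subsingleton.elim _ w]

theorem faceSum_faceSum (p : ℕ) (φ : (Fin p → X) → ℤ) :
    faceSum X (p + 1) (faceSum X p φ) = 0 := by
  induction p with
  | zero =>
    funext v
    rw [← Fin.cons_self_tail v, faceSum_cons, faceSum_zero_apply _ _ Fin.elim0,
      faceSum_zero_apply _ _ Fin.elim0, faceSum_zero_apply _ _ Fin.elim0]
    simp
  | succ p ih =>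
    funext v
    rw [← Fin.cons_self_tail v, faceSum_cons]
    have : (fun u => faceSum X (p + 1) φ (Fin.cons (v 0) u)) =
        φ - faceSum X p (fun u => φ (Fin.cons (v 0) u)) := by
      funext u
      rw [faceSum_cons]
      rfl
    rw [this, map_sub, ih]
    simp

/-- The prism operator between the identity and an arbitrary self-map. -/
def prism (θ : X → X) : (p : ℕ) → ((Fin (p + 1) → X) → ℤ) →ₗ[ℤ] ((Fin p → X) → ℤ)
  | 0 => 0
  | p + 1 =>
    { toFun := fun φ v => φ (Fin.cons (v 0) (θ ∘ v)) -
        prism θ p (fun u => φ (Fin.cons (v 0) u)) (Fin.tail v)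
      map_add' := fun φ ψ => by
        funext v
        have : (fun u => (φ + ψ) (Fin.cons (v 0) u)) =
          (fun u => φ (Fin.cons (v 0) u)) + fun u => ψ (Fin.cons (v 0) u) := rfl
        rw [this, map_add]
        simp only [Pi.add_apply]
        ring
      map_smul' := fun c φ => by
        funext v
        have : (fun u => (c • φ) (Fin.cons (v 0) u)) = c • fun u => φ (Fin.cons (v 0) u) := rfl
        rw [this, map_smul]
        simp only [Pi.smul_apply, smul_eq_mul, RingHom.id_apply]
        ring }

theorem prism_succ_cons (θ : X → X) (p : ℕ) (φ : (Fin (p + 2) → X) → ℤ) (x : X)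
    (w : Fin p → X) :
    prism θ (p + 1) φ (Fin.cons x w) = φ (Fin.cons x (Fin.cons (θ x) (θ ∘ w))) -
      prism θ p (fun u => φ (Fin.cons x u)) w := by
  have : θ ∘ (Fin.cons x w : Fin (p + 1) → X) = Fin.cons (θ x) (θ ∘ w) := by
    funext j
    refine Fin.cases ?_ (fun j => ?_) j <;> simp
  simp [prism, this]

/-- The chain homotopy between the identity and pullback along `θ`. Cochains are arbitrary
functions, so `θ` need not be continuous; that freedom is used throughout. -/
theorem faceSum_prism (θ : X → X) (p : ℕ) (φ : (Fin (p + 1) → X) → ℤ) (v : Fin (p + 1) → X) :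
    faceSum X p (prism θ p φ) v + prism θ (p + 1) (faceSum X (p + 1) φ) v = φ (θ ∘ v) - φ v := by
  induction p with
  | zero =>
    rw [← Fin.cons_self_tail v, prism_succ_cons, faceSum_cons, faceSum_zero_apply _ _ Fin.elim0]
    have h1 : (Fin.cons (θ (v 0)) (θ ∘ Fin.tail v) : Fin 1 → X) = θ ∘ Fin.cons (v 0) (Fin.tail v) := by
      funext j
      fin_cases j
      simp
    have h2 : (Fin.cons (v 0) Fin.elim0 : Fin 1 → X) = Fin.cons (v 0) (Fin.tail v) := by
      funext j
      fin_cases j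
      simp
    rw [h1, faceSum_zero_apply _ _ Fin.elim0, h2]
    simp [prism]
  | succ p ih =>
    obtain ⟨x, w, rfl⟩ : ∃ x w, v = Fin.cons x w := ⟨v 0, Fin.tail v, (Fin.cons_self_tail v).symm⟩
    have h1 : θ ∘ (Fin.cons x w : Fin (p + 2) → X) = Fin.cons (θ x) (θ ∘ w) := by
      funext j
      refine Fin.cases ?_ (fun j => ?_) j <;> simp
    have h2 : (fun u => prism θ (p + 1) φ (Fin.cons x u)) =
        (fun u => φ (Fin.cons x (Fin.cons (θ x) (θ ∘ u)))) -
          prism θ p (fun u => φ (Fin.cons x u)) := by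
      funext u
      rw [prism_succ_cons]
      rfl
    have h3 : (fun u => faceSum X (p + 2) φ (Fin.cons x u)) =
        φ - faceSum X (p + 1) (fun u => φ (Fin.cons x u)) := by
      funext u
      rw [faceSum_cons]
      rfl
    rw [faceSum_cons, prism_succ_cons, faceSum_cons, faceSum_cons, h2, h3, map_sub, map_sub, h1]
    have := ih (fun u => φ (Fin.cons x u)) w
    -- The face sum commutes with pullback along `θ`, so the terms with `θ x` as second vertex
    -- cancel.
    have h4 : faceSum X p (fun u => φ (Fin.cons x (Fin.cons (θ x) (θ ∘ u)))) w =
      faceSum X p (fun u => φ (Fin.cons x (Fin.cons (θ x) u))) (θ ∘ w) := rfl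
    simp only [Pi.sub_apply]
    rw [h4]
    linarith

/-- The prism evaluates `φ` only at tuples made of points `v j` and `θ (v j)`. -/
theorem prism_apply_eq_zero (θ : X → X) (A : Set X) (p : ℕ) (φ : (Fin (p + 1) → X) → ℤ)
    (h : ∀ u : Fin (p + 1) → X, (∀ i, u i ∈ A) → φ u = 0) (v : Fin p → X)
    (hv : ∀ j, v j ∈ A ∧ θ (v j) ∈ A) : prism θ p φ v = 0 := by
  induction p with
  | zero => rfl
  | succ p ih =>
    obtain ⟨x, w, rfl⟩ : ∃ x w, v = Fin.cons x w := ⟨v 0, Fin.tail v, (Fin.cons_self_tail v).symm⟩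
    have hx := hv 0
    rw [Fin.cons_zero] at hx
    have hw : ∀ j, w j ∈ A ∧ θ (w j) ∈ A := fun j => by simpa using hv j.succ
    rw [prism_succ_cons, h _ (fun i => ?_), ih _ (fun u hu => h _ (fun i => ?_)) _ hw, sub_zero]
    · refine Fin.cases ?_ (fun j => ?_) i
      · simpa using hx.1
      · simpa using hu j
    · refine Fin.cases ?_ (fun j => ?_) i
      · simpa using hx.1
      · refine Fin.cases ?_ (fun j => ?_) j
        · simpa using hx.2
        · simpa using (hw j).2

end Prism

/-! ### Supports, carriers and extension by zero -/

section Cochains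

variable {X Y : Type*}

theorem coboundary_coboundary (p : ℕ) (φ : Cochain X p) :
    coboundary X (p + 1) (coboundary X p φ) = 0 :=
  faceSum_faceSum (p + 1) φ

theorem coboundary_apply_eq_zero {p : ℕ} {φ : Cochain X p} {v : Fin (p + 2) → X}
    (h : ∀ i : Fin (p + 2), φ (fun j => v (i.succAbove j)) = 0) : coboundary X p φ v = 0 := by
  change ∑ i : Fin (p + 2), (-1) ^ (i : ℕ) * φ (fun j => v (i.succAbove j)) = 0
  exact Finset.sum_eq_zero fun i _ => by rw [h, mul_zero]

/-- Pullback of cochains along an arbitrary map. -/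
def pullCochain (θ : Y → X) (p : ℕ) : Cochain X p →ₗ[ℤ] Cochain Y p :=
  LinearMap.funLeft ℤ ℤ (fun v => θ ∘ v)

theorem pullCochain_apply (θ : Y → X) {p : ℕ} (φ : Cochain X p) (v : Fin (p + 1) → Y) :
    pullCochain θ p φ v = φ (θ ∘ v) := rfl

theorem coboundary_pullCochain (θ : Y → X) {p : ℕ} (φ : Cochain X p) :
    coboundary Y p (pullCochain θ p φ) = pullCochain θ (p + 1) (coboundary X p φ) := rfl

open Classical in
/-- Extension by zero of cochains on a subspace. -/
noncomputable def extendCochain (A : Set X) (p : ℕ) : Cochain A p →ₗ[ℤ] Cochain X p where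
  toFun φ := fun v => if h : ∀ i, v i ∈ A then φ (fun i => ⟨v i, h i⟩) else 0
  map_add' φ ψ := by
    funext v
    by_cases h : ∀ i, v i ∈ A <;> simp [h]
  map_smul' c φ := by
    funext v
    by_cases h : ∀ i, v i ∈ A <;> simp [h]

theorem extendCochain_of_mem {A : Set X} {p : ℕ} (φ : Cochain A p) {v : Fin (p + 1) → X}
    (h : ∀ i, v i ∈ A) : extendCochain A p φ v = φ (fun i => ⟨v i, h i⟩) := by
  simp [extendCochain, h]

theorem extendCochain_of_not {A : Set X} {p : ℕ} (φ : Cochain A p) {v : Fin (p + 1) → X}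
    (h : ¬ ∀ i, v i ∈ A) : extendCochain A p φ v = 0 := by
  simp only [extendCochain, LinearMap.coe_mk, AddHom.coe_mk, dif_neg h]

theorem pullCochain_extendCochain {A : Set X} {p : ℕ} (φ : Cochain A p) :
    pullCochain Subtype.val p (extendCochain A p φ) = φ := by
  funext v
  exact extendCochain_of_mem φ (fun i => (v i).2)

theorem extendCochain_apply_of_notMem {A : Set X} {p : ℕ} {φ : Cochain A p} {K : Set A}
    (h : ∀ v, (∀ i, v i ∉ K) → φ v = 0) {v : Fin (p + 1) → X}
    (hv : ∀ i, v i ∉ Subtype.val '' K) : extendCochain A p φ v = 0 := by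
  by_cases hA : ∀ i, v i ∈ A
  · rw [extendCochain_of_mem φ hA]
    exact h _ fun i hi => hv i ⟨_, hi, rfl⟩
  · exact extendCochain_of_not φ hA

variable [TopologicalSpace X] [TopologicalSpace Y]

theorem mem_locallyZeroCochains {p : ℕ} {φ : Cochain X p} :
    φ ∈ locallyZeroCochains X p ↔
      ∀ x, ∃ U ∈ 𝓝 x, ∀ v : Fin (p + 1) → X, (∀ i, v i ∈ U) → φ v = 0 := by
  change cochainSupport φ = ∅ ↔ _
  simp only [Set.eq_empty_iff_forall_notMem, notMem_cochainSupport]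

theorem coboundary_mem_locallyZeroCochains {p : ℕ} {φ : Cochain X p}
    (h : φ ∈ locallyZeroCochains X p) : coboundary X p φ ∈ locallyZeroCochains X (p + 1) := by
  rw [mem_locallyZeroCochains] at h ⊢
  intro x
  obtain ⟨U, hU, h⟩ := h x
  exact ⟨U, hU, fun v hv => coboundary_apply_eq_zero fun i => h _ fun j => hv _⟩

theorem cochainSupport_coboundary {p : ℕ} (φ : Cochain X p) :
    cochainSupport (coboundary X p φ) ⊆ cochainSupport φ := by
  intro x hx
  by_contra hn
  obtain ⟨U, hU, h⟩ := notMem_cochainSupport.1 hn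
  exact notMem_cochainSupport.2
    ⟨U, hU, fun v hv => coboundary_apply_eq_zero fun i => h _ fun j => hv _⟩ hx

theorem coboundary_mem_compactCochains {p : ℕ} {φ : Cochain X p}
    (h : φ ∈ compactCochains X p) : coboundary X p φ ∈ compactCochains X (p + 1) :=
  IsCompact.of_isClosed_subset h (isClosed_cochainSupport _) (cochainSupport_coboundary φ)

theorem locallyZeroCochains_le (p : ℕ) : locallyZeroCochains X p ≤ compactCochains X p := by
  intro φ hφ
  change IsCompact (cochainSupport φ)
  rw [show cochainSupport φ = ∅ from hφ]
  exact isCompact_empty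

theorem mem_compactCoboundaries_succ {p : ℕ} {φ : Cochain X (p + 1)} :
    φ ∈ compactCoboundaries X (p + 1) ↔
      ∃ η ∈ compactCochains X p, φ - coboundary X p η ∈ locallyZeroCochains X (p + 1) := by
  rw [compactCoboundaries, Submodule.mem_sup]
  constructor
  · rintro ⟨y, hy, z, ⟨η, hη, rfl⟩, rfl⟩
    exact ⟨η, hη, by simpa using hy⟩
  · rintro ⟨η, hη, h⟩
    exact ⟨_, h, _, ⟨η, hη, rfl⟩, by simp⟩

theorem locallyZeroCochains_le_compactCoboundaries (p : ℕ) :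
    locallyZeroCochains X p ≤ compactCoboundaries X p := by
  cases p with
  | zero => exact le_rfl
  | succ p => exact le_sup_left

theorem locallyZeroCochains_le_compactCocycles (p : ℕ) :
    locallyZeroCochains X p ≤ compactCocycles X p :=
  fun _ h => ⟨locallyZeroCochains_le p h, coboundary_mem_locallyZeroCochains h⟩

theorem compactCoboundaries_le_compactCocycles (p : ℕ) :
    compactCoboundaries X p ≤ compactCocycles X p := by
  cases p with
  | zero => exact locallyZeroCochains_le_compactCocycles 0
  | succ p =>
    refine sup_le (locallyZeroCochains_le_compactCocycles _) ?_
    rintro _ ⟨η, hη, rfl⟩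
    refine ⟨coboundary_mem_compactCochains hη, ?_⟩
    change coboundary X (p + 1) (coboundary X p η) ∈ locallyZeroCochains X (p + 2)
    rw [coboundary_coboundary]
    exact zero_mem _

theorem pullCochain_mem_locallyZeroCochains {θ : Y → X} (hθ : Continuous θ) {p : ℕ}
    {φ : Cochain X p} (h : φ ∈ locallyZeroCochains X p) :
    pullCochain θ p φ ∈ locallyZeroCochains Y p := by
  rw [mem_locallyZeroCochains] at h ⊢
  intro y
  obtain ⟨U, hU, h⟩ := h (θ y)
  exact ⟨θ ⁻¹' U, hθ.continuousAt.preimage_mem_nhds hU, fun v hv => h _ hv⟩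

theorem cochainSupport_pullCochain {θ : Y → X} (hθ : Continuous θ) {p : ℕ} (φ : Cochain X p) :
    cochainSupport (pullCochain θ p φ) ⊆ θ ⁻¹' cochainSupport φ := by
  intro y hy
  by_contra hn
  obtain ⟨U, hU, h⟩ := notMem_cochainSupport.1 hn
  exact notMem_cochainSupport.2
    ⟨θ ⁻¹' U, hθ.continuousAt.preimage_mem_nhds hU, fun v hv => h _ hv⟩ hy

theorem pullCochain_mem_compactCochains {θ : Y → X} (hθ : IsClosedEmbedding θ) {p : ℕ}
    {φ : Cochain X p} (h : φ ∈ compactCochains X p) :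
    pullCochain θ p φ ∈ compactCochains Y p :=
  IsCompact.of_isClosed_subset (hθ.isCompact_preimage h) (isClosed_cochainSupport _)
    (cochainSupport_pullCochain hθ.continuous φ)

theorem pullCochain_mem_compactCocycles {θ : Y → X} (hθ : IsClosedEmbedding θ) {p : ℕ}
    {φ : Cochain X p} (h : φ ∈ compactCocycles X p) :
    pullCochain θ p φ ∈ compactCocycles Y p :=
  ⟨pullCochain_mem_compactCochains hθ h.1,
    pullCochain_mem_locallyZeroCochains hθ.continuous h.2⟩

theorem pullCochain_mem_compactCoboundaries {θ : Y → X} (hθ : IsClosedEmbedding θ) {p : ℕ}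
    {φ : Cochain X p} (h : φ ∈ compactCoboundaries X p) :
    pullCochain θ p φ ∈ compactCoboundaries Y p := by
  cases p with
  | zero => exact pullCochain_mem_locallyZeroCochains hθ.continuous h
  | succ p =>
    rw [mem_compactCoboundaries_succ] at h ⊢
    obtain ⟨η, hη, h⟩ := h
    refine ⟨_, pullCochain_mem_compactCochains hθ hη, ?_⟩
    rw [coboundary_pullCochain, ← map_sub]
    exact pullCochain_mem_locallyZeroCochains hθ.continuous h

variable (X) in
/-- Cochains vanishing on all tuples that avoid some compact set. -/
def carriedCochains (p : ℕ) : Submodule ℤ (Cochain X p) where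
  carrier := {φ | ∃ K : Set X, IsCompact K ∧ ∀ v, (∀ i, v i ∉ K) → φ v = 0}
  zero_mem' := ⟨∅, isCompact_empty, fun _ _ => rfl⟩
  add_mem' := by
    rintro φ ψ ⟨K, hK, h⟩ ⟨L, hL, k⟩
    refine ⟨K ∪ L, hK.union hL, fun v hv => ?_⟩
    rw [Pi.add_apply, h v fun i hi => hv i (Or.inl hi), k v fun i hi => hv i (Or.inr hi), add_zero]
  smul_mem' := by
    rintro c φ ⟨K, hK, h⟩
    exact ⟨K, hK, fun v hv => by rw [Pi.smul_apply, h v hv, smul_zero]⟩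

theorem carriedCochains_le [T2Space X] (p : ℕ) : carriedCochains X p ≤ compactCochains X p := by
  rintro φ ⟨K, hK, h⟩
  refine IsCompact.of_isClosed_subset hK (isClosed_cochainSupport _) fun x hx => ?_
  by_contra hn
  exact notMem_cochainSupport.2 ⟨Kᶜ, hK.isClosed.isOpen_compl.mem_nhds hn, h⟩ hx

theorem coboundary_mem_carriedCochains {p : ℕ} {φ : Cochain X p}
    (h : φ ∈ carriedCochains X p) : coboundary X p φ ∈ carriedCochains X (p + 1) := by
  obtain ⟨K, hK, h⟩ := h
  exact ⟨K, hK, fun v hv => coboundary_apply_eq_zero fun i => h _ fun j => hv _⟩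

theorem extendCochain_mem_carriedCochains {A : Set X} {p : ℕ} {φ : Cochain A p}
    (h : φ ∈ carriedCochains A p) : extendCochain A p φ ∈ carriedCochains X p := by
  obtain ⟨K, hK, h⟩ := h
  exact ⟨_, hK.image continuous_subtype_val, fun v hv => extendCochain_apply_of_notMem h hv⟩

theorem mem_locallyZeroCochains_of_extendCochain {A : Set X} {p : ℕ} {φ : Cochain A p}
    (h : extendCochain A p φ ∈ locallyZeroCochains X p) : φ ∈ locallyZeroCochains A p := by
  rw [← pullCochain_extendCochain φ]
  exact pullCochain_mem_locallyZeroCochains continuous_subtype_val h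

/-- A point outside `U` has a neighbourhood missing the compact carrier. This is where local
vanishing on `U` alone would not suffice. -/
theorem extendCochain_mem_locallyZeroCochains [T2Space X] {U : Set X} (hU : IsOpen U) {p : ℕ}
    {φ : Cochain U p} (hφ : φ ∈ carriedCochains U p) (h : φ ∈ locallyZeroCochains U p) :
    extendCochain U p φ ∈ locallyZeroCochains X p := by
  obtain ⟨K, hK, hφ⟩ := hφ
  rw [mem_locallyZeroCochains] at h ⊢
  intro x
  by_cases hx : x ∈ U
  · obtain ⟨V, hV, h⟩ := h ⟨x, hx⟩
    refine ⟨Subtype.val '' V, hU.isOpenMap_subtype_val.image_mem_nhds hV, fun v hv => ?_⟩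
    by_cases hA : ∀ i, v i ∈ U
    · rw [extendCochain_of_mem φ hA]
      refine h _ fun i => ?_
      obtain ⟨y, hy, hyv⟩ := hv i
      rwa [show (⟨v i, hA i⟩ : U) = y from Subtype.ext hyv.symm]
    · exact extendCochain_of_not φ hA
  · refine ⟨(Subtype.val '' K)ᶜ, ?_, fun v hv => extendCochain_apply_of_notMem hφ hv⟩
    refine (hK.image continuous_subtype_val).isClosed.isOpen_compl.mem_nhds ?_
    rintro ⟨y, -, rfl⟩
    exact hx y.2

/-- Extension by zero fails to commute with the coboundary on tuples lying only partly in `U`. Small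
tuples either lie in `U` or avoid the carrier, so the defect is locally zero. -/
theorem coboundary_extendCochain_sub_mem [T2Space X] {U : Set X} (hU : IsOpen U) {p : ℕ}
    {φ : Cochain U p} (hφ : φ ∈ carriedCochains U p) :
    coboundary X p (extendCochain U p φ) - extendCochain U (p + 1) (coboundary U p φ) ∈
      locallyZeroCochains X (p + 1) := by
  obtain ⟨K, hK, hφ⟩ := hφ
  rw [mem_locallyZeroCochains]
  intro x
  by_cases hx : x ∈ U
  · refine ⟨U, hU.mem_nhds hx, fun v hv => ?_⟩
    rw [Pi.sub_apply, extendCochain_of_mem _ hv, sub_eq_zero]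
    change ∑ i : Fin (p + 2), (-1) ^ (i : ℕ) * extendCochain U p φ (fun j => v (i.succAbove j)) =
      ∑ i : Fin (p + 2), (-1) ^ (i : ℕ) * φ (fun j => ⟨v (i.succAbove j), _⟩)
    refine Finset.sum_congr rfl fun i _ => ?_
    rw [extendCochain_of_mem _ fun j => hv _]
  · refine ⟨(Subtype.val '' K)ᶜ, ?_, fun v hv => ?_⟩
    · refine (hK.image continuous_subtype_val).isClosed.isOpen_compl.mem_nhds ?_
      rintro ⟨y, -, rfl⟩
      exact hx y.2
    · rw [Pi.sub_apply, coboundary_apply_eq_zero, extendCochain_apply_of_notMem (K := K) _ hv,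
        sub_zero]
      · exact fun w hw => coboundary_apply_eq_zero fun i => hφ _ fun j => hw _
      · exact fun i => extendCochain_apply_of_notMem hφ fun j => hv _

/-- A compactly supported cochain agrees, up to a locally zero one, with a carried cochain on any
open neighbourhood of its support. -/
theorem exists_extendCochain_sub_mem [T2Space X] [LocallyCompactSpace X] {U : Set X}
    (hU : IsOpen U) {p : ℕ} {φ : Cochain X p} (hφ : φ ∈ compactCochains X p)
    (h : cochainSupport φ ⊆ U) :
    ∃ ψ ∈ carriedCochains U p, φ - extendCochain U p ψ ∈ locallyZeroCochains X p := by
  classical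
  obtain ⟨L, hL, hφL, hLU⟩ := exists_compact_between (hφ : IsCompact (cochainSupport φ)) hU h
  -- Cut off to tuples inside the compact set `L`. Near the interior of `L` nothing changes, and
  -- elsewhere `φ` is already locally zero.
  set χ : Cochain X p := fun v => if ∀ i, v i ∈ L then φ v else 0 with hχ
  refine ⟨pullCochain Subtype.val p χ, ⟨Subtype.val ⁻¹' L, ?_, fun v hv => ?_⟩, ?_⟩
  · rw [Subtype.isCompact_iff, Subtype.image_preimage_coe, Set.inter_eq_right.2 hLU]
    exact hL
  · rw [pullCochain_apply, hχ]
    exact if_neg fun H => hv 0 (H 0)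
  · have hext : extendCochain U p (pullCochain Subtype.val p χ) = χ := by
      funext v
      by_cases hv : ∀ i, v i ∈ U
      · rw [extendCochain_of_mem _ hv]
        rfl
      · rw [extendCochain_of_not _ hv, hχ]
        exact (if_neg fun H => hv fun i => hLU (H i)).symm
    rw [hext, mem_locallyZeroCochains]
    intro x
    by_cases hx : x ∈ interior L
    · refine ⟨L, mem_interior_iff_mem_nhds.1 hx, fun v hv => ?_⟩
      simp [hχ, hv]
    · obtain ⟨V, hV, k⟩ := notMem_cochainSupport.1 fun H => hx (hφL H)
      refine ⟨V, hV, fun v hv => ?_⟩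
      simp [hχ, k v hv]

theorem exists_carriedCochains_sub_mem [T2Space X] [LocallyCompactSpace X] {p : ℕ}
    {φ : Cochain X p} (hφ : φ ∈ compactCochains X p) :
    ∃ ψ ∈ carriedCochains X p, φ - ψ ∈ locallyZeroCochains X p := by
  obtain ⟨ψ, hψ, h⟩ := exists_extendCochain_sub_mem isOpen_univ hφ (Set.subset_univ _)
  exact ⟨_, extendCochain_mem_carriedCochains hψ, h⟩

end Cochains

/-! ### Small cochains on metric spaces -/

section Metric

variable {X : Type*} [MetricSpace X]

/-- By a Lebesgue number for the carrier, a small tuple meeting it lies in one of the neighbourhoods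
where `φ` vanishes. Local vanishing thus becomes uniform, which allows pullback along discontinuous
maps that move points little. -/
theorem exists_small_eq_zero {p : ℕ} {φ : Cochain X p} (hφ : φ ∈ carriedCochains X p)
    (h : φ ∈ locallyZeroCochains X p) :
    ∃ ε > 0, ∀ v : Fin (p + 1) → X, (∀ i j, dist (v i) (v j) < ε) → φ v = 0 := by
  obtain ⟨K, hK, hφ⟩ := hφ
  rw [mem_locallyZeroCochains] at h
  choose U hU h using h
  obtain ⟨ε, hε, H⟩ := lebesgue_number_lemma_of_metric (c := fun x => interior (U x)) hK
    (fun _ => isOpen_interior)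
    (fun x _ => Set.mem_iUnion.2 ⟨x, mem_interior_iff_mem_nhds.2 (hU x)⟩)
  refine ⟨ε, hε, fun v hv => ?_⟩
  by_cases hvK : ∀ i, v i ∉ K
  · exact hφ v hvK
  · push Not at hvK
    obtain ⟨i, hi⟩ := hvK
    obtain ⟨x, hx⟩ := H _ hi
    exact h x v fun j => interior_subset (hx (hv j i))

theorem prism_mem_carriedCochains {θ : X → X} {p : ℕ} {φ : Cochain X (p + 1)} {K L : Set X}
    (hφ : ∀ v, (∀ i, v i ∉ K) → φ v = 0) (hL : IsCompact L) (hKL : K ⊆ L)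
    (hθ : ∀ x, θ x ∈ K → x ∈ L) : prism θ (p + 1) φ ∈ carriedCochains X p := by
  refine ⟨L, hL, fun v hv => ?_⟩
  exact prism_apply_eq_zero θ Kᶜ (p + 1) φ (fun u hu => hφ u hu) v fun j =>
    ⟨fun H => hv j (hKL H), fun H => hv j (hθ _ H)⟩

open Classical in
/-- A (discontinuous) map moving points by less than `δ` and sending the `δ`-neighbourhood
of `Z` into `Z`. -/
noncomputable def nearRetraction (Z : Set X) (δ : ℝ) (x : X) : X :=
  if x ∈ Z then x else if h : ∃ z ∈ Z, dist x z < δ then h.choose else x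

theorem nearRetraction_of_mem {Z : Set X} {δ : ℝ} {x : X} (h : x ∈ Z) :
    nearRetraction Z δ x = x := if_pos h

theorem nearRetraction_mem {Z : Set X} {δ : ℝ} {x z : X} (hz : z ∈ Z) (h : dist x z < δ) :
    nearRetraction Z δ x ∈ Z := by
  have H : ∃ z ∈ Z, dist x z < δ := ⟨z, hz, h⟩
  by_cases hx : x ∈ Z
  · rwa [nearRetraction_of_mem hx]
  · rw [nearRetraction, if_neg hx, dif_pos H]
    exact H.choose_spec.1

theorem dist_nearRetraction {Z : Set X} {δ : ℝ} (hδ : 0 < δ) (x : X) :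
    dist x (nearRetraction Z δ x) < δ := by
  by_cases hx : x ∈ Z
  · rwa [nearRetraction_of_mem hx, dist_self]
  · rw [nearRetraction, if_neg hx]
    split_ifs with H
    · exact H.choose_spec.2
    · rwa [dist_self]

theorem exists_pos_le_dist {K Z : Set X} (hK : IsCompact K) (hZ : IsClosed Z) (h : K ⊆ Zᶜ) :
    ∃ r > 0, ∀ x ∈ K, ∀ z ∈ Z, r < dist x z := by
  obtain ⟨r, hr, H⟩ := hK.exists_cthickening_subset_open hZ.isOpen_compl h
  refine ⟨r, hr, fun x hx z hz => lt_of_not_ge fun hle => ?_⟩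
  exact H (Metric.mem_cthickening_of_dist_le z x r K hx (by rwa [dist_comm])) hz

/-- Source of the constant `3 * δ`: the prism mixes the points of a tuple with their images. -/
theorem dist_lt_of_near {δ : ℝ} {ι : Type*} {θ : X → X} (hθ : ∀ x, dist x (θ x) < δ) {v : ι → X}
    (hv : ∀ i j, dist (v i) (v j) < δ) {a b : X} (ha : ∃ j, a = v j ∨ a = θ (v j))
    (hb : ∃ j, b = v j ∨ b = θ (v j)) : dist a b < 3 * δ := by
  obtain ⟨i, hi⟩ := ha
  obtain ⟨j, hj⟩ := hb
  have h1 : dist (v i) a < δ := by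
    rcases hi with rfl | rfl
    · exact hv i i
    · exact hθ _
  have h2 : dist (v j) b < δ := by
    rcases hj with rfl | rfl
    · exact hv j j
    · exact hθ _
  have h3 := dist_triangle4 a (v i) (v j) b
  rw [dist_comm a (v i)] at h3
  linarith [hv i j]

variable [LocallyCompactSpace X] {Z : Set X}

/-- A cochain which is locally zero on the closed set `Z` and closed near `Z` is cohomologous to
one supported away from `Z`. -/
theorem exists_extendCochain_sub_mem_compactCoboundaries (hZ : IsClosed Z) {p : ℕ}
    {φ : Cochain X p} (hφ : φ ∈ carriedCochains X p)
    (hφZ : pullCochain (Subtype.val : Z → X) p φ ∈ locallyZeroCochains Z p)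
    {ψ : Cochain (Zᶜ : Set X) (p + 1)} (hψ : ψ ∈ carriedCochains (Zᶜ : Set X) (p + 1))
    (h : coboundary X p φ - extendCochain Zᶜ (p + 1) ψ ∈ locallyZeroCochains X (p + 1)) :
    ∃ φ₁ ∈ carriedCochains (Zᶜ : Set X) p,
      φ - extendCochain Zᶜ p φ₁ ∈ compactCoboundaries X p := by
  have hZe : IsClosedEmbedding (Subtype.val : Z → X) := hZ.isClosedEmbedding_subtypeVal
  obtain ⟨K, hK, hφK⟩ := id hφ
  obtain ⟨ε₁, hε₁, h₁⟩ := exists_small_eq_zero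
    (φ := pullCochain (Subtype.val : Z → X) p φ)
    ⟨_, hZe.isCompact_preimage hK, fun v hv => hφK _ hv⟩ hφZ
  obtain ⟨ε₂, hε₂, h₂⟩ := exists_small_eq_zero (sub_mem (coboundary_mem_carriedCochains hφ)
    (extendCochain_mem_carriedCochains hψ)) h
  obtain ⟨M, hM, hψM⟩ := id hψ
  obtain ⟨ε₃, hε₃, h₃⟩ := exists_pos_le_dist (hM.image continuous_subtype_val) hZ
    (by rintro _ ⟨y, -, rfl⟩; exact y.2)
  obtain ⟨ε₄, hε₄, h₄⟩ := hK.exists_isCompact_cthickening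
  -- `ε₁` makes `φ` vanish on small tuples in `Z`, `ε₂` makes its coboundary equal to the extension
  -- of `ψ` on small tuples, `ε₃` separates `Z` from the carrier of `ψ`, and `ε₄` keeps the prism
  -- compactly carried.
  obtain ⟨δ, hδ, hδ₁, hδ₂, hδ₃, hδ₄⟩ :
      ∃ δ > 0, 3 * δ ≤ ε₁ ∧ 3 * δ ≤ ε₂ ∧ δ ≤ ε₃ ∧ δ ≤ ε₄ := by
    refine ⟨min (min (ε₁ / 3) (ε₂ / 3)) (min ε₃ ε₄), by positivity, ?_, ?_, ?_, ?_⟩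
    · have := (min_le_left (min (ε₁ / 3) (ε₂ / 3)) (min ε₃ ε₄)).trans (min_le_left _ _)
      linarith
    · have := (min_le_left (min (ε₁ / 3) (ε₂ / 3)) (min ε₃ ε₄)).trans (min_le_right _ _)
      linarith
    · exact (min_le_right _ _).trans (min_le_left _ _)
    · exact (min_le_right _ _).trans (min_le_right _ _)
  set θ := nearRetraction Z δ with hθ
  have hθd : ∀ x, dist x (θ x) < δ := dist_nearRetraction hδ
  have hprism : ∀ q, p = q + 1 → ∀ φ' : Cochain X (q + 1), HEq φ φ' →
      prism θ (q + 1) φ' ∈ carriedCochains X q := by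
    rintro q rfl φ' hφ'
    obtain rfl := eq_of_heq hφ'
    refine prism_mem_carriedCochains hφK h₄ (Metric.self_subset_cthickening K) fun x hx => ?_
    exact Metric.mem_cthickening_of_dist_le x _ _ K hx ((hθd x).le.trans hδ₄)
  -- Take `φ` plus the coboundary of its prism. Near `Z` the map `θ` lands in `Z`, where `φ`
  -- vanishes on small tuples, and the prism of the coboundary vanishes too; the homotopy formula
  -- leaves zero.
  obtain ⟨φ₂, hφ₂, hφ₂Z⟩ : ∃ φ₂, φ - φ₂ ∈ compactCoboundaries X p ∧
      ∀ v : Fin (p + 1) → X, (∀ i j, dist (v i) (v j) < δ) → (∀ i, ∃ z ∈ Z, dist (v i) z < δ) →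
        φ₂ v = 0 := by
    have key : ∀ v : Fin (p + 1) → X, (∀ i j, dist (v i) (v j) < δ) →
        (∀ i, ∃ z ∈ Z, dist (v i) z < δ) → φ v + faceSum X p (prism θ p φ) v = 0 := by
      intro v hv hvZ
      have e := faceSum_prism θ p φ v
      have hθZ : ∀ i, θ (v i) ∈ Z := fun i => by
        obtain ⟨z, hz, hd⟩ := hvZ i
        exact nearRetraction_mem hz hd
      have e1 : φ (θ ∘ v) = 0 := by
        refine h₁ (fun i => ⟨θ (v i), hθZ i⟩) fun i j => ?_
        exact (dist_lt_of_near hθd hv ⟨i, Or.inr rfl⟩ ⟨j, Or.inr rfl⟩).trans_le hδ₁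
      have e2 : prism θ (p + 1) (faceSum X (p + 1) φ) v = 0 := by
        refine prism_apply_eq_zero θ {a | ∃ j, a = v j ∨ a = θ (v j)} _ _ (fun u hu => ?_) v
          fun j => ⟨⟨j, Or.inl rfl⟩, ⟨j, Or.inr rfl⟩⟩
        have e3 := h₂ u fun i j => (dist_lt_of_near hθd hv (hu i) (hu j)).trans_le hδ₂
        rw [Pi.sub_apply, extendCochain_apply_of_notMem hψM, sub_zero] at e3
        · exact e3
        · intro i hi
          obtain ⟨j, hj | hj⟩ := hu i
          · obtain ⟨z, hz, hd⟩ := hvZ j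
            exact absurd (h₃ _ hi z hz) (not_lt.2 (by rw [hj]; exact hd.le.trans hδ₃))
          · have := h₃ _ hi (u i) (by rw [hj]; exact hθZ j)
            rw [dist_self] at this
            exact absurd this (not_lt.2 hε₃.le)
      rw [e1, e2] at e
      linarith
    cases p with
    | zero =>
      refine ⟨φ, by rw [sub_self]; exact zero_mem _, fun v hv hvZ => ?_⟩
      have := key v hv hvZ
      simpa [prism] using this
    | succ q =>
      refine ⟨φ + coboundary X q (prism θ (q + 1) φ), ?_, key⟩
      rw [mem_compactCoboundaries_succ]
      refine ⟨-prism θ (q + 1) φ, neg_mem (carriedCochains_le _ (hprism q rfl φ HEq.rfl)), ?_⟩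
      rw [map_neg]
      simp
  have hsupp : cochainSupport φ₂ ⊆ Zᶜ := by
    intro x hx hxZ
    refine notMem_cochainSupport.2 ⟨Metric.ball x (δ / 2), Metric.ball_mem_nhds x (by positivity),
      fun v hv => hφ₂Z v (fun i j => ?_) fun i => ⟨x, hxZ, ?_⟩⟩ hx
    · have := dist_triangle_right (v i) (v j) x
      have h1 := Metric.mem_ball.1 (hv i)
      have h2 := Metric.mem_ball.1 (hv j)
      linarith
    · have h1 := Metric.mem_ball.1 (hv i)
      linarith
  have hc : φ₂ ∈ compactCochains X p := by
    have := sub_mem (carriedCochains_le p hφ) (compactCoboundaries_le_compactCocycles p hφ₂).1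
    rwa [sub_sub_cancel] at this
  obtain ⟨φ₁, hφ₁, H⟩ := exists_extendCochain_sub_mem hZ.isOpen_compl hc hsupp
  refine ⟨φ₁, hφ₁, ?_⟩
  have := add_mem hφ₂ (locallyZeroCochains_le_compactCoboundaries p H)
  rwa [sub_add_sub_cancel] at this

/-- Every carried cocycle on `Z` extends to a carried cochain on `X` which is closed near `Z`. -/
theorem exists_extension_of_cocycle (hZ : IsClosed Z) {p : ℕ} {ζ : Cochain Z p}
    (hζ : ζ ∈ carriedCochains Z p) (h : coboundary Z p ζ ∈ locallyZeroCochains Z (p + 1)) :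
    ∃ φ ∈ carriedCochains X p, pullCochain Subtype.val p φ = ζ ∧
      ∃ ψ ∈ carriedCochains (Zᶜ : Set X) (p + 1),
        coboundary X p φ - extendCochain Zᶜ (p + 1) ψ ∈ locallyZeroCochains X (p + 1) := by
  obtain ⟨K, hK, hζK⟩ := id hζ
  obtain ⟨ε₁, hε₁, h₁⟩ := exists_small_eq_zero (coboundary_mem_carriedCochains hζ) h
  have hK' := hK.image continuous_subtype_val
  obtain ⟨ε₄, hε₄, h₄⟩ := hK'.exists_isCompact_cthickening
  obtain ⟨δ, hδ, hδ₁, hδ₄⟩ : ∃ δ > 0, 3 * δ ≤ ε₁ ∧ δ ≤ ε₄ := by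
    refine ⟨min (ε₁ / 3) ε₄, by positivity, ?_, min_le_right _ _⟩
    have := min_le_left (ε₁ / 3) ε₄
    linarith
  set θ := nearRetraction Z δ with hθ
  have hθd : ∀ x, dist x (θ x) < δ := dist_nearRetraction hδ
  -- Extend along the near-retraction onto `Z`. Small tuples near `Z` are sent to small tuples of
  -- `Z`, so the cocycle condition survives near `Z`.
  set φ : Cochain X p := pullCochain θ p (extendCochain Z p ζ) with hφ
  have hφc : φ ∈ carriedCochains X p := by
    refine ⟨_, h₄, fun v hv => extendCochain_apply_of_notMem hζK fun i hi => hv i ?_⟩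
    exact Metric.mem_cthickening_of_dist_le _ _ _ _ hi ((hθd _).le.trans hδ₄)
  refine ⟨φ, hφc, ?_, ?_⟩
  · funext v
    rw [pullCochain_apply, hφ, pullCochain_apply]
    have : θ ∘ Subtype.val ∘ v = Subtype.val ∘ v := by
      funext i
      exact nearRetraction_of_mem (v i).2
    rw [this]
    exact congrFun (pullCochain_extendCochain ζ) v
  · refine exists_extendCochain_sub_mem hZ.isOpen_compl (carriedCochains_le _
      (coboundary_mem_carriedCochains hφc)) fun x hx hxZ => ?_
    refine notMem_cochainSupport.2 ⟨Metric.ball x (δ / 2), Metric.ball_mem_nhds x (by positivity),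
      fun v hv => ?_⟩ hx
    have hv1 : ∀ i j, dist (v i) (v j) < δ := fun i j => by
      have := dist_triangle_right (v i) (v j) x
      have h1 := Metric.mem_ball.1 (hv i)
      have h2 := Metric.mem_ball.1 (hv j)
      linarith
    have hvZ : ∀ i, θ (v i) ∈ Z := fun i => by
      refine nearRetraction_mem hxZ ?_
      have h1 := Metric.mem_ball.1 (hv i)
      linarith
    have e := h₁ (fun i => ⟨θ (v i), hvZ i⟩) fun i j =>
      (dist_lt_of_near hθd hv1 ⟨i, Or.inr rfl⟩ ⟨j, Or.inr rfl⟩).trans_le hδ₁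
    rw [hφ, coboundary_pullCochain, pullCochain_apply]
    rw [← pullCochain_extendCochain ζ, coboundary_pullCochain] at e
    exact e

end Metric

/-! ### The long exact sequence of a closed subset -/

section LongExact

/-- Used to define a map on cohomology through convenient representatives of each class, such as
carried ones. -/
theorem exists_linearMap_factor {M N P : Type*} [AddCommGroup M] [AddCommGroup N] [AddCommGroup P]
    (f : M →ₗ[ℤ] N) (g : M →ₗ[ℤ] P) (hf : Function.Surjective f)
    (h : ∀ m, f m = 0 → g m = 0) : ∃ k : N →ₗ[ℤ] P, ∀ m, k (f m) = g m := by
  refine ⟨(f.ker.liftQ g h).comp (f.quotKerEquivOfSurjective hf).symm.toLinearMap, fun m => ?_⟩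
  have : (f.quotKerEquivOfSurjective hf).symm (f m) = Submodule.Quotient.mk m := by
    rw [LinearEquiv.symm_apply_eq]
    rfl
  rw [LinearMap.comp_apply, LinearEquiv.coe_coe, this]
  exact Submodule.liftQ_apply _ _ _

section Class

variable {X : Type*} [TopologicalSpace X]

variable (X) in
/-- The cohomology class of a cocycle. -/
def cohomologyClass (p : ℕ) : compactCocycles X p →ₗ[ℤ] CompactCohomology X p :=
  Submodule.mkQ _

theorem cohomologyClass_surjective (p : ℕ) : Function.Surjective (cohomologyClass X p) :=
  Submodule.mkQ_surjective _

theorem cohomologyClass_eq_zero {p : ℕ} {φ : compactCocycles X p} :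
    cohomologyClass X p φ = 0 ↔ (φ : Cochain X p) ∈ compactCoboundaries X p := by
  rw [cohomologyClass, Submodule.mkQ_apply, Submodule.Quotient.mk_eq_zero]
  rfl

theorem cohomologyClass_eq {p : ℕ} {φ ψ : compactCocycles X p} :
    cohomologyClass X p φ = cohomologyClass X p ψ ↔
      (φ : Cochain X p) - ψ ∈ compactCoboundaries X p := by
  rw [← sub_eq_zero, ← map_sub, cohomologyClass_eq_zero]
  rfl

variable [T2Space X] [LocallyCompactSpace X]

theorem exists_carried_cocycle {p : ℕ} {φ : Cochain X p} (h : φ ∈ compactCocycles X p) :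
    ∃ ψ ∈ carriedCochains X p, ψ ∈ compactCocycles X p ∧ φ - ψ ∈ locallyZeroCochains X p := by
  obtain ⟨ψ, hψ, k⟩ := exists_carriedCochains_sub_mem h.1
  refine ⟨ψ, hψ, ?_, k⟩
  have := sub_mem h (locallyZeroCochains_le_compactCocycles p k)
  rwa [sub_sub_cancel] at this

theorem exists_carried_primitive {p : ℕ} {φ : Cochain X (p + 1)}
    (h : φ ∈ compactCoboundaries X (p + 1)) :
    ∃ η ∈ carriedCochains X p, φ - coboundary X p η ∈ locallyZeroCochains X (p + 1) := by
  rw [mem_compactCoboundaries_succ] at h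
  obtain ⟨η, hη, h⟩ := h
  obtain ⟨η', hη', k⟩ := exists_carriedCochains_sub_mem hη
  refine ⟨η', hη', ?_⟩
  have := add_mem h (coboundary_mem_locallyZeroCochains k)
  rwa [map_sub, sub_add_sub_cancel] at this

end Class

theorem pullCochain_extendCochain_compl {X : Type*} {Z : Set X} {p : ℕ} (φ : Cochain (Zᶜ : Set X) p) :
    pullCochain (Subtype.val : Z → X) p (extendCochain Zᶜ p φ) = 0 := by
  funext v
  exact extendCochain_of_not φ fun h => h 0 (v 0).2

variable {X : Type*} [MetricSpace X] {Z : Set X}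

theorem extendCochain_mem_compactCocycles {U : Set X} (hU : IsOpen U) {p : ℕ} {φ : Cochain U p}
    (hφ : φ ∈ carriedCochains U p) (h : coboundary U p φ ∈ locallyZeroCochains U (p + 1)) :
    extendCochain U p φ ∈ compactCocycles X p := by
  refine ⟨carriedCochains_le _ (extendCochain_mem_carriedCochains hφ), ?_⟩
  have := add_mem (coboundary_extendCochain_sub_mem hU hφ)
    (extendCochain_mem_locallyZeroCochains hU (coboundary_mem_carriedCochains hφ) h)
  rwa [sub_add_cancel] at this

variable [LocallyCompactSpace X]

theorem extendCochain_mem_compactCoboundaries {U : Set X} (hU : IsOpen U) {p : ℕ}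
    {φ : Cochain U p} (hφ : φ ∈ carriedCochains U p) (h : φ ∈ compactCoboundaries U p) :
    extendCochain U p φ ∈ compactCoboundaries X p := by
  have : LocallyCompactSpace U := hU.locallyCompactSpace
  cases p with
  | zero => exact extendCochain_mem_locallyZeroCochains hU hφ h
  | succ p =>
    obtain ⟨η, hη, k⟩ := exists_carried_primitive h
    rw [mem_compactCoboundaries_succ]
    refine ⟨_, carriedCochains_le _ (extendCochain_mem_carriedCochains hη), ?_⟩
    have h1 := extendCochain_mem_locallyZeroCochains hU
      (sub_mem hφ (coboundary_mem_carriedCochains hη)) k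
    have := sub_mem h1 (coboundary_extendCochain_sub_mem hU hη)
    rw [map_sub] at this
    rwa [sub_sub_sub_cancel_right] at this

/-- A cochain whose restriction to `Z` bounds, and which is closed near `Z`, is cohomologous to one
supported away from `Z`. -/
theorem exists_extendCochain_of_restrict_mem (hZ : IsClosed Z) {p : ℕ}
    {φ : Cochain X p} (hφ : φ ∈ carriedCochains X p)
    (hφZ : pullCochain (Subtype.val : Z → X) p φ ∈ compactCoboundaries Z p)
    {ψ : Cochain (Zᶜ : Set X) (p + 1)} (hψ : ψ ∈ carriedCochains (Zᶜ : Set X) (p + 1))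
    (h : coboundary X p φ - extendCochain Zᶜ (p + 1) ψ ∈ locallyZeroCochains X (p + 1)) :
    ∃ φ₁ ∈ carriedCochains (Zᶜ : Set X) p,
      φ - extendCochain Zᶜ p φ₁ ∈ compactCoboundaries X p ∧
      coboundary _ p φ₁ - ψ ∈ locallyZeroCochains (Zᶜ : Set X) (p + 1) := by
  have : LocallyCompactSpace Z := hZ.locallyCompactSpace
  -- The statement on the coboundary of `φ₁` is automatic: a cochain on the complement is locally
  -- zero as soon as its extension by zero is.
  suffices H : ∃ φ₁ ∈ carriedCochains (Zᶜ : Set X) p,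
      φ - extendCochain Zᶜ p φ₁ ∈ compactCoboundaries X p by
    obtain ⟨φ₁, hφ₁, H⟩ := H
    refine ⟨φ₁, hφ₁, H, ?_⟩
    have h1 := (compactCoboundaries_le_compactCocycles p H).2
    have h2 := coboundary_extendCochain_sub_mem hZ.isOpen_compl hφ₁
    apply mem_locallyZeroCochains_of_extendCochain
    rw [map_sub]
    have h3 : coboundary X p φ - coboundary X p (extendCochain Zᶜ p φ₁) ∈
        locallyZeroCochains X (p + 1) := by
      rw [← map_sub]
      exact h1
    have := neg_mem (sub_mem (add_mem h2 h3) h)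
    convert this using 1
    abel
  cases p with
  | zero => exact exists_extendCochain_sub_mem_compactCoboundaries hZ hφ hφZ hψ h
  | succ p =>
    obtain ⟨c, hc, k⟩ := exists_carried_primitive hφZ
    -- The primitive `c` of the restriction extends to `X` by zero. Subtracting its coboundary
    -- reduces to a cochain that is locally zero on `Z`.
    have hcX := extendCochain_mem_carriedCochains hc
    have e : coboundary X (p + 1) (φ - coboundary X p (extendCochain Z p c)) =
        coboundary X (p + 1) φ := by
      rw [map_sub, coboundary_coboundary, sub_zero]
    obtain ⟨φ₁, hφ₁, H⟩ := exists_extendCochain_sub_mem_compactCoboundaries hZ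
      (φ := φ - coboundary X p (extendCochain Z p c))
      (sub_mem hφ (coboundary_mem_carriedCochains hcX))
      (by rwa [map_sub, ← coboundary_pullCochain, pullCochain_extendCochain]) hψ
      (by rwa [e])
    refine ⟨φ₁, hφ₁, ?_⟩
    have h1 : coboundary X p (extendCochain Z p c) ∈ compactCoboundaries X (p + 1) := by
      rw [mem_compactCoboundaries_succ]
      exact ⟨_, carriedCochains_le _ hcX, by rw [sub_self]; exact zero_mem _⟩
    have := add_mem H h1
    convert this using 1
    abel

/-- The long exact sequence of a closed subset in cohomology with compact supports. -/
theorem exists_long_exact_sequence (hZ : IsClosed Z) :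
    ∃ (i : ∀ p, CompactCohomology (Zᶜ : Set X) p →ₗ[ℤ] CompactCohomology X p)
      (r : ∀ p, CompactCohomology X p →ₗ[ℤ] CompactCohomology Z p)
      (δ : ∀ p, CompactCohomology Z p →ₗ[ℤ] CompactCohomology (Zᶜ : Set X) (p + 1)),
      Function.Injective (i 0) ∧ ∀ p, Function.Exact (i p) (r p) ∧ Function.Exact (r p) (δ p) ∧
        Function.Exact (δ p) (i (p + 1)) := by
  have hU : IsOpen (Zᶜ : Set X) := hZ.isOpen_compl
  have hZe : IsClosedEmbedding (Subtype.val : Z → X) := hZ.isClosedEmbedding_subtypeVal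
  have : LocallyCompactSpace (Zᶜ : Set X) := hU.locallyCompactSpace
  have : LocallyCompactSpace Z := hZ.locallyCompactSpace
  -- the map `i`
  have hi : ∀ p, ∃ i : CompactCohomology (Zᶜ : Set X) p →ₗ[ℤ] CompactCohomology X p,
      ∀ φ (hφ : φ ∈ carriedCochains (Zᶜ : Set X) p) (h : φ ∈ compactCocycles (Zᶜ : Set X) p),
        i (cohomologyClass _ p ⟨φ, h⟩) = cohomologyClass X p
          ⟨extendCochain _ p φ, extendCochain_mem_compactCocycles hU hφ h.2⟩ := by
    intro p
    let M := (carriedCochains (Zᶜ : Set X) p ⊓ compactCocycles (Zᶜ : Set X) p : Submodule ℤ _)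
    let f : M →ₗ[ℤ] CompactCohomology (Zᶜ : Set X) p :=
      (cohomologyClass _ p).comp (Submodule.inclusion inf_le_right)
    let g : M →ₗ[ℤ] CompactCohomology X p := (cohomologyClass X p).comp
      (((extendCochain (Zᶜ : Set X) p).comp M.subtype).codRestrict _
        fun m => extendCochain_mem_compactCocycles hU m.2.1 m.2.2.2)
    have hf : Function.Surjective f := by
      intro y
      obtain ⟨⟨φ, hφ⟩, rfl⟩ := cohomologyClass_surjective p y
      obtain ⟨ψ, hψ, hψ', h⟩ := exists_carried_cocycle hφ
      refine ⟨⟨ψ, hψ, hψ'⟩, Eq.symm ?_⟩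
      exact cohomologyClass_eq.2 (locallyZeroCochains_le_compactCoboundaries p h)
    have hfg : ∀ m, f m = 0 → g m = 0 := fun m hm => cohomologyClass_eq_zero.2
      (extendCochain_mem_compactCoboundaries hU m.2.1 (cohomologyClass_eq_zero.1 hm))
    obtain ⟨k, hk⟩ := exists_linearMap_factor f g hf hfg
    exact ⟨k, fun φ hφ h => hk ⟨φ, hφ, h⟩⟩
  -- the map `r`
  have hr : ∀ p, ∃ r : CompactCohomology X p →ₗ[ℤ] CompactCohomology Z p,
      ∀ φ (h : φ ∈ compactCocycles X p), r (cohomologyClass X p ⟨φ, h⟩) =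
        cohomologyClass Z p ⟨pullCochain Subtype.val p φ, pullCochain_mem_compactCocycles hZe h⟩ := by
    intro p
    let g : compactCocycles X p →ₗ[ℤ] CompactCohomology Z p := (cohomologyClass Z p).comp
      (((pullCochain (Subtype.val : Z → X) p).comp (compactCocycles X p).subtype).codRestrict _
        fun m => pullCochain_mem_compactCocycles hZe m.2)
    have hg : ∀ m, cohomologyClass X p m = 0 → g m = 0 := fun m hm => cohomologyClass_eq_zero.2
      (pullCochain_mem_compactCoboundaries hZe (cohomologyClass_eq_zero.1 hm))
    obtain ⟨k, hk⟩ := exists_linearMap_factor _ g (cohomologyClass_surjective p) hg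
    exact ⟨k, fun φ h => hk ⟨φ, h⟩⟩
  -- pairs used for the connecting map
  have hD1 : ∀ {p} {φ : Cochain X p} {ψ : Cochain (Zᶜ : Set X) (p + 1)},
      φ ∈ carriedCochains X p →
      coboundary X p φ - extendCochain _ (p + 1) ψ ∈ locallyZeroCochains X (p + 1) →
      pullCochain (Subtype.val : Z → X) p φ ∈ compactCocycles Z p := by
    intro p φ ψ hφ h
    refine ⟨pullCochain_mem_compactCochains hZe (carriedCochains_le _ hφ), ?_⟩
    have := pullCochain_mem_locallyZeroCochains hZe.continuous h
    rw [map_sub, pullCochain_extendCochain_compl, sub_zero] at this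
    exact this
  have hD2 : ∀ {p} {φ : Cochain X p} {ψ : Cochain (Zᶜ : Set X) (p + 1)},
      ψ ∈ carriedCochains (Zᶜ : Set X) (p + 1) →
      coboundary X p φ - extendCochain _ (p + 1) ψ ∈ locallyZeroCochains X (p + 1) →
      ψ ∈ compactCocycles (Zᶜ : Set X) (p + 1) := by
    intro p φ ψ hψ h
    refine ⟨carriedCochains_le _ hψ, ?_⟩
    apply mem_locallyZeroCochains_of_extendCochain
    have h1 := coboundary_extendCochain_sub_mem hU hψ
    have h2 := coboundary_mem_locallyZeroCochains h
    rw [map_sub, coboundary_coboundary, zero_sub] at h2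
    have := neg_mem (add_mem h1 h2)
    convert this using 1
    abel
  have hδ : ∀ p, ∃ δ : CompactCohomology Z p →ₗ[ℤ] CompactCohomology (Zᶜ : Set X) (p + 1),
      ∀ φ (hφ : φ ∈ carriedCochains X p) ψ (hψ : ψ ∈ carriedCochains (Zᶜ : Set X) (p + 1))
        (h : coboundary X p φ - extendCochain _ (p + 1) ψ ∈ locallyZeroCochains X (p + 1)),
        δ (cohomologyClass Z p ⟨pullCochain Subtype.val p φ, hD1 hφ h⟩) =
          cohomologyClass _ (p + 1) ⟨ψ, hD2 hψ h⟩ := by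
    intro p
    -- The snake relation: pairs of a cochain on `X` and a cochain on the complement representing
    -- its coboundary. Every class of `Z` lifts to such a pair, and `δ` reads off the second entry.
    let D : Submodule ℤ (Cochain X p × Cochain (Zᶜ : Set X) (p + 1)) :=
      (carriedCochains X p).comap (LinearMap.fst ℤ _ _) ⊓
        ((carriedCochains (Zᶜ : Set X) (p + 1)).comap (LinearMap.snd ℤ _ _) ⊓
        (locallyZeroCochains X (p + 1)).comap ((coboundary X p).comp (LinearMap.fst ℤ _ _) -
          (extendCochain (Zᶜ : Set X) (p + 1)).comp (LinearMap.snd ℤ _ _)))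
    let f : D →ₗ[ℤ] CompactCohomology Z p := (cohomologyClass Z p).comp
      (((pullCochain (Subtype.val : Z → X) p).comp
        ((LinearMap.fst ℤ _ _).comp D.subtype)).codRestrict _ fun m => hD1 m.2.1 m.2.2.2)
    let g : D →ₗ[ℤ] CompactCohomology (Zᶜ : Set X) (p + 1) :=
      (cohomologyClass (Zᶜ : Set X) (p + 1)).comp
        (((LinearMap.snd ℤ _ _).comp D.subtype).codRestrict _ fun m => hD2 m.2.2.1 m.2.2.2)
    have hf : Function.Surjective f := by
      intro y
      obtain ⟨⟨ζ, hζ⟩, rfl⟩ := cohomologyClass_surjective p y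
      obtain ⟨ζ', hζc, hζ', h⟩ := exists_carried_cocycle hζ
      obtain ⟨φ, hφ, e, ψ, hψ, k⟩ := exists_extension_of_cocycle hZ hζc hζ'.2
      refine ⟨⟨(φ, ψ), hφ, hψ, k⟩, Eq.symm (cohomologyClass_eq.2 ?_)⟩
      refine locallyZeroCochains_le_compactCoboundaries p ?_
      change ζ - pullCochain Subtype.val p φ ∈ _
      rwa [e]
    have hfg : ∀ m, f m = 0 → g m = 0 := by
      rintro ⟨⟨φ, ψ⟩, hφ, hψ, h⟩ hm
      obtain ⟨φ₁, hφ₁, -, k⟩ := exists_extendCochain_of_restrict_mem hZ hφ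
        (cohomologyClass_eq_zero.1 hm) hψ h
      refine cohomologyClass_eq_zero.2 (mem_compactCoboundaries_succ.2
        ⟨φ₁, carriedCochains_le _ hφ₁, ?_⟩)
      have := neg_mem k
      rwa [neg_sub] at this
    obtain ⟨k, hk⟩ := exists_linearMap_factor f g hf hfg
    exact ⟨k, fun φ hφ ψ hψ h => hk ⟨(φ, ψ), hφ, hψ, h⟩⟩
  choose i hi using hi
  choose r hr using hr
  choose δ hδ using hδ
  refine ⟨i, r, δ, ?_, fun p => ⟨?_, ?_, ?_⟩⟩
  -- In degree `0` the only coboundaries are the locally zero cochains, and extension by zero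
  -- reflects these.
  · rw [injective_iff_map_eq_zero]
    intro y hy
    obtain ⟨⟨φ', hφ'⟩, rfl⟩ := cohomologyClass_surjective 0 y
    obtain ⟨φ, hφc, hφ, h⟩ := exists_carried_cocycle hφ'
    have e : cohomologyClass (Zᶜ : Set X) 0 ⟨φ', hφ'⟩ = cohomologyClass _ 0 ⟨φ, hφ⟩ :=
      cohomologyClass_eq.2 h
    rw [e, hi 0 φ hφc hφ, cohomologyClass_eq_zero] at hy
    rw [e, cohomologyClass_eq_zero]
    exact mem_locallyZeroCochains_of_extendCochain hy
  · intro y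
    constructor
    · intro hy
      obtain ⟨⟨φ', hφ'⟩, rfl⟩ := cohomologyClass_surjective p y
      obtain ⟨φ, hφc, hφ, h⟩ := exists_carried_cocycle hφ'
      have e : cohomologyClass X p ⟨φ', hφ'⟩ = cohomologyClass _ p ⟨φ, hφ⟩ :=
        cohomologyClass_eq.2 (locallyZeroCochains_le_compactCoboundaries p h)
      rw [e, hr p φ hφ, cohomologyClass_eq_zero] at hy
      -- Since `φ` is a cocycle, `ψ = 0` is allowed, and then `φ₁` is itself a cocycle on the
      -- complement.
      obtain ⟨φ₁, hφ₁, k, k'⟩ := exists_extendCochain_of_restrict_mem hZ hφc hy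
        (zero_mem _) (by rw [map_zero, sub_zero]; exact hφ.2)
      rw [sub_zero] at k'
      have hφ₁' : φ₁ ∈ compactCocycles (Zᶜ : Set X) p := ⟨carriedCochains_le _ hφ₁, k'⟩
      refine ⟨cohomologyClass _ p ⟨φ₁, hφ₁'⟩, ?_⟩
      rw [e, hi p φ₁ hφ₁]
      exact (cohomologyClass_eq.2 k).symm
    · rintro ⟨x, rfl⟩
      obtain ⟨⟨φ', hφ'⟩, rfl⟩ := cohomologyClass_surjective p x
      obtain ⟨φ, hφc, hφ, h⟩ := exists_carried_cocycle hφ'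
      have e : cohomologyClass (Zᶜ : Set X) p ⟨φ', hφ'⟩ = cohomologyClass _ p ⟨φ, hφ⟩ :=
        cohomologyClass_eq.2 (locallyZeroCochains_le_compactCoboundaries p h)
      rw [e, hi p φ hφc hφ, hr, cohomologyClass_eq_zero]
      change pullCochain _ p _ ∈ _
      rw [pullCochain_extendCochain_compl]
      exact zero_mem _
  · intro y
    constructor
    · intro hy
      obtain ⟨⟨ζ', hζ'⟩, rfl⟩ := cohomologyClass_surjective p y
      obtain ⟨ζ, hζc, hζ, h⟩ := exists_carried_cocycle hζ'
      obtain ⟨φ, hφ, rfl, ψ, hψ, k⟩ := exists_extension_of_cocycle hZ hζc hζ.2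
      have e : cohomologyClass Z p ⟨ζ', hζ'⟩ = cohomologyClass _ p ⟨_, hζ⟩ :=
        cohomologyClass_eq.2 (locallyZeroCochains_le_compactCoboundaries p h)
      rw [e, hδ p φ hφ ψ hψ k, cohomologyClass_eq_zero] at hy
      obtain ⟨η, hη, hy⟩ := exists_carried_primitive hy
      have hηX := extendCochain_mem_carriedCochains (X := X) hη
      -- Removing the extension of a primitive of `ψ` makes the lift closed and leaves its
      -- restriction to `Z` unchanged.
      have hc : φ - extendCochain _ p η ∈ compactCocycles X p := by
        refine ⟨carriedCochains_le _ (sub_mem hφ hηX), ?_⟩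
        change coboundary X p (φ - extendCochain _ p η) ∈ locallyZeroCochains X (p + 1)
        have h1 := coboundary_extendCochain_sub_mem hU hη
        have h2 := extendCochain_mem_locallyZeroCochains hU
          (sub_mem hψ (coboundary_mem_carriedCochains hη)) hy
        have := sub_mem (add_mem k h2) h1
        rw [map_sub] at this ⊢
        convert this using 1
        abel
      refine ⟨cohomologyClass X p ⟨_, hc⟩, ?_⟩
      rw [hr, e, cohomologyClass_eq]
      change pullCochain _ p _ - _ ∈ _
      rw [map_sub, pullCochain_extendCochain_compl, sub_zero, sub_self]
      exact zero_mem _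
    · rintro ⟨x, rfl⟩
      obtain ⟨⟨φ', hφ'⟩, rfl⟩ := cohomologyClass_surjective p x
      obtain ⟨φ, hφc, hφ, h⟩ := exists_carried_cocycle hφ'
      have e : cohomologyClass X p ⟨φ', hφ'⟩ = cohomologyClass _ p ⟨φ, hφ⟩ :=
        cohomologyClass_eq.2 (locallyZeroCochains_le_compactCoboundaries p h)
      rw [e, hr, hδ p φ hφc 0 (zero_mem _) (by rw [map_zero, sub_zero]; exact hφ.2),
        cohomologyClass_eq_zero]
      exact zero_mem _
  · intro y
    constructor
    · intro hy
      obtain ⟨⟨ψ', hψ'⟩, rfl⟩ := cohomologyClass_surjective (p + 1) y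
      obtain ⟨ψ, hψc, hψ, h⟩ := exists_carried_cocycle hψ'
      have e : cohomologyClass (Zᶜ : Set X) (p + 1) ⟨ψ', hψ'⟩ = cohomologyClass _ (p + 1) ⟨ψ, hψ⟩ :=
        cohomologyClass_eq.2 (locallyZeroCochains_le_compactCoboundaries _ h)
      rw [e, hi _ ψ hψc hψ, cohomologyClass_eq_zero] at hy
      obtain ⟨φ, hφ, k⟩ := exists_carried_primitive hy
      refine ⟨_, (hδ p φ hφ ψ hψc ?_).trans e.symm⟩
      have := neg_mem k
      rwa [neg_sub] at this
    · rintro ⟨x, rfl⟩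
      obtain ⟨⟨ζ', hζ'⟩, rfl⟩ := cohomologyClass_surjective p x
      obtain ⟨ζ, hζc, hζ, h⟩ := exists_carried_cocycle hζ'
      obtain ⟨φ, hφ, rfl, ψ, hψ, k⟩ := exists_extension_of_cocycle hZ hζc hζ.2
      have e : cohomologyClass Z p ⟨ζ', hζ'⟩ = cohomologyClass _ p ⟨_, hζ⟩ :=
        cohomologyClass_eq.2 (locallyZeroCochains_le_compactCoboundaries p h)
      rw [e, hδ p φ hφ ψ hψ k, hi _ ψ hψ, cohomologyClass_eq_zero, mem_compactCoboundaries_succ]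
      refine ⟨φ, carriedCochains_le _ hφ, ?_⟩
      have := neg_mem k
      rwa [neg_sub] at this

end LongExact

universe u

/-! ### Additivity of the Euler characteristic -/

section Ranks

/-- A sequence of finite cardinals, almost all zero. -/
def FinitelySupported (h : ℕ → Cardinal) : Prop :=
  (∀ p, h p < Cardinal.aleph0) ∧ {p | h p ≠ 0}.Finite

theorem FinitelySupported.exists_nat {h : ℕ → Cardinal} (H : FinitelySupported h) :
    ∃ (n : ℕ → ℕ) (N : ℕ), (∀ p, h p = n p) ∧ ∀ p ≥ N, n p = 0 := by
  choose n hn using fun p => Cardinal.lt_aleph0.1 (H.1 p)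
  obtain ⟨N, hN⟩ := H.2.bddAbove
  refine ⟨n, N + 1, hn, fun p hp => ?_⟩
  by_contra h0
  have : p ≤ N := hN (by simpa [hn p] using h0)
  omega

theorem FinitelySupported.of_nat {h : ℕ → Cardinal} {n : ℕ → ℕ} {N : ℕ} (H : ∀ p, h p = n p)
    (hN : ∀ p ≥ N, n p = 0) : FinitelySupported h := by
  refine ⟨fun p => by rw [H]; exact Cardinal.natCast_lt_aleph0, (Set.finite_lt_nat N).subset fun p hp => ?_⟩
  by_contra hlt
  exact hp (by rw [H, hN p (not_lt.1 hlt), Nat.cast_zero])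

theorem FinitelySupported.mono {g h : ℕ → Cardinal} (H : FinitelySupported h)
    (hgh : ∀ p, g p ≤ h p) : FinitelySupported g :=
  ⟨fun p => (hgh p).trans_lt (H.1 p), H.2.subset fun p hp h0 =>
    hp (le_antisymm ((hgh p).trans h0.le) zero_le)⟩

/-- The alternating sum of a sequence of cardinals. -/
noncomputable def altSum (h : ℕ → Cardinal) : ℤ :=
  ∑ᶠ p : ℕ, (-1) ^ p * (Cardinal.toNat (h p) : ℤ)

theorem altSum_eq {h : ℕ → Cardinal} {n : ℕ → ℕ} {N : ℕ} (H : ∀ p, h p = n p)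
    (hN : ∀ p ≥ N, n p = 0) : altSum h = ∑ p ∈ Finset.range N, (-1) ^ p * (n p : ℤ) := by
  have e : ∀ p, Cardinal.toNat (h p) = n p := fun p => by rw [H, Cardinal.toNat_natCast]
  rw [altSum]
  simp only [e]
  refine finsum_eq_sum_of_support_subset _ fun p hp => ?_
  by_contra hlt
  refine hp ?_
  simp only [Finset.coe_range, Set.mem_Iio, not_lt] at hlt
  simp [hN p hlt]

/-- Here `a`, `b`, `c` are the ranks of the images of the three maps of the long exact sequence. The
degree shift of the connecting map gives `c` opposite signs in `U` and `Z`, so it cancels. -/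
theorem altSum_of_exact {U X Z a b c : ℕ → Cardinal} (hU0 : U 0 = a 0)
    (hU : ∀ p, U (p + 1) = c p + a (p + 1)) (hX : ∀ p, X p = a p + b p)
    (hZ : ∀ p, Z p = b p + c p) (fa : FinitelySupported a) (fb : FinitelySupported b)
    (fc : FinitelySupported c) :
    FinitelySupported U ∧ FinitelySupported X ∧ altSum X = altSum U + altSum Z := by
  obtain ⟨n, N₁, hn, hN₁⟩ := fa.exists_nat
  obtain ⟨m, N₂, hm, hN₂⟩ := fb.exists_nat
  obtain ⟨l, N₃, hl, hN₃⟩ := fc.exists_nat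
  set N := max N₁ (max N₂ N₃) with hN
  have hn0 : ∀ p ≥ N, n p = 0 := fun p hp => hN₁ p (by omega)
  have hm0 : ∀ p ≥ N, m p = 0 := fun p hp => hN₂ p (by omega)
  have hl0 : ∀ p ≥ N, l p = 0 := fun p hp => hN₃ p (by omega)
  obtain ⟨u, hu1, hu2⟩ : ∃ u : ℕ → ℕ, u 0 = n 0 ∧ ∀ q, u (q + 1) = l q + n (q + 1) :=
    ⟨fun p => Nat.casesOn p (n 0) fun q => l q + n (q + 1), rfl, fun _ => rfl⟩
  have hu : ∀ p, U p = (u p : ℕ) := by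
    intro p
    cases p with
    | zero => rw [hU0, hn, hu1]
    | succ q =>
      rw [hU, hn, hl, ← Nat.cast_add, hu2]
  -- One more than `N`, because `u (q + 1)` involves `l q`.
  have hu0 : ∀ p ≥ N + 1, u p = 0 := by
    intro p hp
    cases p with
    | zero => omega
    | succ q =>
      rw [hu2, hl0 q (by omega), hn0 _ (by omega)]
  have hx : ∀ p, X p = (n p + m p : ℕ) := fun p => by rw [hX, hn, hm, Nat.cast_add]
  have hz : ∀ p, Z p = (m p + l p : ℕ) := fun p => by rw [hZ, hm, hl, Nat.cast_add]
  have hx0 : ∀ p ≥ N + 1, n p + m p = 0 := fun p hp => by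
    rw [hn0 p (by omega), hm0 p (by omega)]
  have hz0 : ∀ p ≥ N + 1, m p + l p = 0 := fun p hp => by
    rw [hm0 p (by omega), hl0 p (by omega)]
  refine ⟨.of_nat hu hu0, .of_nat hx hx0, ?_⟩
  rw [altSum_eq hu hu0, altSum_eq hx hx0, altSum_eq hz hz0]
  have e1 : ∑ p ∈ Finset.range (N + 1), (-1 : ℤ) ^ p * (u p : ℤ) =
      ∑ p ∈ Finset.range (N + 1), (-1 : ℤ) ^ p * (n p : ℤ) -
        ∑ p ∈ Finset.range (N + 1), (-1 : ℤ) ^ p * (l p : ℤ) := by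
    rw [Finset.sum_range_succ', Finset.sum_range_succ' (fun p => (-1 : ℤ) ^ p * (n p : ℤ)),
      Finset.sum_range_succ (fun p => (-1 : ℤ) ^ p * (l p : ℤ)), hl0 N le_rfl]
    simp only [hu1, hu2, Nat.cast_add, pow_succ]
    simp only [mul_add, Finset.sum_add_distrib]
    simp
    ring
  rw [e1]
  push_cast
  simp only [mul_add, Finset.sum_add_distrib]
  ring

theorem rank_eq_of_exact {A B C : Type u} [AddCommGroup A] [AddCommGroup B] [AddCommGroup C]
    {f : A →ₗ[ℤ] B} {g : B →ₗ[ℤ] C} (h : Function.Exact f g) :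
    Module.rank ℤ B = Module.rank ℤ (LinearMap.range f) + Module.rank ℤ (LinearMap.range g) := by
  rw [← LinearMap.exact_iff.1 h, add_comm, LinearMap.rank_range_add_rank_ker]

end Ranks

/-! ### Additivity along closed subsets, homeomorphism invariance, and the basic values. -/

section EulerCharC

theorem eulerCharC_eq_altSum (X : Type u) [TopologicalSpace X] :
    eulerCharC X = altSum fun p => Module.rank ℤ (CompactCohomology X p) := rfl

section Closed

variable {X : Type u} [TopologicalSpace X] [MetrizableSpace X] [LocallyCompactSpace X] {Z : Set X}

theorem exists_ranks (hZ : IsClosed Z) : ∃ a b c : ℕ → Cardinal.{u},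
    Module.rank ℤ (CompactCohomology (Zᶜ : Set X) 0) = a 0 ∧
    (∀ p, Module.rank ℤ (CompactCohomology (Zᶜ : Set X) (p + 1)) = c p + a (p + 1)) ∧
    (∀ p, Module.rank ℤ (CompactCohomology X p) = a p + b p) ∧
    ∀ p, Module.rank ℤ (CompactCohomology Z p) = b p + c p := by
  let _ := TopologicalSpace.metrizableSpaceMetric X
  obtain ⟨i, r, δ, hi, H⟩ := exists_long_exact_sequence hZ
  exact ⟨fun p => Module.rank ℤ (LinearMap.range (i p)), fun p => Module.rank ℤ (LinearMap.range (r p)),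
    fun p => Module.rank ℤ (LinearMap.range (δ p)), (rank_range_of_injective _ hi).symm,
    fun p => rank_eq_of_exact (H p).2.2, fun p => rank_eq_of_exact (H p).1,
    fun p => rank_eq_of_exact (H p).2.1⟩

theorem hasEulerCharC_of_closed (hZ : IsClosed Z) (h : HasEulerCharC Z)
    (h' : HasEulerCharC (Zᶜ : Set X)) :
    HasEulerCharC X ∧ eulerCharC X = eulerCharC (Zᶜ : Set X) + eulerCharC Z := by
  obtain ⟨a, b, c, hU0, hU, hX, hZ⟩ := exists_ranks hZ
  have fa : FinitelySupported a := FinitelySupported.mono h' fun p => by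
    cases p with
    | zero => exact hU0.ge
    | succ p => rw [hU]; exact self_le_add_left _ _
  have fb : FinitelySupported b := FinitelySupported.mono h fun p => by
    rw [hZ]; exact self_le_add_right _ _
  have fc : FinitelySupported c := FinitelySupported.mono h fun p => by
    rw [hZ]; exact self_le_add_left _ _
  refine And.right (altSum_of_exact (U := fun p => Module.rank ℤ (CompactCohomology (Zᶜ : Set X) p)) hU0 hU hX hZ
    fa fb fc)

/-- The variant where the complement is the unknown piece, needed for the open half-line inside the
closed one. -/
theorem hasEulerCharC_compl (hZ : IsClosed Z) (h : HasEulerCharC Z) (h' : HasEulerCharC X) :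
    HasEulerCharC (Zᶜ : Set X) ∧ eulerCharC X = eulerCharC (Zᶜ : Set X) + eulerCharC Z := by
  obtain ⟨a, b, c, hU0, hU, hX, hZ⟩ := exists_ranks hZ
  have fa : FinitelySupported a := FinitelySupported.mono h' fun p => by
    rw [hX]; exact self_le_add_right _ _
  have fb : FinitelySupported b := FinitelySupported.mono h fun p => by
    rw [hZ]; exact self_le_add_right _ _
  have fc : FinitelySupported c := FinitelySupported.mono h fun p => by
    rw [hZ]; exact self_le_add_left _ _
  have := altSum_of_exact (U := fun p => Module.rank ℤ (CompactCohomology (Zᶜ : Set X) p)) hU0 hU hX hZ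
    fa fb fc
  exact ⟨this.1, this.2.2⟩

end Closed

variable {X Y : Type u} [TopologicalSpace X] [TopologicalSpace Y]

theorem rank_compactCohomology_congr (e : X ≃ₜ Y) (p : ℕ) :
    Module.rank ℤ (CompactCohomology X p) = Module.rank ℤ (CompactCohomology Y p) := by
  have key : ∀ {X Y : Type u} [TopologicalSpace X] [TopologicalSpace Y] (e : X ≃ₜ Y),
      ∃ k : CompactCohomology Y p →ₗ[ℤ] CompactCohomology X p,
        ∀ φ (h : φ ∈ compactCocycles Y p), k (cohomologyClass Y p ⟨φ, h⟩) = cohomologyClass X p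
          ⟨pullCochain e p φ, pullCochain_mem_compactCocycles e.isClosedEmbedding h⟩ := by
    intro X Y _ _ e
    let g : compactCocycles Y p →ₗ[ℤ] CompactCohomology X p := (cohomologyClass X p).comp
      (((pullCochain e p).comp (compactCocycles Y p).subtype).codRestrict _
        fun m => pullCochain_mem_compactCocycles e.isClosedEmbedding m.2)
    have hg : ∀ m, cohomologyClass Y p m = 0 → g m = 0 := fun m hm => cohomologyClass_eq_zero.2
      (pullCochain_mem_compactCoboundaries e.isClosedEmbedding (cohomologyClass_eq_zero.1 hm))
    obtain ⟨k, hk⟩ := exists_linearMap_factor _ g (cohomologyClass_surjective p) hg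
    exact ⟨k, fun φ h => hk ⟨φ, h⟩⟩
  obtain ⟨k, hk⟩ := key e
  obtain ⟨l, hl⟩ := key e.symm
  refine LinearEquiv.rank_eq (LinearEquiv.ofLinearMap l k ?_ ?_)
  · refine LinearMap.ext fun y => ?_
    obtain ⟨⟨φ, hφ⟩, rfl⟩ := cohomologyClass_surjective p y
    rw [LinearMap.comp_apply, hk, hl, LinearMap.id_apply]
    congr 2
    funext v
    simp only [pullCochain_apply, ← Function.comp_assoc, e.self_comp_symm, Function.id_comp]
  · refine LinearMap.ext fun y => ?_
    obtain ⟨⟨φ, hφ⟩, rfl⟩ := cohomologyClass_surjective p y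
    rw [LinearMap.comp_apply, hl, hk, LinearMap.id_apply]
    congr 2
    funext v
    simp only [pullCochain_apply, ← Function.comp_assoc, e.symm_comp_self, Function.id_comp]

theorem HasEulerCharC.congr (e : X ≃ₜ Y) (h : HasEulerCharC X) : HasEulerCharC Y := by
  simpa only [HasEulerCharC, rank_compactCohomology_congr e] using h

theorem eulerCharC_congr (e : X ≃ₜ Y) : eulerCharC X = eulerCharC Y := by
  simp only [eulerCharC_eq_altSum, rank_compactCohomology_congr e]

theorem rank_compactCohomology_eq_zero {p : ℕ}
    (h : compactCocycles X p ≤ compactCoboundaries X p) :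
    Module.rank ℤ (CompactCohomology X p) = 0 := by
  have : Subsingleton (CompactCohomology X p) := by
    refine subsingleton_of_forall_eq 0 fun y => ?_
    obtain ⟨φ, rfl⟩ := cohomologyClass_surjective p y
    exact cohomologyClass_eq_zero.2 (h φ.2)
  exact rank_subsingleton' _ _

theorem hasEulerCharC_of_acyclic (h : ∀ p, compactCocycles X p ≤ compactCoboundaries X p) :
    HasEulerCharC X ∧ eulerCharC X = 0 := by
  have e : ∀ p, Module.rank ℤ (CompactCohomology X p) = ((fun _ => 0 : ℕ → ℕ) p : ℕ) := fun p => by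
    rw [rank_compactCohomology_eq_zero (h p), Nat.cast_zero]
  refine ⟨FinitelySupported.of_nat (N := 0) e fun _ _ => rfl, ?_⟩
  rw [eulerCharC_eq_altSum, altSum_eq (N := 0) e fun _ _ => rfl]
  rfl

theorem hasEulerCharC_of_isEmpty [IsEmpty X] : HasEulerCharC X ∧ eulerCharC X = 0 :=
  hasEulerCharC_of_acyclic fun p φ _ => by
    have : φ = 0 := funext fun v => isEmptyElim (v 0)
    rw [this]
    exact zero_mem _

/-- Every cochain group of a point is `ℤ`, and the coboundary is `0` in even degrees and the
identity in odd degrees, so only degree `0` survives. -/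
theorem hasEulerCharC_of_unique [Unique X] : HasEulerCharC X ∧ eulerCharC X = 1 := by
  have hcob : ∀ {p} (φ : Cochain X p) v, coboundary X p φ v =
      (if Even p then 0 else 1) * φ default := by
    intro p φ v
    change ∑ i : Fin (p + 2), (-1) ^ (i : ℕ) * φ (fun j => v (i.succAbove j)) = _
    have : ∀ w : Fin (p + 1) → X, φ w = φ default := fun w => by rw [Subsingleton.elim w]
    simp only [this, ← Finset.sum_mul, Fin.sum_neg_one_pow]
    simp [Nat.even_add]
  have hLZ : ∀ {p} {φ : Cochain X p}, φ ∈ locallyZeroCochains X p → φ = 0 := by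
    intro p φ h
    rw [mem_locallyZeroCochains] at h
    obtain ⟨U, hU, h⟩ := h default
    funext v
    refine h v fun i => ?_
    rw [Subsingleton.elim (v i) default]
    exact mem_of_mem_nhds hU
  have hc : ∀ {p} (φ : Cochain X p), φ ∈ compactCochains X p := fun φ =>
    (Set.toFinite (cochainSupport φ)).isCompact
  have h0 : Module.rank ℤ (CompactCohomology X 0) = 1 := by
    let g : compactCocycles X 0 →ₗ[ℤ] ℤ := (LinearMap.proj default).comp (compactCocycles X 0).subtype
    obtain ⟨k, hk⟩ := exists_linearMap_factor _ g (cohomologyClass_surjective 0) (by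
      intro m hm
      have := hLZ (cohomologyClass_eq_zero.1 hm)
      change (m : Cochain X 0) default = 0
      rw [this]
      rfl)
    have hinj : Function.Injective k := by
      rw [injective_iff_map_eq_zero]
      intro y hy
      obtain ⟨φ, rfl⟩ := cohomologyClass_surjective 0 y
      rw [hk] at hy
      rw [cohomologyClass_eq_zero]
      have : (φ : Cochain X 0) = 0 := by
        funext v
        rw [Subsingleton.elim v default]
        exact hy
      rw [this]
      exact zero_mem _
    have hsurj : Function.Surjective k := by
      intro n
      have hn : (fun _ => n : Cochain X 0) ∈ compactCocycles X 0 := by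
        refine ⟨hc _, ?_⟩
        change coboundary X 0 _ ∈ locallyZeroCochains X 1
        have : coboundary X 0 (fun _ => n) = 0 := by
          funext v
          rw [hcob]
          simp
        rw [this]
        exact zero_mem _
      exact ⟨cohomologyClass X 0 ⟨_, hn⟩, hk _⟩
    have := (LinearEquiv.ofBijective k ⟨hinj, hsurj⟩).lift_rank_eq
    simpa using this
  have h1 : ∀ p, Module.rank ℤ (CompactCohomology X (p + 1)) = 0 := by
    intro p
    refine rank_compactCohomology_eq_zero fun φ hφ => ?_
    rw [mem_compactCoboundaries_succ]
    have h2 := hLZ hφ.2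
    by_cases hp : Even p
    · have : φ = 0 := by
        funext v
        have := congrFun h2 default
        rw [hcob, if_neg (by simpa [Nat.even_add_one] using hp), one_mul] at this
        rw [Subsingleton.elim v default]
        exact this
      exact ⟨0, zero_mem _, by rw [this, map_zero, sub_zero]; exact zero_mem _⟩
    · refine ⟨fun _ => φ default, hc _, ?_⟩
      have : φ - coboundary X p (fun _ => φ default) = 0 := by
        funext v
        rw [Pi.sub_apply, hcob, if_neg hp, one_mul, Subsingleton.elim v default]
        exact sub_self _
      rw [this]
      exact zero_mem _
  have e : ∀ p, Module.rank ℤ (CompactCohomology X p) =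
      ((fun p => if p = 0 then 1 else 0 : ℕ → ℕ) p : ℕ) := fun p => by
    cases p with
    | zero => rw [h0]; simp
    | succ p => rw [h1]; simp
  have e' : ∀ p ≥ 1, (fun p => if p = 0 then 1 else 0 : ℕ → ℕ) p = 0 := fun p hp => by
    simp only [ite_eq_right_iff]
    omega
  refine ⟨FinitelySupported.of_nat e e', ?_⟩
  rw [eulerCharC_eq_altSum, altSum_eq e e']
  simp

end EulerCharC

/-! ### Half-lines -/

section HalfLine

variable {X : Type*} [MetricSpace X]

theorem mem_locallyZeroCochains_of_small {p : ℕ} {φ : Cochain X p} {δ : ℝ} (hδ : 0 < δ)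
    (h : ∀ v : Fin (p + 1) → X, (∀ i j, dist (v i) (v j) < δ) → φ v = 0) :
    φ ∈ locallyZeroCochains X p := by
  rw [mem_locallyZeroCochains]
  refine fun x => ⟨Metric.ball x (δ / 2), Metric.ball_mem_nhds x (by positivity),
    fun v hv => h v fun i j => ?_⟩
  have := dist_triangle_right (v i) (v j) x
  have h1 := Metric.mem_ball.1 (hv i)
  have h2 := Metric.mem_ball.1 (hv j)
  linarith

/-- Pulling back a cocycle along a map close to the identity does not change its class. -/
theorem sub_pullCochain_mem_compactCoboundaries {p : ℕ} {φ : Cochain X p} {K L : Set X}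
    (hφ : ∀ v, (∀ i, v i ∉ K) → φ v = 0) (hL : IsCompact L) (hKL : K ⊆ L) {θ : X → X}
    (hθL : ∀ x, θ x ∈ K → x ∈ L) {δ : ℝ} (hδ : 0 < δ) (hθ : ∀ x, dist x (θ x) < δ)
    (h : ∀ v : Fin (p + 2) → X, (∀ i j, dist (v i) (v j) < 3 * δ) → coboundary X p φ v = 0) :
    φ - pullCochain θ p φ ∈ compactCoboundaries X p := by
  have key : ∀ v : Fin (p + 1) → X, (∀ i j, dist (v i) (v j) < δ) →
      φ v - φ (θ ∘ v) + faceSum X p (prism θ p φ) v = 0 := by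
    intro v hv
    have e := faceSum_prism θ p φ v
    have e2 : prism θ (p + 1) (faceSum X (p + 1) φ) v = 0 :=
      prism_apply_eq_zero θ {a | ∃ j, a = v j ∨ a = θ (v j)} _ _
        (fun u hu => h u fun i j => dist_lt_of_near hθ hv (hu i) (hu j)) v
        fun j => ⟨⟨j, Or.inl rfl⟩, ⟨j, Or.inr rfl⟩⟩
    rw [e2] at e
    linarith
  cases p with
  | zero =>
    refine mem_locallyZeroCochains_of_small hδ fun v hv => ?_
    have := key v hv
    simpa [prism, pullCochain_apply] using this
  | succ q =>
    rw [mem_compactCoboundaries_succ]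
    refine ⟨-prism θ (q + 1) φ,
      neg_mem (carriedCochains_le _ (prism_mem_carriedCochains hφ hL hKL hθL)), ?_⟩
    rw [map_neg, sub_neg_eq_add]
    exact mem_locallyZeroCochains_of_small hδ key

variable {Y : Type*} [MetricSpace Y]

/-- Translation of the half-line. -/
noncomputable def shiftIci (s : ℝ) (hs : 0 ≤ s) (x : Set.Ici (0 : ℝ) × Y) : Set.Ici (0 : ℝ) × Y :=
  (⟨x.1 + s, add_nonneg x.1.2 hs⟩, x.2)

theorem isometry_shiftIci (s : ℝ) (hs : 0 ≤ s) : Isometry (shiftIci (Y := Y) s hs) := by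
  refine Isometry.of_dist_eq fun x y => ?_
  simp [shiftIci, Prod.dist_eq, Subtype.dist_eq]

theorem isClosedEmbedding_shiftIci (s : ℝ) (hs : 0 ≤ s) :
    IsClosedEmbedding (shiftIci (Y := Y) s hs) := by
  refine ⟨(isometry_shiftIci s hs).isEmbedding, ?_⟩
  have : Set.range (shiftIci (Y := Y) s hs) = {x | s ≤ x.1} := by
    ext ⟨⟨t, ht⟩, y⟩
    constructor
    · rintro ⟨⟨⟨t', ht'⟩, y'⟩, h⟩
      have h1 : t' + s = t := congrArg (fun x => (x.1 : ℝ)) h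
      change s ≤ t
      rw [← h1]
      exact le_add_of_nonneg_left ht'
    · intro h
      change s ≤ t at h
      exact ⟨(⟨t - s, sub_nonneg.2 h⟩, y), by simp [shiftIci]⟩
  rw [this]
  exact isClosed_le continuous_const (continuous_subtype_val.comp continuous_fst)

theorem dist_shiftIci (s : ℝ) (hs : 0 ≤ s) (x : Set.Ici (0 : ℝ) × Y) :
    dist x (shiftIci s hs x) = s := by
  simp [shiftIci, Prod.dist_eq, Subtype.dist_eq, abs_of_nonneg hs, hs]

/-- Translation pushes the carrier off the end of the half-line. A short shift preserves the class
of a cocycle and lowers the carrier, so finitely many shifts bring it to zero. -/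
theorem compactCocycles_le_of_halfLine [LocallyCompactSpace Y] (p : ℕ) :
    compactCocycles (Set.Ici (0 : ℝ) × Y) p ≤ compactCoboundaries (Set.Ici (0 : ℝ) × Y) p := by
  intro φ' hφ'
  have : LocallyCompactSpace (Set.Ici (0 : ℝ)) := isClosed_Ici.locallyCompactSpace
  obtain ⟨φ, hφc, hφ, hsub⟩ := exists_carried_cocycle hφ'
  suffices H : φ ∈ compactCoboundaries (Set.Ici (0 : ℝ) × Y) p by
    have := add_mem (locallyZeroCochains_le_compactCoboundaries p hsub) H
    rwa [sub_add_cancel] at this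
  obtain ⟨ε, hε, hs⟩ := exists_small_eq_zero (coboundary_mem_carriedCochains hφc) hφ.2
  obtain ⟨K, hK, hφK⟩ := hφc
  have hs0 : 0 ≤ ε / 6 := by positivity
  -- The scale `ε` on which the coboundary vanishes stays fixed through the induction, because the
  -- shifts are isometries.
  have key : ∀ (m : ℕ) (φ : Cochain (Set.Ici (0 : ℝ) × Y) p) (K : Set (Set.Ici (0 : ℝ) × Y)),
      IsCompact K → (∀ v, (∀ i, v i ∉ K) → φ v = 0) → (∀ x ∈ K, (x.1 : ℝ) < m * (ε / 6)) →
      (∀ v, (∀ i j, dist (v i) (v j) < ε) → coboundary _ p φ v = 0) →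
      φ ∈ compactCoboundaries (Set.Ici (0 : ℝ) × Y) p := by
    intro m
    induction m with
    | zero =>
      intro φ K hK hφ hKm _
      have : φ = 0 := funext fun v => hφ v fun i hi => by
        have h1 := hKm _ hi
        have h2 : (0 : ℝ) ≤ (v i).1 := (v i).1.2
        simp only [Nat.cast_zero, zero_mul] at h1
        linarith
      rw [this]
      exact zero_mem _
    | succ m ih =>
      intro φ K hK hφ hKm hφε
      have hK' := (isClosedEmbedding_shiftIci (Y := Y) (ε / 6) hs0).isCompact_preimage hK
      -- The homotopy needs a displacement below `δ` with `3 * δ = ε`; the shift `ε / 6` is below `δ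
      -- = ε / 3`.
      have h1 := sub_pullCochain_mem_compactCoboundaries (θ := shiftIci (ε / 6) hs0) (δ := ε / 3)
        hφ (hK.union hK') Set.subset_union_left (fun x hx => Or.inr hx) (by positivity)
        (fun x => by rw [dist_shiftIci]; linarith)
        (fun v hv => hφε v fun i j => (hv i j).trans_eq (by ring))
      have h2 := ih (pullCochain (shiftIci (ε / 6) hs0) p φ) _ hK' (fun v hv => hφ _ hv) ?_ ?_
      · have := add_mem h1 h2
        rwa [sub_add_cancel] at this
      · intro x hx
        have := hKm _ hx
        simp only [shiftIci] at this
        push_cast at this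
        linarith
      · intro v hv
        rw [coboundary_pullCochain, pullCochain_apply]
        refine hφε _ fun i j => ?_
        simp only [Function.comp_apply, (isometry_shiftIci (Y := Y) (ε / 6) hs0).dist_eq]
        exact hv i j
  obtain ⟨M, hM⟩ := (hK.image (continuous_subtype_val.comp continuous_fst)).bddAbove
  obtain ⟨m, hm⟩ := exists_nat_gt (M / (ε / 6))
  refine key m φ K hK hφK (fun x hx => ?_) hs
  have h1 : (x.1 : ℝ) ≤ M := hM ⟨x, hx, rfl⟩
  rw [div_lt_iff₀ (by positivity)] at hm
  exact h1.trans_lt hm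

end HalfLine

/-- `(0, ∞) × Y ≃ₜ ℝ × Y`, as the complement of the boundary of `[0, ∞) × Y`. -/
noncomputable def boundaryComplHomeomorph (Y : Type*) [TopologicalSpace Y] :
    ({x : Set.Ici (0 : ℝ) × Y | (x.1 : ℝ) = 0}ᶜ : Set (Set.Ici (0 : ℝ) × Y)) ≃ₜ ℝ × Y where
  toFun x := (Real.log x.1.1, x.1.2)
  invFun y := ⟨(⟨Real.exp y.1, (Real.exp_pos _).le⟩, y.2), (Real.exp_pos _).ne'⟩
  left_inv := by
    rintro ⟨⟨⟨t, ht⟩, y⟩, h⟩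
    have : 0 < t := lt_of_le_of_ne ht (Ne.symm h)
    simp [Real.exp_log this]
  right_inv y := by simp
  continuous_toFun := by
    refine Continuous.prodMk (Continuous.log (by fun_prop) fun x => x.2) (by fun_prop)
  continuous_invFun := by fun_prop

/-- The boundary of `[0, ∞) × Y` is `Y`. -/
def boundaryHomeomorph (Y : Type*) [TopologicalSpace Y] :
    ({x : Set.Ici (0 : ℝ) × Y | (x.1 : ℝ) = 0} : Set (Set.Ici (0 : ℝ) × Y)) ≃ₜ Y where
  toFun x := x.1.2
  invFun y := ⟨(⟨0, Set.self_mem_Ici⟩, y), rfl⟩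
  left_inv := by
    rintro ⟨⟨⟨t, ht⟩, y⟩, h⟩
    change t = 0 at h
    subst h
    rfl
  right_inv y := rfl
  continuous_toFun := by fun_prop
  continuous_invFun := (continuous_const.prodMk continuous_id).subtype_mk _

/-- The acyclic space `[0, ∞) × Y` is the disjoint union of its closed boundary `Y` and an open part
homeomorphic to `ℝ × Y`. -/
theorem hasEulerCharC_real_prod {Y : Type} [TopologicalSpace Y] [MetrizableSpace Y]
    [LocallyCompactSpace Y] (h : HasEulerCharC Y) :
    HasEulerCharC (ℝ × Y) ∧ eulerCharC (ℝ × Y) = -eulerCharC Y := by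
  let _ := TopologicalSpace.metrizableSpaceMetric Y
  have : LocallyCompactSpace (Set.Ici (0 : ℝ)) := isClosed_Ici.locallyCompactSpace
  obtain ⟨h1, h2⟩ := hasEulerCharC_of_acyclic (compactCocycles_le_of_halfLine (Y := Y))
  have hZ : IsClosed {x : Set.Ici (0 : ℝ) × Y | (x.1 : ℝ) = 0} :=
    isClosed_eq (by fun_prop) continuous_const
  obtain ⟨h3, h4⟩ := hasEulerCharC_compl hZ (h.congr (boundaryHomeomorph Y).symm) h1
  refine ⟨h3.congr (boundaryComplHomeomorph Y), ?_⟩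
  rw [h2, eulerCharC_congr (boundaryHomeomorph Y), eulerCharC_congr (boundaryComplHomeomorph Y)] at h4
  linarith

/-! ### Tame spaces -/

/-- Locally compact metrizable spaces whose Euler characteristic with compact supports is defined
and multiplicative with respect to products with arbitrary spaces. -/
structure Tame (X : Type) [TopologicalSpace X] : Prop where
  locallyCompact : LocallyCompactSpace X
  metrizable : MetrizableSpace X
  euler : ∀ (T : Type) [TopologicalSpace T] [MetrizableSpace T] [LocallyCompactSpace T],
    HasEulerCharC T → HasEulerCharC (X × T) ∧ eulerCharC (X × T) = eulerCharC X * eulerCharC T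

section Tame

variable {X Y : Type} [TopologicalSpace X] [TopologicalSpace Y]

theorem Tame.hasEulerCharC (h : Tame X) : HasEulerCharC X :=
  (h.euler PUnit hasEulerCharC_of_unique.1).1.congr (Homeomorph.prodPUnit X)

theorem Tame.congr (e : X ≃ₜ Y) (h : Tame X) : Tame Y := by
  have := h.locallyCompact
  have := h.metrizable
  refine ⟨e.symm.isClosedEmbedding.locallyCompactSpace, e.symm.isEmbedding.metrizableSpace,
    fun T _ _ _ hT => ?_⟩
  obtain ⟨h1, h2⟩ := h.euler T hT
  exact ⟨h1.congr (e.prodCongr (.refl T)), by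
    rw [← eulerCharC_congr (e.prodCongr (.refl T)), h2, eulerCharC_congr e]⟩

theorem tame_of_isEmpty [IsEmpty X] : Tame X where
  locallyCompact := ⟨fun x => isEmptyElim x⟩
  metrizable := by
    have : DiscreteTopology X := Subsingleton.discreteTopology
    infer_instance
  euler T _ _ _ _ := by
    rw [hasEulerCharC_of_isEmpty.2, hasEulerCharC_of_isEmpty.2, zero_mul]
    exact ⟨hasEulerCharC_of_isEmpty.1, rfl⟩

theorem tame_of_unique [Unique X] : Tame X where
  locallyCompact := inferInstance
  metrizable := by
    have : DiscreteTopology X := Subsingleton.discreteTopology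
    infer_instance
  euler T _ _ _ hT := by
    have e : T ≃ₜ X × T := (Homeomorph.uniqueProd X T).symm
    rw [(hasEulerCharC_of_unique (X := X)).2, one_mul, eulerCharC_congr e]
    exact ⟨hT.congr e, rfl⟩

/-- Multiplicativity is postulated against every space `T`, so stability under products needs only
associativity and no Künneth formula. -/
theorem Tame.prod (hX : Tame X) (hY : Tame Y) :
    Tame (X × Y) ∧ eulerCharC (X × Y) = eulerCharC X * eulerCharC Y := by
  have := hX.locallyCompact
  have := hX.metrizable
  have := hY.locallyCompact
  have := hY.metrizable
  have h := hX.euler Y hY.hasEulerCharC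
  refine ⟨⟨inferInstance, inferInstance, fun T _ _ _ hT => ?_⟩, h.2⟩
  obtain ⟨h1, h2⟩ := hY.euler T hT
  obtain ⟨h3, h4⟩ := hX.euler (Y × T) h1
  refine ⟨h3.congr (Homeomorph.prodAssoc X Y T).symm, ?_⟩
  rw [eulerCharC_congr (Homeomorph.prodAssoc X Y T), h4, h2, h.2, mul_assoc]

theorem tame_real : Tame ℝ ∧ eulerCharC ℝ = -1 := by
  have h : eulerCharC ℝ = -1 := by
    rw [← eulerCharC_congr (Homeomorph.prodPUnit ℝ),
      (hasEulerCharC_real_prod hasEulerCharC_of_unique.1).2, hasEulerCharC_of_unique.2]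
  refine ⟨⟨inferInstance, inferInstance, fun T _ _ _ hT => ?_⟩, h⟩
  rw [h, (hasEulerCharC_real_prod hT).2, neg_one_mul]
  exact ⟨(hasEulerCharC_real_prod hT).1, rfl⟩

theorem tame_pi (n : ℕ) : Tame (Fin n → ℝ) ∧ eulerCharC (Fin n → ℝ) = (-1) ^ n := by
  induction n with
  | zero => exact ⟨tame_of_unique, hasEulerCharC_of_unique.2⟩
  | succ n ih =>
    have e : (Fin n → ℝ) × ℝ ≃ₜ (Fin (n + 1) → ℝ) :=
      ((Homeomorph.refl _).prodCongr (Homeomorph.funUnique (Fin 1) ℝ).symm).trans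
        (Fin.appendHomeomorph n 1)
    have h := ih.1.prod tame_real.1
    refine ⟨h.1.congr e, ?_⟩
    rw [← eulerCharC_congr e, h.2, tame_real.2, ih.2, pow_succ]

/-- A cylinder over a subset. -/
def cylinderHomeomorph (A : Set X) (T : Type) [TopologicalSpace T] :
    A × T ≃ₜ {x : X × T | x.1 ∈ A} where
  toFun x := ⟨(x.1, x.2), x.1.2⟩
  invFun x := (⟨x.1.1, x.2⟩, x.1.2)
  left_inv _ := rfl
  right_inv _ := rfl
  continuous_toFun := by fun_prop
  continuous_invFun := by fun_prop

/-- Cut `X × T` along `Z × T`: both sides of the product formula are additive. -/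
theorem Tame.of_closed [LocallyCompactSpace X] [MetrizableSpace X] {Z : Set X} (hZ : IsClosed Z)
    (h : Tame Z) (h' : Tame (Zᶜ : Set X)) :
    Tame X ∧ eulerCharC X = eulerCharC (Zᶜ : Set X) + eulerCharC Z := by
  have hX := hasEulerCharC_of_closed hZ h.hasEulerCharC h'.hasEulerCharC
  refine ⟨⟨inferInstance, inferInstance, fun T _ _ _ hT => ?_⟩, hX.2⟩
  obtain ⟨h1, h2⟩ := h.euler T hT
  obtain ⟨h3, h4⟩ := h'.euler T hT
  have hZT : IsClosed {x : X × T | x.1 ∈ Z} := hZ.preimage continuous_fst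
  obtain ⟨h5, h6⟩ := hasEulerCharC_of_closed hZT (h1.congr (cylinderHomeomorph Z T))
    (h3.congr (cylinderHomeomorph Zᶜ T))
  refine ⟨h5, h6.trans ?_⟩
  have e1 := eulerCharC_congr (cylinderHomeomorph Z T)
  have e2 : _ = eulerCharC ({x : X × T | x.1 ∈ Z}ᶜ : Set (X × T)) :=
    eulerCharC_congr (cylinderHomeomorph Zᶜ T)
  rw [← e1, ← e2, h2, h4, hX.2, add_mul]

/-- A subset of a subspace as a subset of the ambient space. -/
def subsubHomeomorph {S A : Set X} {B : Set S} (hA : ∀ x (h : x ∈ S), x ∈ A ↔ ⟨x, h⟩ ∈ B)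
    (hAS : A ⊆ S) : B ≃ₜ A where
  toFun x := ⟨x.1.1, (hA _ x.1.2).2 x.2⟩
  invFun x := ⟨⟨x.1, hAS x.2⟩, (hA _ _).1 x.2⟩
  left_inv _ := rfl
  right_inv _ := rfl
  continuous_toFun := by fun_prop
  continuous_invFun := by fun_prop

variable [LocallyCompactSpace X] [MetrizableSpace X]

theorem Tame.of_closed_inter {S C : Set X} (hS : IsLocallyClosed S) (hC : IsClosed C)
    (h : Tame (S ∩ C : Set X)) (h' : Tame (S ∩ Cᶜ : Set X)) :
    Tame S ∧ eulerCharC S = eulerCharC (S ∩ Cᶜ : Set X) + eulerCharC (S ∩ C : Set X) := by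
  have := hS.locallyCompactSpace
  have hZ : IsClosed (Subtype.val ⁻¹' C : Set S) := hC.preimage continuous_subtype_val
  have e1 : (Subtype.val ⁻¹' C : Set S) ≃ₜ (S ∩ C : Set X) :=
    subsubHomeomorph (fun x hx => ⟨fun h => h.2, fun h => ⟨hx, h⟩⟩) Set.inter_subset_left
  have e2 : ((Subtype.val ⁻¹' C)ᶜ : Set S) ≃ₜ (S ∩ Cᶜ : Set X) :=
    subsubHomeomorph (fun x hx => ⟨fun h => h.2, fun h => ⟨hx, h⟩⟩) Set.inter_subset_left
  have H := Tame.of_closed hZ (h.congr e1.symm) (h'.congr e2.symm)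
  rwa [eulerCharC_congr e1, eulerCharC_congr e2] at H

theorem Tame.of_sign {S : Set X} (hS : IsLocallyClosed S) {h : X → ℝ} (hh : Continuous h)
    (h0 : Tame (S ∩ {x | h x = 0} : Set X)) (hp : Tame (S ∩ {x | 0 < h x} : Set X))
    (hn : Tame (S ∩ {x | h x < 0} : Set X)) :
    Tame S ∧ eulerCharC S = eulerCharC (S ∩ {x | h x = 0} : Set X) +
      eulerCharC (S ∩ {x | 0 < h x} : Set X) + eulerCharC (S ∩ {x | h x < 0} : Set X) := by
  have hc : IsClosed {x | h x = 0} := isClosed_eq hh continuous_const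
  have hc' : IsClosed {x | 0 ≤ h x} := isClosed_le continuous_const hh
  have e1 : S ∩ {x | h x = 0}ᶜ ∩ {x | 0 ≤ h x} = S ∩ {x | 0 < h x} := by
    ext x
    simp only [Set.mem_inter_iff, Set.mem_compl_iff, Set.mem_ofPred_eq, and_assoc]
    refine and_congr_right fun _ => ?_
    rw [lt_iff_le_and_ne, and_comm, ne_comm]
  have e2 : S ∩ {x | h x = 0}ᶜ ∩ {x | 0 ≤ h x}ᶜ = S ∩ {x | h x < 0} := by
    ext x
    simp only [Set.mem_inter_iff, Set.mem_compl_iff, Set.mem_ofPred_eq, and_assoc, not_le]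
    refine and_congr_right fun _ => ⟨fun h => h.2, fun h => ⟨h.ne, h⟩⟩
  have H := Tame.of_closed_inter (S := S ∩ {x | h x = 0}ᶜ)
    (hS.inter hc.isOpen_compl.isLocallyClosed) hc' (by rwa [e1]) (by rwa [e2])
  have H' := Tame.of_closed_inter hS hc h0 H.1
  refine ⟨H'.1, ?_⟩
  rw [H'.2, H.2, e1, e2]
  ring

/-- Cutting by one function at a time keeps every intermediate piece locally closed, as additivity
requires. -/
theorem tame_of_signs {ι : Type*} (s : Finset ι) {h : ι → X → ℝ}
    (hh : ∀ i ∈ s, Continuous (h i)) {S : Set X} (hS : IsLocallyClosed S)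
    (H : ∀ σ : ι → SignType, Tame (S ∩ {x | ∀ i ∈ s, SignType.sign (h i x) = σ i} : Set X)) :
    Tame S := by
  classical
  induction s using Finset.induction_on generalizing S with
  | empty =>
    have e : S ∩ {x | ∀ i ∈ (∅ : Finset ι), SignType.sign (h i x) = (0 : ι → SignType) i} = S := by
      simp
    have := H 0
    rwa [e] at this
  | insert i s hi ih =>
    have hc := hh i (Finset.mem_insert_self i s)
    have key : ∀ (τ : SignType) (A : Set X), IsLocallyClosed A →
        A = {x | SignType.sign (h i x) = τ} → Tame (S ∩ A : Set X) := by
      rintro τ A hA rfl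
      refine ih (fun j hj => hh j (Finset.mem_insert_of_mem hj)) (hS.inter hA) fun σ => ?_
      have := H (Function.update σ i τ)
      have e : S ∩ {x | SignType.sign (h i x) = τ} ∩ {x | ∀ i ∈ s, SignType.sign (h i x) = σ i} =
          S ∩ {x | ∀ j ∈ insert i s, SignType.sign (h j x) = Function.update σ i τ j} := by
        ext x
        simp only [Set.mem_inter_iff, Set.mem_ofPred_eq, and_assoc, Finset.forall_mem_insert,
          Function.update_self]
        refine and_congr_right fun _ => and_congr_right fun _ => forall₂_congr fun j hj => ?_
        rw [Function.update_of_ne (ne_of_mem_of_not_mem hj hi)]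
      rwa [e]
    refine (Tame.of_sign hS hc (key 0 _ ?_ ?_) (key 1 _ ?_ ?_) (key (-1) _ ?_ ?_)).1
    · exact (isClosed_eq hc continuous_const).isLocallyClosed
    · ext x; simp [sign_eq_zero_iff]
    · exact (isOpen_lt continuous_const hc).isLocallyClosed
    · ext x; simp [sign_eq_one_iff]
    · exact (isOpen_lt hc continuous_const).isLocallyClosed
    · ext x; simp [sign_eq_neg_one_iff]

end Tame

/-! ### Graphs and bands -/

section Bands

variable {C : Type} [TopologicalSpace C]

/-- The region above a graph. -/
noncomputable def aboveHomeomorph (l : C → ℝ) (hl : Continuous l) :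
    C × ℝ ≃ₜ {p : C × ℝ | l p.1 < p.2} where
  toFun p := ⟨(p.1, l p.1 + Real.exp p.2), by simp [Real.exp_pos]⟩
  invFun p := (p.1.1, Real.log (p.1.2 - l p.1.1))
  left_inv p := by simp
  right_inv := by
    rintro ⟨⟨x, t⟩, h⟩
    change l x < t at h
    simp [Real.exp_log (sub_pos.2 h)]
  continuous_toFun := by fun_prop
  continuous_invFun := by
    refine Continuous.prodMk (by fun_prop) (Continuous.log (by fun_prop) fun p => ?_)
    exact (sub_pos.2 p.2).ne'

/-- The region below a graph. -/
noncomputable def belowHomeomorph (u : C → ℝ) (hu : Continuous u) :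
    C × ℝ ≃ₜ {p : C × ℝ | p.2 < u p.1} where
  toFun p := ⟨(p.1, u p.1 - Real.exp p.2), by simp [Real.exp_pos]⟩
  invFun p := (p.1.1, Real.log (u p.1.1 - p.1.2))
  left_inv p := by simp
  right_inv := by
    rintro ⟨⟨x, t⟩, h⟩
    change t < u x at h
    simp [Real.exp_log (sub_pos.2 h)]
  continuous_toFun := by fun_prop
  continuous_invFun := by
    refine Continuous.prodMk (by fun_prop) (Continuous.log (by fun_prop) fun p => ?_)
    exact (sub_pos.2 p.2).ne'

/-- The region between two disjoint graphs. -/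
noncomputable def betweenHomeomorph (l u : C → ℝ) (hl : Continuous l) (hu : Continuous u)
    (h : ∀ x, l x < u x) :
    C × ℝ ≃ₜ {p : C × ℝ | l p.1 < p.2 ∧ p.2 < u p.1} where
  toFun p := ⟨(p.1, (l p.1 + Real.exp p.2 * u p.1) / (1 + Real.exp p.2)), by
    have h1 := Real.exp_pos p.2
    have h2 := h p.1
    constructor
    · rw [lt_div_iff₀ (by positivity)]
      nlinarith
    · rw [div_lt_iff₀ (by positivity)]
      nlinarith⟩
  invFun p := (p.1.1, Real.log ((p.1.2 - l p.1.1) / (u p.1.1 - p.1.2)))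
  left_inv p := by
    have h1 := Real.exp_pos p.2
    have h2 := sub_pos.2 (h p.1)
    have h3 : (1 + Real.exp p.2) ≠ 0 := by positivity
    have e1 : (l p.1 + Real.exp p.2 * u p.1) / (1 + Real.exp p.2) - l p.1 =
        Real.exp p.2 * (u p.1 - l p.1) / (1 + Real.exp p.2) := by
      field_simp
      ring
    have e2 : u p.1 - (l p.1 + Real.exp p.2 * u p.1) / (1 + Real.exp p.2) =
        (u p.1 - l p.1) / (1 + Real.exp p.2) := by
      field_simp
      ring
    refine Prod.ext rfl ?_
    change Real.log (((l p.1 + Real.exp p.2 * u p.1) / (1 + Real.exp p.2) - l p.1) /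
      (u p.1 - (l p.1 + Real.exp p.2 * u p.1) / (1 + Real.exp p.2))) = p.2
    rw [e1, e2, div_div_div_cancel_right₀ h3, mul_div_cancel_right₀ _ h2.ne', Real.log_exp]
  right_inv := by
    rintro ⟨⟨x, t⟩, h1, h2⟩
    change l x < t at h1
    change t < u x at h2
    have h3 := sub_pos.2 h1
    have h4 := sub_pos.2 h2
    have h5 : u x - t ≠ 0 := h4.ne'
    have h6 : u x - l x ≠ 0 := (sub_pos.2 (h x)).ne'
    refine Subtype.ext (Prod.ext rfl ?_)
    change (l x + Real.exp (Real.log ((t - l x) / (u x - t))) * u x) /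
      (1 + Real.exp (Real.log ((t - l x) / (u x - t)))) = t
    rw [Real.exp_log (by positivity), div_eq_iff (by positivity)]
    field_simp
    ring
  continuous_toFun := by
    refine Continuous.subtype_mk (Continuous.prodMk (by fun_prop)
      (Continuous.div (by fun_prop) (by fun_prop) fun p => ?_)) _
    positivity
  continuous_invFun := by
    refine Continuous.prodMk (by fun_prop) (Continuous.log (Continuous.div (by fun_prop)
      (by fun_prop) fun p => ?_) fun p => ?_)
    · exact (sub_pos.2 p.2.2).ne'
    · exact (div_pos (sub_pos.2 p.2.1) (sub_pos.2 p.2.2)).ne'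

/-- The graph of a continuous function. -/
def graphHomeomorph (f : C → ℝ) (hf : Continuous f) : C ≃ₜ {p : C × ℝ | p.2 = f p.1} where
  toFun x := ⟨(x, f x), rfl⟩
  invFun p := p.1.1
  left_inv _ := rfl
  right_inv p := Subtype.ext (Prod.ext rfl p.2.symm)
  continuous_toFun := by fun_prop
  continuous_invFun := by fun_prop

/-- Only the maximum of the lower and the minimum of the upper functions matter, so the band is a
product of `C` with a line, whether or not it is bounded on either side. -/
theorem Tame.band (hC : Tame C) (L U : Finset C(C, ℝ)) (h : ∀ ξ ∈ L, ∀ η ∈ U, ∀ x, ξ x < η x) :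
    Tame {p : C × ℝ | (∀ ξ ∈ L, ξ p.1 < p.2) ∧ ∀ η ∈ U, p.2 < η p.1} := by
  have hCR := (hC.prod tame_real.1).1
  rcases L.eq_empty_or_nonempty with rfl | hL <;> rcases U.eq_empty_or_nonempty with rfl | hU
  · have e : {p : C × ℝ | (∀ ξ ∈ (∅ : Finset C(C, ℝ)), ξ p.1 < p.2) ∧
        ∀ η ∈ (∅ : Finset C(C, ℝ)), p.2 < η p.1} = Set.univ := by
      ext; simp
    rw [e]
    exact hCR.congr (Homeomorph.Set.univ _).symm
  · have e : {p : C × ℝ | (∀ ξ ∈ (∅ : Finset C(C, ℝ)), ξ p.1 < p.2) ∧ ∀ η ∈ U, p.2 < η p.1} =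
        {p | p.2 < U.inf' hU (fun η => η p.1)} := by
      ext; simp
    rw [e]
    exact hCR.congr (belowHomeomorph (fun x => U.inf' hU fun η => η x)
      (Continuous.finset_inf'_apply hU fun η _ => η.continuous))
  · have e : {p : C × ℝ | (∀ ξ ∈ L, ξ p.1 < p.2) ∧ ∀ η ∈ (∅ : Finset C(C, ℝ)), p.2 < η p.1} =
        {p | L.sup' hL (fun ξ => ξ p.1) < p.2} := by
      ext; simp
    rw [e]
    exact hCR.congr (aboveHomeomorph (fun x => L.sup' hL fun ξ => ξ x)
      (Continuous.finset_sup'_apply hL fun ξ _ => ξ.continuous))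
  · have e : {p : C × ℝ | (∀ ξ ∈ L, ξ p.1 < p.2) ∧ ∀ η ∈ U, p.2 < η p.1} =
        {p | L.sup' hL (fun ξ => ξ p.1) < p.2 ∧ p.2 < U.inf' hU (fun η => η p.1)} := by
      ext; simp
    rw [e]
    exact hCR.congr (betweenHomeomorph (fun x => L.sup' hL fun ξ => ξ x)
      (fun x => U.inf' hU fun η => η x)
      (Continuous.finset_sup'_apply hL fun ξ _ => ξ.continuous)
      (Continuous.finset_inf'_apply hU fun η _ => η.continuous)
      fun x => by
        simp only [Finset.lt_inf'_iff, Finset.sup'_lt_iff]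
        exact fun η hη ξ hξ => h ξ hξ η hη x)

/-- The two points lie in the same position relative to the graphs of the family. -/
def SamePosition (Ξ : Finset C(C, ℝ)) (p q : C × ℝ) : Prop :=
  ∀ ξ ∈ Ξ, SignType.sign (p.2 - ξ p.1) = SignType.sign (q.2 - ξ q.1)

/-- The graphs of the family are pairwise equal or disjoint, in a constant order. -/
def Separated (Ξ : Finset C(C, ℝ)) : Prop :=
  ∀ ξ ∈ Ξ, ∀ η ∈ Ξ, ∀ x y, SignType.sign (ξ x - η x) = SignType.sign (ξ y - η y)

/-- `S` is a union of cells of the family, and each nonempty cell is a graph or a band over all of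
`C`, hence homeomorphic to `C` or to `C × ℝ`. -/
theorem Tame.of_slices (hC : Tame C) {Ξ : Finset C(C, ℝ)} (hΞ : Separated Ξ) {S : Set (C × ℝ)}
    (hS : IsLocallyClosed S) (h : ∀ p q, SamePosition Ξ p q → p ∈ S → q ∈ S) : Tame S := by
  classical
  have := hC.locallyCompact
  have := hC.metrizable
  refine tame_of_signs Ξ (h := fun ξ p => p.2 - ξ p.1) (fun ξ _ => by fun_prop) hS fun σ => ?_
  rcases (S ∩ {p : C × ℝ | ∀ ξ ∈ Ξ, SignType.sign (p.2 - ξ p.1) = σ ξ}).eq_empty_or_nonempty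
    with he | ⟨p₀, hp₀, hσ⟩
  · rw [he]
    exact tame_of_isEmpty
  -- A cell that meets `S` is contained in it.
  · have hsub : S ∩ {p : C × ℝ | ∀ ξ ∈ Ξ, SignType.sign (p.2 - ξ p.1) = σ ξ} =
        {p : C × ℝ | ∀ ξ ∈ Ξ, SignType.sign (p.2 - ξ p.1) = σ ξ} :=
      Set.inter_eq_right.2 fun p hp => h p₀ p (fun ξ hξ => (hσ ξ hξ).trans (hp ξ hξ).symm) hp₀
    rw [hsub]
    by_cases h0 : ∃ ξ ∈ Ξ, σ ξ = 0
    · obtain ⟨ξ, hξ, hξ0⟩ := h0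
      have e : {p : C × ℝ | ∀ ξ ∈ Ξ, SignType.sign (p.2 - ξ p.1) = σ ξ} =
          {p : C × ℝ | p.2 = ξ p.1} := by
        ext p
        constructor
        · intro hp
          have := hp ξ hξ
          rw [hξ0, sign_eq_zero_iff, sub_eq_zero] at this
          exact this
        · intro hp η hη
          have h1 := hσ ξ hξ
          rw [hξ0, sign_eq_zero_iff, sub_eq_zero] at h1
          rw [← hσ η hη, h1, show p.2 = ξ p.1 from hp]
          exact hΞ ξ hξ η hη _ _
      rw [e]
      exact hC.congr (graphHomeomorph ξ ξ.continuous)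
    · push Not at h0
      have e : {p : C × ℝ | ∀ ξ ∈ Ξ, SignType.sign (p.2 - ξ p.1) = σ ξ} =
          {p : C × ℝ | (∀ ξ ∈ Ξ.filter (fun ξ => σ ξ = 1), ξ p.1 < p.2) ∧
            ∀ η ∈ Ξ.filter (fun ξ => σ ξ = -1), p.2 < η p.1} := by
        ext p
        simp only [Set.mem_ofPred_eq, Finset.mem_filter, and_imp]
        constructor
        · refine fun hp => ⟨fun ξ hξ h1 => ?_, fun ξ hξ h1 => ?_⟩
          · have := hp ξ hξ
            rwa [h1, sign_eq_one_iff, sub_pos] at this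
          · have := hp ξ hξ
            rwa [h1, sign_eq_neg_one_iff, sub_neg] at this
        · rintro ⟨h1, h2⟩ ξ hξ
          rcases hs : σ ξ with _ | _ | _
          · exact absurd hs (h0 ξ hξ)
          · exact sign_eq_neg_one_iff.2 (sub_neg.2 (h2 ξ hξ hs))
          · exact sign_eq_one_iff.2 (sub_pos.2 (h1 ξ hξ hs))
      rw [e]
      refine hC.band _ _ fun ξ hξ η hη x => ?_
      rw [Finset.mem_filter] at hξ hη
      have h1 := hσ ξ hξ.1
      have h2 := hσ η hη.1
      rw [hξ.2, sign_eq_one_iff, sub_pos] at h1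
      rw [hη.2, sign_eq_neg_one_iff, sub_neg] at h2
      -- The point `p₀` shows that `ξ < η` over one base point; separatedness carries this to every
      -- base point.
      have h3 := hΞ ξ hξ.1 η hη.1 x p₀.1
      rwa [sign_eq_neg_one_iff.2 (sub_neg.2 (h1.trans h2)), sign_eq_neg_one_iff, sub_neg] at h3

end Bands

/-! ### Polynomials in one variable over a base -/

section OneVariable

open Polynomial

theorem exists_eval_sub_eq (P : ℝ[X]) {a b : ℝ} (h : a ≠ b) :
    ∃ c ∈ Set.Ioo (min a b) (max a b), P.eval b - P.eval a = P.derivative.eval c * (b - a) := by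
  rcases lt_or_gt_of_ne h with h | h
  · obtain ⟨c, hc, e⟩ := exists_deriv_eq_slope (fun t => P.eval t) h P.continuousOn
      P.differentiableOn
    rw [Polynomial.deriv, eq_div_iff (sub_ne_zero.2 h.ne')] at e
    exact ⟨c, by rwa [min_eq_left h.le, max_eq_right h.le], e.symm⟩
  · obtain ⟨c, hc, e⟩ := exists_deriv_eq_slope (fun t => P.eval t) h P.continuousOn
      P.differentiableOn
    rw [Polynomial.deriv, eq_div_iff (sub_ne_zero.2 h.ne')] at e
    exact ⟨c, by rwa [min_eq_right h.le, max_eq_left h.le], by linarith⟩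

/-- A negative increasing polynomial on a band: the band is bounded above and the value at the
upper end is not positive. -/
theorem exists_upper_end {P : ℝ[X]} (hP : 0 < P.degree) {L U : Finset ℝ} {s₀ : ℝ}
    (hL : ∀ l ∈ L, l < s₀) (hU : ∀ u ∈ U, s₀ < u)
    (hneg : ∀ s, (∀ l ∈ L, l < s) → (∀ u ∈ U, s < u) → P.eval s < 0)
    (hder : ∀ s, (∀ l ∈ L, l < s) → (∀ u ∈ U, s < u) → 0 < P.derivative.eval s) :
    ∃ u ∈ U, (∀ u' ∈ U, u ≤ u') ∧ P.eval u ≤ 0 := by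
  rcases U.eq_empty_or_nonempty with rfl | hne
  · exfalso
    have hs : ∀ s ≥ s₀, ∀ l ∈ L, l < s := fun s hs l hl => (hL l hl).trans_le hs
    -- On a band unbounded above, a negative increasing polynomial would be bounded, which a
    -- nonconstant one is not.
    have hb : ∀ s ≥ s₀, |P.eval s| ≤ |P.eval s₀| := by
      intro s h
      have h1 := hneg s (hs s h) (by simp)
      have h0 := hneg s₀ hL (by simp)
      rw [abs_of_neg h1, abs_of_neg h0]
      rcases eq_or_ne s₀ s with rfl | hne
      · exact le_rfl
      · obtain ⟨c, hc, e⟩ := exists_eval_sub_eq P hne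
        rw [min_eq_left h] at hc
        have h2 := hder c (hs c hc.1.le) (by simp)
        nlinarith [mul_nonneg h2.le (sub_nonneg.2 h)]
    have ht := P.abs_tendsto_atTop hP
    obtain ⟨s, h1, h2⟩ := ((ht.eventually_gt_atTop (|P.eval s₀|)).and (eventually_ge_atTop s₀)).exists
    exact absurd (hb s h2) (not_le.2 h1)
  · refine ⟨U.min' hne, U.min'_mem hne, fun u' hu' => U.min'_le u' hu', ?_⟩
    by_contra hpos
    rw [not_le] at hpos
    have h1 : ∀ᶠ s in 𝓝[<] (U.min' hne), 0 < P.eval s :=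
      (P.continuous.continuousAt.eventually (lt_mem_nhds hpos)).filter_mono nhdsWithin_le_nhds
    have h2 : ∀ᶠ s in 𝓝[<] (U.min' hne), s ∈ Set.Ioo s₀ (U.min' hne) :=
      Ioo_mem_nhdsLT (hU _ (U.min'_mem hne))
    obtain ⟨s, h3, h4⟩ := (h1.and h2).exists
    exact absurd (hneg s (fun l hl => (hL l hl).trans h4.1)
      fun u hu => h4.2.trans_le (U.min'_le u hu)) (not_lt.2 h3.le)

/-- The mirror image of `exists_upper_end` under `s ↦ -s`. -/
theorem exists_lower_end {P : ℝ[X]} (hP : 0 < P.degree) {L U : Finset ℝ} {s₀ : ℝ}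
    (hL : ∀ l ∈ L, l < s₀) (hU : ∀ u ∈ U, s₀ < u)
    (hneg : ∀ s, (∀ l ∈ L, l < s) → (∀ u ∈ U, s < u) → P.eval s < 0)
    (hder : ∀ s, (∀ l ∈ L, l < s) → (∀ u ∈ U, s < u) → P.derivative.eval s < 0) :
    ∃ l ∈ L, (∀ l' ∈ L, l' ≤ l) ∧ P.eval l ≤ 0 := by
  classical
  have hdeg : 0 < (P.comp (-X)).degree := by
    rw [← natDegree_pos_iff_degree_pos] at hP ⊢
    rwa [natDegree_comp, natDegree_neg, natDegree_X, mul_one]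
  have hb : ∀ s, (∀ l ∈ U.image (-·), l < s) → (∀ u ∈ L.image (-·), s < u) →
      (∀ l ∈ L, l < -s) ∧ ∀ u ∈ U, -s < u := fun s h1 h2 =>
    ⟨fun l hl => lt_neg.1 (h2 _ (Finset.mem_image_of_mem _ hl)),
      fun u hu => neg_lt.1 (h1 _ (Finset.mem_image_of_mem _ hu))⟩
  obtain ⟨u, hu, hmin, hle⟩ := exists_upper_end hdeg (L := U.image (-·)) (U := L.image (-·))
    (s₀ := -s₀) (by simpa using hU) (by simpa using hL)
    (fun s h1 h2 => by
      have := hb s h1 h2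
      simpa using hneg _ this.1 this.2)
    (fun s h1 h2 => by
      have := hb s h1 h2
      simpa [derivative_comp] using hder _ this.1 this.2)
  obtain ⟨l, hl, rfl⟩ := Finset.mem_image.1 hu
  refine ⟨l, hl, fun l' hl' => ?_, by simpa using hle⟩
  exact neg_le_neg_iff.1 (hmin _ (Finset.mem_image_of_mem _ hl'))

end OneVariable

/-! ### Positions relative to a separated family -/

section Position

variable {C : Type} [TopologicalSpace C] {Ξ Ξ' : Finset C(C, ℝ)} {p q r : C × ℝ}

theorem SamePosition.refl (p : C × ℝ) : SamePosition Ξ p p := fun _ _ => rfl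

theorem SamePosition.symm (h : SamePosition Ξ p q) : SamePosition Ξ q p :=
  fun ξ hξ => (h ξ hξ).symm

theorem SamePosition.trans (h : SamePosition Ξ p q) (h' : SamePosition Ξ q r) :
    SamePosition Ξ p r := fun ξ hξ => (h ξ hξ).trans (h' ξ hξ)

theorem SamePosition.mono (hs : Ξ' ⊆ Ξ) (h : SamePosition Ξ p q) : SamePosition Ξ' p q :=
  fun ξ hξ => h ξ (hs hξ)

theorem Separated.mono (hs : Ξ' ⊆ Ξ) (h : Separated Ξ) : Separated Ξ' :=
  fun ξ hξ η hη => h ξ (hs hξ) η (hs hη)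

theorem Separated.samePosition (h : Separated Ξ) {ξ : C(C, ℝ)} (hξ : ξ ∈ Ξ) (x y : C) :
    SamePosition Ξ (x, ξ x) (y, ξ y) := fun η hη => h ξ hξ η hη x y

/-- The point does not lie on any of the graphs. -/
def OffGraphs (Ξ : Finset C(C, ℝ)) (p : C × ℝ) : Prop := ∀ ξ ∈ Ξ, p.2 ≠ ξ p.1

theorem SamePosition.offGraphs (h : SamePosition Ξ p q) (hp : OffGraphs Ξ p) : OffGraphs Ξ q := by
  intro ξ hξ e
  refine hp ξ hξ ?_
  have := h ξ hξ
  rwa [e, sub_self, sign_zero, sign_eq_zero_iff, sub_eq_zero] at this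

theorem SamePosition.between {y : C} {s₁ s₂ s : ℝ} (h₁ : SamePosition Ξ p (y, s₁))
    (h₂ : SamePosition Ξ p (y, s₂)) (hs : s ∈ Set.uIcc s₁ s₂) : SamePosition Ξ p (y, s) := by
  wlog h : s₁ ≤ s₂ generalizing s₁ s₂
  · exact this h₂ h₁ (by rwa [Set.uIcc_comm]) (le_of_not_ge h)
  rw [Set.uIcc_of_le h] at hs
  intro ξ hξ
  refine le_antisymm ?_ ?_
  · rw [h₁ ξ hξ]
    exact SignType.sign.monotone (sub_le_sub_right hs.1 _)
  · rw [h₂ ξ hξ]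
    exact SignType.sign.monotone (sub_le_sub_right hs.2 _)

theorem samePosition_iff_of_offGraphs (hp : OffGraphs Ξ p) :
    SamePosition Ξ p q ↔ (∀ ξ ∈ Ξ, ξ p.1 < p.2 → ξ q.1 < q.2) ∧
      ∀ ξ ∈ Ξ, p.2 < ξ p.1 → q.2 < ξ q.1 := by
  constructor
  · refine fun h => ⟨fun ξ hξ hlt => ?_, fun ξ hξ hlt => ?_⟩
    · have := h ξ hξ
      rw [sign_eq_one_iff.2 (sub_pos.2 hlt)] at this
      exact sub_pos.1 (sign_eq_one_iff.1 this.symm)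
    · have := h ξ hξ
      rw [sign_eq_neg_one_iff.2 (sub_neg.2 hlt)] at this
      exact sub_neg.1 (sign_eq_neg_one_iff.1 this.symm)
  · rintro ⟨h1, h2⟩ ξ hξ
    rcases lt_or_gt_of_ne (hp ξ hξ) with h | h
    · rw [sign_eq_neg_one_iff.2 (sub_neg.2 h), sign_eq_neg_one_iff.2 (sub_neg.2 (h2 ξ hξ h))]
    · rw [sign_eq_one_iff.2 (sub_pos.2 h), sign_eq_one_iff.2 (sub_pos.2 (h1 ξ hξ h))]

theorem Separated.lt_of_lt (h : Separated Ξ) {ξ η : C(C, ℝ)} (hξ : ξ ∈ Ξ) (hη : η ∈ Ξ) {x : C}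
    (y : C) (hlt : ξ x < η x) : ξ y < η y := by
  have := h ξ hξ η hη x y
  rw [sign_eq_neg_one_iff.2 (sub_neg.2 hlt)] at this
  exact sub_neg.1 (sign_eq_neg_one_iff.1 this.symm)

theorem Separated.le_of_le (h : Separated Ξ) {ξ η : C(C, ℝ)} (hξ : ξ ∈ Ξ) (hη : η ∈ Ξ) {x : C}
    (y : C) (hle : ξ x ≤ η x) : ξ y ≤ η y :=
  le_of_not_gt fun hlt => absurd (h.lt_of_lt hη hξ x hlt) (not_lt.2 hle)

/-- Every position is realized over every point of the base. -/
theorem Separated.exists_samePosition (h : Separated Ξ) (p : C × ℝ) (y : C) :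
    ∃ s, SamePosition Ξ p (y, s) := by
  classical
  by_cases hp : OffGraphs Ξ p
  · obtain ⟨s, h1, h2⟩ := Order.exists_between_finsets
      ((Ξ.filter fun ξ => ξ p.1 < p.2).image fun ξ => ξ y)
      ((Ξ.filter fun ξ => p.2 < ξ p.1).image fun ξ => ξ y) (by
        simp only [Finset.mem_image, Finset.mem_filter]
        rintro _ ⟨ξ, ⟨hξ, h1⟩, rfl⟩ _ ⟨η, ⟨hη, h2⟩, rfl⟩
        exact h.lt_of_lt hξ hη y (h1.trans h2))
    refine ⟨s, (samePosition_iff_of_offGraphs hp).2 ⟨fun ξ hξ hlt => ?_, fun ξ hξ hlt => ?_⟩⟩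
    · exact h1 _ (Finset.mem_image_of_mem _ (Finset.mem_filter.2 ⟨hξ, hlt⟩))
    · exact h2 _ (Finset.mem_image_of_mem _ (Finset.mem_filter.2 ⟨hξ, hlt⟩))
  · simp only [OffGraphs, not_forall, not_not, exists_prop] at hp
    obtain ⟨ξ, hξ, e⟩ := hp
    refine ⟨ξ y, ?_⟩
    have : p = (p.1, ξ p.1) := Prod.ext rfl e
    rw [this]
    exact h.samePosition hξ _ _

theorem eventually_sign_eq {T : Type*} [TopologicalSpace T] {h : T → ℝ} {a : T}
    (hc : ContinuousAt h a) (h0 : h a ≠ 0) :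
    ∀ᶠ x in 𝓝 a, SignType.sign (h x) = SignType.sign (h a) := by
  rcases lt_or_gt_of_ne h0 with h0 | h0
  · filter_upwards [hc.eventually (gt_mem_nhds h0)] with x hx
    rw [sign_eq_neg_one_iff.2 hx, sign_eq_neg_one_iff.2 h0]
  · filter_upwards [hc.eventually (lt_mem_nhds h0)] with x hx
    rw [sign_eq_one_iff.2 hx, sign_eq_one_iff.2 h0]

theorem OffGraphs.eventually (hp : OffGraphs Ξ p) (h : SamePosition Ξ p q) :
    ∀ᶠ q' in 𝓝 q, SamePosition Ξ p q' := by
  simp only [SamePosition]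
  rw [Filter.eventually_all_finset]
  intro ξ hξ
  have hc : ContinuousAt (fun q' : C × ℝ => q'.2 - ξ q'.1) q := by fun_prop
  filter_upwards [eventually_sign_eq hc (sub_ne_zero.2 (h.offGraphs hp ξ hξ))] with q' hq'
  rw [h ξ hξ, hq']

end Position

/-! ### Adding a polynomial to a sliced family -/

section PolynomialFamily

open Polynomial

variable {C : Type} [TopologicalSpace C] {Ξ : Finset C(C, ℝ)}

/-- The sign of the polynomial family is determined by the position. -/
def SignAdapted (Ξ : Finset C(C, ℝ)) (Q : C → ℝ[X]) : Prop :=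
  ∀ p q, SamePosition Ξ p q → SignType.sign ((Q p.1).eval p.2) = SignType.sign ((Q q.1).eval q.2)

/-- Hypotheses on a polynomial family whose derivative is already under control. -/
structure DerivAdapted (Ξ : Finset C(C, ℝ)) (Q : C → ℝ[X]) : Prop where
  separated : Separated Ξ
  degree_pos : ∀ x, 0 < (Q x).degree
  graph : ∀ ξ ∈ Ξ, ∀ x y, SignType.sign ((Q x).eval (ξ x)) = SignType.sign ((Q y).eval (ξ y))
  deriv_ne : ∀ p, OffGraphs Ξ p → (Q p.1).derivative.eval p.2 ≠ 0
  deriv : SignAdapted Ξ fun x => (Q x).derivative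

variable {Q : C → ℝ[X]} {p : C × ℝ}

theorem DerivAdapted.neg (h : DerivAdapted Ξ Q) : DerivAdapted Ξ fun x => -Q x where
  separated := h.separated
  degree_pos x := by rw [degree_neg]; exact h.degree_pos x
  graph ξ hξ x y := by
    rw [eval_neg, eval_neg, Left.sign_neg, Left.sign_neg, h.graph ξ hξ x y]
  deriv_ne p hp := by
    rw [derivative_neg, eval_neg, neg_ne_zero]
    exact h.deriv_ne p hp
  deriv p q hpq := by
    simp only [derivative_neg, eval_neg, Left.sign_neg]
    exact congrArg _ (h.deriv p q hpq)

/-- Off the graphs the polynomials are strictly monotone along each band, in the same direction over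
all base points. If `Q y` were negative on its whole band, it would be nonpositive at the end
towards which it grows. The sign on that bounding graph is constant, but over `p.1` monotonicity
makes the value there positive. -/
theorem DerivAdapted.exists_nonneg (h : DerivAdapted Ξ Q) (hp : OffGraphs Ξ p)
    (h0 : 0 ≤ (Q p.1).eval p.2) (y : C) : ∃ s, SamePosition Ξ p (y, s) ∧ 0 ≤ (Q y).eval s := by
  classical
  obtain ⟨s₀, hs₀⟩ := h.separated.exists_samePosition p y
  by_contra! hneg
  set L := (Ξ.filter fun ξ => ξ p.1 < p.2).image fun ξ => ξ y with hL
  set U := (Ξ.filter fun ξ => p.2 < ξ p.1).image fun ξ => ξ y with hU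
  have hband : ∀ s, SamePosition Ξ p (y, s) ↔ (∀ l ∈ L, l < s) ∧ ∀ u ∈ U, s < u := by
    intro s
    rw [samePosition_iff_of_offGraphs hp]
    simp only [hL, hU, Finset.forall_mem_image, Finset.mem_filter, and_imp]
  have h1 := (hband s₀).1 hs₀
  rcases lt_or_gt_of_ne (h.deriv_ne p hp) with hd | hd
  · obtain ⟨l, hl, hmax, hle⟩ := exists_lower_end (h.degree_pos y) h1.1 h1.2
      (fun s h1 h2 => hneg s ((hband s).2 ⟨h1, h2⟩)) (fun s h1 h2 => by
        have := h.deriv p (y, s) ((hband s).2 ⟨h1, h2⟩)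
        simp only at this
        rw [sign_eq_neg_one_iff.2 hd] at this
        exact sign_eq_neg_one_iff.1 this.symm)
    obtain ⟨ξ, hξ, rfl⟩ := Finset.mem_image.1 hl
    rw [Finset.mem_filter] at hξ
    obtain ⟨c, hc, e⟩ := exists_eval_sub_eq (Q p.1) hξ.2.ne
    rw [min_eq_left hξ.2.le, max_eq_right hξ.2.le] at hc
    have hpc : SamePosition Ξ p (p.1, c) := by
      refine (samePosition_iff_of_offGraphs hp).2 ⟨fun η hη hlt => ?_, fun η hη hlt => ?_⟩
      · refine lt_of_le_of_lt ?_ hc.1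
        exact h.separated.le_of_le hη hξ.1 (x := y) _
          (hmax _ (Finset.mem_image_of_mem _ (Finset.mem_filter.2 ⟨hη, hlt⟩)))
      · exact hc.2.trans hlt
    have h2 := h.deriv _ _ hpc
    rw [sign_eq_neg_one_iff.2 hd] at h2
    have h3 := sign_eq_neg_one_iff.1 h2.symm
    have h4 : 0 < (Q p.1).eval (ξ p.1) := by nlinarith [mul_neg_of_neg_of_pos h3 (sub_pos.2 hξ.2)]
    have h5 := h.graph ξ hξ.1 p.1 y
    rw [sign_eq_one_iff.2 h4] at h5
    exact absurd (sign_eq_one_iff.1 h5.symm) (not_lt.2 hle)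
  · obtain ⟨u, hu, hmin, hle⟩ := exists_upper_end (h.degree_pos y) h1.1 h1.2
      (fun s h1 h2 => hneg s ((hband s).2 ⟨h1, h2⟩)) (fun s h1 h2 => by
        have := h.deriv p (y, s) ((hband s).2 ⟨h1, h2⟩)
        simp only at this
        rw [sign_eq_one_iff.2 hd] at this
        exact sign_eq_one_iff.1 this.symm)
    obtain ⟨ξ, hξ, rfl⟩ := Finset.mem_image.1 hu
    rw [Finset.mem_filter] at hξ
    obtain ⟨c, hc, e⟩ := exists_eval_sub_eq (Q p.1) hξ.2.ne
    rw [min_eq_left hξ.2.le, max_eq_right hξ.2.le] at hc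
    have hpc : SamePosition Ξ p (p.1, c) := by
      refine (samePosition_iff_of_offGraphs hp).2 ⟨fun η hη hlt => ?_, fun η hη hlt => ?_⟩
      · exact hlt.trans hc.1
      · refine lt_of_lt_of_le hc.2 ?_
        exact h.separated.le_of_le hξ.1 hη (x := y) _
          (hmin _ (Finset.mem_image_of_mem _ (Finset.mem_filter.2 ⟨hη, hlt⟩)))
    have h2 := h.deriv _ _ hpc
    rw [sign_eq_one_iff.2 hd] at h2
    have h3 := sign_eq_one_iff.1 h2.symm
    have h4 : 0 < (Q p.1).eval (ξ p.1) := by nlinarith [mul_pos h3 (sub_pos.2 hξ.2)]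
    have h5 := h.graph ξ hξ.1 p.1 y
    rw [sign_eq_one_iff.2 h4] at h5
    exact absurd (sign_eq_one_iff.1 h5.symm) (not_lt.2 hle)

theorem DerivAdapted.exists_nonpos (h : DerivAdapted Ξ Q) (hp : OffGraphs Ξ p)
    (h0 : (Q p.1).eval p.2 ≤ 0) (y : C) : ∃ s, SamePosition Ξ p (y, s) ∧ (Q y).eval s ≤ 0 := by
  obtain ⟨s, h1, h2⟩ := h.neg.exists_nonneg hp (by simpa using h0) y
  exact ⟨s, h1, by simpa using h2⟩

theorem exists_eval_eq_zero (P : ℝ[X]) {a b : ℝ} (ha : 0 ≤ P.eval a) (hb : P.eval b ≤ 0) :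
    ∃ s ∈ Set.uIcc a b, P.eval s = 0 := by
  have := intermediate_value_uIcc (a := a) (b := b) (f := fun t => P.eval t) P.continuousOn
  obtain ⟨s, hs, e⟩ := this (Set.mem_uIcc.2 (Or.inr ⟨hb, ha⟩))
  exact ⟨s, hs, e⟩

theorem DerivAdapted.exists_zero (h : DerivAdapted Ξ Q) (hp : OffGraphs Ξ p)
    (h0 : (Q p.1).eval p.2 = 0) (y : C) : ∃ s, SamePosition Ξ p (y, s) ∧ (Q y).eval s = 0 := by
  obtain ⟨a, ha, ha'⟩ := h.exists_nonneg hp h0.ge y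
  obtain ⟨b, hb, hb'⟩ := h.exists_nonpos hp h0.le y
  obtain ⟨s, hs, e⟩ := exists_eval_eq_zero (Q y) ha' hb'
  exact ⟨s, ha.between hb hs, e⟩

/-- By the mean value theorem, inside a band the sign of `Q` is equivalent to the position relative
to its zero. This gives uniqueness of the zero, its continuity and adaptedness of the enlarged
family. -/
theorem DerivAdapted.sign_eval (h : DerivAdapted Ξ Q) {y : C} {r s : ℝ}
    (hr : SamePosition Ξ p (y, r)) (h0 : (Q y).eval r = 0) (hs : SamePosition Ξ p (y, s)) :
    SignType.sign ((Q y).eval s) =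
      SignType.sign ((Q p.1).derivative.eval p.2) * SignType.sign (s - r) := by
  rcases eq_or_ne r s with rfl | hne
  · rw [h0, sub_self, sign_zero, mul_zero]
  · obtain ⟨c, hc, e⟩ := exists_eval_sub_eq (Q y) hne
    rw [h0, sub_zero] at e
    have := h.deriv p (y, c) (hr.between hs ⟨hc.1.le, hc.2.le⟩)
    simp only at this
    rw [e, sign_mul, this]

theorem sign_mul_cancel {a b c : SignType} (ha : a ≠ 0) (h : a * b = a * c) : b = c := by
  revert a b c
  decide

theorem DerivAdapted.sign_deriv_ne (h : DerivAdapted Ξ Q) (hp : OffGraphs Ξ p) :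
    SignType.sign ((Q p.1).derivative.eval p.2) ≠ 0 := by
  rw [Ne, sign_eq_zero_iff]
  exact h.deriv_ne p hp

theorem DerivAdapted.zero_unique (h : DerivAdapted Ξ Q) (hp : OffGraphs Ξ p) {y : C} {r s : ℝ}
    (hr : SamePosition Ξ p (y, r)) (h0 : (Q y).eval r = 0) (hs : SamePosition Ξ p (y, s))
    (h1 : (Q y).eval s = 0) : s = r := by
  have := h.sign_eval hr h0 hs
  rw [h1, sign_zero, ← mul_zero (SignType.sign ((Q p.1).derivative.eval p.2))] at this
  have := sign_mul_cancel (h.sign_deriv_ne hp) this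
  rw [eq_comm, sign_eq_zero_iff, sub_eq_zero] at this
  exact this

/-- For fixed `a` near `ρ y₀`, the sign of `(Q y).eval a` is locally constant in `y` and tells on
which side of `a` the zero lies. Continuity of `Q` therefore suffices, without an implicit function
theorem. -/
theorem DerivAdapted.continuous_zero (h : DerivAdapted Ξ Q)
    (hQ : Continuous fun p : C × ℝ => (Q p.1).eval p.2) (hp : OffGraphs Ξ p) {ρ : C → ℝ}
    (hρ : ∀ y, SamePosition Ξ p (y, ρ y)) (h0 : ∀ y, (Q y).eval (ρ y) = 0) : Continuous ρ := by
  rw [continuous_iff_continuousAt]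
  intro y₀
  have key : ∀ a, SamePosition Ξ p (y₀, a) → a ≠ ρ y₀ →
      ∀ᶠ y in 𝓝 y₀, SignType.sign (a - ρ y) = SignType.sign (a - ρ y₀) := by
    intro a ha hne
    have hne' : (Q y₀).eval a ≠ 0 := fun e => hne (h.zero_unique hp (hρ y₀) (h0 y₀) ha e)
    have hc : ContinuousAt (fun y => (Q y).eval a) y₀ :=
      (hQ.comp (continuous_id.prodMk continuous_const)).continuousAt
    have hpos : ∀ᶠ y in 𝓝 y₀, SamePosition Ξ p (y, a) :=
      (continuous_id.prodMk continuous_const).continuousAt.eventually (hp.eventually ha)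
    filter_upwards [hpos, eventually_sign_eq hc hne'] with y h1 h2
    rw [h.sign_eval (hρ y) (h0 y) h1, h.sign_eval (hρ y₀) (h0 y₀) ha] at h2
    exact sign_mul_cancel (h.sign_deriv_ne hp) h2
  have hnear : ∀ᶠ a in 𝓝 (ρ y₀), SamePosition Ξ p (y₀, a) :=
    (continuous_const.prodMk continuous_id).continuousAt.eventually (hp.eventually (hρ y₀))
  refine tendsto_order.2 ⟨fun b hb => ?_, fun b hb => ?_⟩
  · obtain ⟨a, h1, h2⟩ := ((hnear.filter_mono nhdsWithin_le_nhds).and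
      (Ioo_mem_nhdsLT hb)).exists
    filter_upwards [key a h1 h2.2.ne] with y hy
    rw [sign_eq_neg_one_iff.2 (sub_neg.2 h2.2), sign_eq_neg_one_iff, sub_neg] at hy
    exact h2.1.trans hy
  · obtain ⟨a, h1, h2⟩ := ((hnear.filter_mono nhdsWithin_le_nhds).and
      (Ioo_mem_nhdsGT hb)).exists
    filter_upwards [key a h1 h2.1.ne'] with y hy
    rw [sign_eq_one_iff.2 (sub_pos.2 h2.1), sign_eq_one_iff, sub_pos] at hy
    exact hy.trans h2.2

/-- The zeros of the family off the old graphs are finitely many new graphs. -/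
theorem DerivAdapted.exists_slices [Nonempty C] (h : DerivAdapted Ξ Q)
    (hQ : Continuous fun p : C × ℝ => (Q p.1).eval p.2) :
    ∃ Ξ' : Finset C(C, ℝ), Ξ ⊆ Ξ' ∧ Separated Ξ' ∧ SignAdapted Ξ' Q := by
  classical
  obtain ⟨x₀⟩ := ‹Nonempty C›
  -- Each root over the base point `x₀` spreads to a graph; values of `t` that are not such roots
  -- get a dummy graph, so that `ρ` is a total function.
  have hex : ∀ t : ℝ, ∃ ρ : C(C, ℝ), OffGraphs Ξ (x₀, t) → (Q x₀).eval t = 0 →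
      ∀ y, SamePosition Ξ (x₀, t) (y, ρ y) ∧ (Q y).eval (ρ y) = 0 := by
    intro t
    by_cases ht : OffGraphs Ξ (x₀, t) ∧ (Q x₀).eval t = 0
    · choose ρ h1 h2 using fun y => h.exists_zero (p := (x₀, t)) ht.1 ht.2 y
      exact ⟨⟨ρ, h.continuous_zero hQ ht.1 h1 h2⟩, fun _ _ y => ⟨h1 y, h2 y⟩⟩
    · exact ⟨0, fun h1 h2 => absurd ⟨h1, h2⟩ ht⟩
  choose ρ hρ using hex
  set R := (Q x₀).roots.toFinset.filter fun t => OffGraphs Ξ (x₀, t) with hR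
  have hQ0 : Q x₀ ≠ 0 := fun e => by
    have := h.degree_pos x₀
    simp [e] at this
  have hmem : ∀ t, t ∈ R ↔ OffGraphs Ξ (x₀, t) ∧ (Q x₀).eval t = 0 := by
    intro t
    rw [hR, Finset.mem_filter, Multiset.mem_toFinset, mem_roots hQ0, IsRoot.def, and_comm]
  have hpos : ∀ t ∈ R, ∀ y, SamePosition Ξ (x₀, t) (y, ρ t y) := fun t ht y =>
    (hρ t ((hmem t).1 ht).1 ((hmem t).1 ht).2 y).1
  have hzero : ∀ t ∈ R, ∀ y, (Q y).eval (ρ t y) = 0 := fun t ht y =>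
    (hρ t ((hmem t).1 ht).1 ((hmem t).1 ht).2 y).2
  -- every zero off the old graphs lies on a new one
  have hcover : ∀ q : C × ℝ, OffGraphs Ξ q → (Q q.1).eval q.2 = 0 → ∃ t ∈ R, q.2 = ρ t q.1 := by
    intro q hq hq0
    obtain ⟨t, ht, ht0⟩ := h.exists_zero hq hq0 x₀
    have htR : t ∈ R := (hmem t).2 ⟨ht.offGraphs hq, ht0⟩
    refine ⟨t, htR, ?_⟩
    exact h.zero_unique hq (ht.trans (hpos t htR q.1)) (hzero t htR q.1) (.refl q) hq0
  refine ⟨Ξ ∪ R.image ρ, Finset.subset_union_left, ?_, ?_⟩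
  · have h1 : ∀ ξ ∈ Ξ, ∀ t ∈ R, ∀ x y,
        SignType.sign (ρ t x - ξ x) = SignType.sign (ρ t y - ξ y) := fun ξ hξ t ht x y =>
      (hpos t ht x ξ hξ).symm.trans (hpos t ht y ξ hξ)
    intro ξ hξ η hη x y
    rw [Finset.mem_union, Finset.mem_image] at hξ hη
    rcases hξ with hξ | ⟨t, ht, rfl⟩ <;> rcases hη with hη | ⟨t', ht', rfl⟩
    · exact h.separated ξ hξ η hη x y
    · have := h1 ξ hξ t' ht' x y
      rw [← neg_sub, Left.sign_neg, this, ← Left.sign_neg, neg_sub]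
    · exact h1 η hη t ht x y
    · rcases eq_or_ne t t' with rfl | hne
      · simp
      · have hoff := ((hmem t).1 ht).1
        have hoff' := ((hmem t').1 ht').1
        -- A band contains at most one zero, so distinct roots are separated by an old graph, and
        -- this fixes their order over every base point.
        have hns : ¬ SamePosition Ξ (x₀, t) (x₀, t') := fun H => hne
          (h.zero_unique hoff H ((hmem t').1 ht').2 (.refl _) ((hmem t).1 ht).2)
        simp only [SamePosition, not_forall] at hns
        obtain ⟨ξ, hξ, hns⟩ := hns
        have e1 := fun x => hpos t ht x ξ hξ
        have e2 := fun x => hpos t' ht' x ξ hξ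
        simp only at e1 e2
        rcases lt_or_gt_of_ne (hoff ξ hξ) with h2 | h2 <;>
          rcases lt_or_gt_of_ne (hoff' ξ hξ) with h3 | h3
        · exact absurd ((sign_eq_neg_one_iff.2 (sub_neg.2 h2)).trans
            (sign_eq_neg_one_iff.2 (sub_neg.2 h3)).symm) hns
        · have : ∀ x, ρ t x - ρ t' x < 0 := fun x => by
            have h4 := (e1 x).symm.trans (sign_eq_neg_one_iff.2 (sub_neg.2 h2))
            have h5 := (e2 x).symm.trans (sign_eq_one_iff.2 (sub_pos.2 h3))
            rw [sign_eq_neg_one_iff] at h4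
            rw [sign_eq_one_iff] at h5
            linarith
          rw [sign_eq_neg_one_iff.2 (this x), sign_eq_neg_one_iff.2 (this y)]
        · have : ∀ x, 0 < ρ t x - ρ t' x := fun x => by
            have h4 := (e1 x).symm.trans (sign_eq_one_iff.2 (sub_pos.2 h2))
            have h5 := (e2 x).symm.trans (sign_eq_neg_one_iff.2 (sub_neg.2 h3))
            rw [sign_eq_one_iff] at h4
            rw [sign_eq_neg_one_iff] at h5
            linarith
          rw [sign_eq_one_iff.2 (this x), sign_eq_one_iff.2 (this y)]
        · exact absurd ((sign_eq_one_iff.2 (sub_pos.2 h2)).trans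
            (sign_eq_one_iff.2 (sub_pos.2 h3)).symm) hns
  · intro p q hpq
    have hpq' : SamePosition Ξ p q := hpq.mono Finset.subset_union_left
    by_cases hp : OffGraphs Ξ p
    · have hz : ∀ p q : C × ℝ, SamePosition (Ξ ∪ R.image ρ) p q → OffGraphs Ξ p →
          (Q p.1).eval p.2 = 0 → (Q q.1).eval q.2 = 0 := by
        intro p q hpq hp h0
        obtain ⟨t, ht, e⟩ := hcover p hp h0
        have := hpq (ρ t) (Finset.mem_union_right _ (Finset.mem_image_of_mem _ ht))
        rw [e, sub_self, sign_zero, eq_comm, sign_eq_zero_iff, sub_eq_zero] at this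
        rw [this]
        exact hzero t ht _
      by_cases h0 : (Q p.1).eval p.2 = 0
      · rw [h0, hz p q hpq hp h0]
      -- If the band contains a zero over `x₀`, it contains one over every point, and the position
      -- relative to the new graph determines the sign. If not, it contains none anywhere, and the
      -- sign cannot change.
      · by_cases hex : ∃ t, SamePosition Ξ p (x₀, t) ∧ (Q x₀).eval t = 0
        · obtain ⟨t, ht, ht0⟩ := hex
          have htR : t ∈ R := (hmem t).2 ⟨ht.offGraphs hp, ht0⟩
          have e1 := h.sign_eval (ht.trans (hpos t htR p.1)) (hzero t htR p.1) (.refl p)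
          have e2 := h.sign_eval (ht.trans (hpos t htR q.1)) (hzero t htR q.1) hpq'
          rw [e1, e2, hpq (ρ t) (Finset.mem_union_right _ (Finset.mem_image_of_mem _ htR))]
        · have hno : ∀ q', SamePosition Ξ p q' → (Q q'.1).eval q'.2 ≠ 0 := fun q' hq' e => by
            obtain ⟨t, ht, ht0⟩ := h.exists_zero (hq'.offGraphs hp) e x₀
            exact hex ⟨t, hq'.trans ht, ht0⟩
          rcases lt_or_gt_of_ne h0 with hlt | hlt
          · obtain ⟨s, hs, hs0⟩ := h.exists_nonpos hp hlt.le q.1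
            have : (Q q.1).eval q.2 < 0 := by
              by_contra hge
              obtain ⟨r, hr, hr0⟩ := exists_eval_eq_zero (Q q.1) (not_lt.1 hge) hs0
              exact hno (q.1, r) (SamePosition.between (s₁ := q.2) hpq' hs hr) hr0
            rw [sign_eq_neg_one_iff.2 hlt, sign_eq_neg_one_iff.2 this]
          · obtain ⟨s, hs, hs0⟩ := h.exists_nonneg hp hlt.le q.1
            have : 0 < (Q q.1).eval q.2 := by
              by_contra hge
              obtain ⟨r, hr, hr0⟩ := exists_eval_eq_zero (Q q.1) hs0 (not_lt.1 hge)
              exact hno (q.1, r) (SamePosition.between (s₂ := q.2) hs hpq' hr) hr0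
            rw [sign_eq_one_iff.2 hlt, sign_eq_one_iff.2 this]
    · simp only [OffGraphs, not_forall, not_not, exists_prop] at hp
      obtain ⟨ξ, hξ, e⟩ := hp
      have e' := hpq' ξ hξ
      rw [e, sub_self, sign_zero, eq_comm, sign_eq_zero_iff, sub_eq_zero] at e'
      rw [e, e']
      exact h.graph ξ hξ _ _

/-- Graphs which are not zeros of a family of polynomials can be discarded. -/
theorem exists_discard {ι : Type*} (I : Set ι) {P : ι → C → ℝ[X]} (hΞ : Separated Ξ)
    (hP : ∀ i ∈ I, SignAdapted Ξ (P i)) (h0 : ∀ i ∈ I, ∀ x, P i x ≠ 0) :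
    ∃ Ξ' ⊆ Ξ, (∀ ξ ∈ Ξ', ∃ i ∈ I, ∀ x, (P i x).eval (ξ x) = 0) ∧
      (∀ i ∈ I, ∀ p, OffGraphs Ξ' p → (P i p.1).eval p.2 ≠ 0) ∧
      ∀ i ∈ I, SignAdapted Ξ' (P i) := by
  classical
  set Ξ' := Ξ.filter fun ξ => ∃ i ∈ I, ∀ x, (P i x).eval (ξ x) = 0 with hΞ'
  have hsub : Ξ' ⊆ Ξ := Finset.filter_subset _ _
  have hroot : ∀ i ∈ I, ∀ p : C × ℝ, (P i p.1).eval p.2 = 0 → ∃ ξ ∈ Ξ', p.2 = ξ p.1 := by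
    intro i hi p hp
    by_contra! hoff
    by_cases hp' : OffGraphs Ξ p
    · have h1 : ∀ᶠ s in 𝓝 p.2, SamePosition Ξ p (p.1, s) :=
        (continuous_const.prodMk continuous_id).continuousAt.eventually
          (hp'.eventually (.refl p))
      -- A zero off all graphs would make the polynomial vanish on an interval, although it is
      -- nonzero.
      have h2 : ∀ᶠ s in 𝓝 p.2, s ∈ (P i p.1).rootSet ℝ := by
        filter_upwards [h1] with s hs
        have := hP i hi _ _ hs
        rw [hp, sign_zero, eq_comm, sign_eq_zero_iff] at this
        rw [mem_rootSet]
        exact ⟨h0 i hi _, by simpa using this⟩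
      exact (infinite_of_mem_nhds p.2 h2) (rootSet_finite _ _)
    · simp only [OffGraphs, not_forall, not_not, exists_prop] at hp'
      obtain ⟨ξ, hξ, e⟩ := hp'
      refine hoff ξ (Finset.mem_filter.2 ⟨hξ, i, hi, fun x => ?_⟩) e
      have := hP i hi _ _ (hΞ.samePosition hξ p.1 x)
      simp only at this
      rw [← e, hp, sign_zero, eq_comm, sign_eq_zero_iff] at this
      exact this
  refine ⟨Ξ', hsub, fun ξ hξ => (Finset.mem_filter.1 hξ).2, fun i hi p hp e => ?_, ?_⟩
  · obtain ⟨ξ, hξ, e'⟩ := hroot i hi p e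
    exact hp ξ hξ e'
  · intro i hi p q hpq
    obtain ⟨s, hs⟩ := hΞ.exists_samePosition p q.1
    rw [hP i hi _ _ hs]
    have hqs : SamePosition Ξ' q (q.1, s) := hpq.symm.trans (hs.mono hsub)
    by_cases hq : OffGraphs Ξ' q
    -- The fibre segment from `s` to `q.2` meets no kept graph, hence no zero, so the sign is
    -- constant along it.
    · have hno : ∀ r ∈ Set.uIcc s q.2, (P i q.1).eval r ≠ 0 := by
        intro r hr e
        obtain ⟨ξ, hξ, e'⟩ := hroot i hi (q.1, r) e
        exact (hqs.between (s₂ := q.2) (.refl q) hr).offGraphs hq ξ hξ e'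
      simp only
      rcases lt_or_gt_of_ne (hno s Set.left_mem_uIcc) with h1 | h1 <;>
        rcases lt_or_gt_of_ne (hno q.2 Set.right_mem_uIcc) with h2 | h2
      · rw [sign_eq_neg_one_iff.2 h1, sign_eq_neg_one_iff.2 h2]
      · obtain ⟨r, hr, e⟩ := exists_eval_eq_zero (P i q.1) h2.le h1.le
        exact absurd e (hno r (by rwa [Set.uIcc_comm]))
      · obtain ⟨r, hr, e⟩ := exists_eval_eq_zero (P i q.1) h1.le h2.le
        exact absurd e (hno r hr)
      · rw [sign_eq_one_iff.2 h1, sign_eq_one_iff.2 h2]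
    · simp only [OffGraphs, not_forall, not_not, exists_prop] at hq
      obtain ⟨ξ, hξ, e⟩ := hq
      have := hqs ξ hξ
      rw [e, sub_self, sign_zero, eq_comm, sign_eq_zero_iff, sub_eq_zero] at this
      simp only at this ⊢
      rw [this, e]

end PolynomialFamily

/-! ### Slicing polynomials over sign-invariant sets -/

section Slicing

open Polynomial

/-- Pseudo-division. -/
theorem exists_pseudo_remainder {A : Type*} [CommRing A] (p q : A[X]) (hp : 1 ≤ p.natDegree) :
    ∃ (k : ℕ) (s r : A[X]), C (p.leadingCoeff) ^ k * q = p * s + r ∧ r.natDegree < p.natDegree := by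
  induction hn : q.natDegree using Nat.strong_induction_on generalizing q with
  | _ n ih =>
    subst hn
    by_cases hlt : q.natDegree < p.natDegree
    · exact ⟨0, 0, q, by simp, hlt⟩
    · rw [not_lt] at hlt
      set q₁ := C p.leadingCoeff * q - p * (C q.leadingCoeff * X ^ (q.natDegree - p.natDegree))
        with hq₁
      have hle : q₁.natDegree ≤ q.natDegree := by
        refine (natDegree_sub_le _ _).trans (max_le (natDegree_C_mul_le _ _) ?_)
        refine natDegree_mul_le.trans ?_
        have := natDegree_C_mul_X_pow_le q.leadingCoeff (q.natDegree - p.natDegree)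
        omega
      have hc : q₁.coeff q.natDegree = 0 := by
        rw [hq₁, coeff_sub, coeff_C_mul, ← mul_assoc, ← Nat.sub_add_cancel hlt, add_comm,
          Nat.add_sub_cancel_left, coeff_mul_X_pow, coeff_mul_C, add_comm, Nat.sub_add_cancel hlt]
        simp only [leadingCoeff]
        ring
      have hlt' : q₁.natDegree < q.natDegree := by
        refine lt_of_le_of_ne hle fun e => ?_
        rw [← e] at hc
        have h0 : q₁ = 0 := leadingCoeff_eq_zero.1 hc
        rw [h0, natDegree_zero] at e
        omega
      obtain ⟨k, s, r, h1, h2⟩ := ih _ hlt' q₁ rfl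
      refine ⟨k + 1, C p.leadingCoeff ^ k * (C q.leadingCoeff * X ^ (q.natDegree - p.natDegree)) + s,
        r, ?_, h2⟩
      have : C p.leadingCoeff * q =
          q₁ + p * (C q.leadingCoeff * X ^ (q.natDegree - p.natDegree)) := by
        rw [hq₁]; ring
      rw [pow_succ, mul_assoc, this, mul_add, h1]
      ring

variable {A : Type*} [CommRing A]

/-- Over every base on which the elements of `G` have constant sign, the polynomials of `F` are
sign-adapted to a separated family of graphs. -/
def SlicedBy (F : Multiset A[X]) (G : Finset A) : Prop :=
  ∀ (C : Type) [TopologicalSpace C] (ev : C → A →+* ℝ), (∀ a, Continuous fun x => ev x a) →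
    (∀ g ∈ G, ∀ x y, SignType.sign (ev x g) = SignType.sign (ev y g)) →
    ∃ Ξ : Finset C(C, ℝ), Separated Ξ ∧ ∀ f ∈ F, SignAdapted Ξ fun x => f.map (ev x)

theorem continuous_eval_map {C : Type} [TopologicalSpace C] {ev : C → A →+* ℝ}
    (hev : ∀ a, Continuous fun x => ev x a) (f : A[X]) :
    Continuous fun p : C × ℝ => (f.map (ev p.1)).eval p.2 := by
  have : (fun p : C × ℝ => (f.map (ev p.1)).eval p.2) =
      fun p : C × ℝ => ∑ i ∈ Finset.range (f.natDegree + 1), ev p.1 (f.coeff i) * p.2 ^ i := by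
    funext p
    rw [eval_map, eval₂_eq_sum_range]
  rw [this]
  exact continuous_finsetSum _ fun i _ =>
    ((hev _).comp continuous_fst).mul (continuous_snd.pow i)

theorem signAdapted_of_natDegree_eq_zero {C : Type} [TopologicalSpace C] {ev : C → A →+* ℝ}
    {f : A[X]} (hf : f.natDegree = 0)
    (h : ∀ x y, SignType.sign (ev x f.leadingCoeff) = SignType.sign (ev y f.leadingCoeff))
    (Ξ : Finset C(C, ℝ)) : SignAdapted Ξ fun x => f.map (ev x) := by
  intro p q _
  rw [eq_C_of_natDegree_eq_zero hf]
  simp only [map_C, eval_C]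
  rw [leadingCoeff, hf] at h
  exact h _ _

/-- On the zeros of `p`, the sign of `q` is governed by a remainder of smaller degree. This supplies
the constant signs on graphs required by `DerivAdapted`. -/
theorem sign_eval_of_pseudo_remainder {φ : A →+* ℝ} {p q s r : A[X]} {k : ℕ}
    (h : C (p.leadingCoeff) ^ k * q = p * s + r) {t : ℝ} (ht : (p.map φ).eval t = 0) :
    SignType.sign (φ p.leadingCoeff) ^ k * SignType.sign ((q.map φ).eval t) =
      SignType.sign ((r.map φ).eval t) := by
  have := congrArg (fun f => (f.map φ).eval t) h
  simp only [Polynomial.map_mul, Polynomial.map_pow, map_C, Polynomial.map_add, eval_mul, eval_pow,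
    eval_C, eval_add, ht, zero_mul, zero_add] at this
  rw [← this, sign_mul, sign_pow]

/-- The reduction step: a polynomial of maximal degree is controlled by its derivative and its
pseudo-remainders. -/
theorem exists_slicedBy_cons {q : A[X]} {F : Multiset A[X]} (hq : 1 ≤ q.natDegree)
    {rem : A[X] → A[X]}
    (hrem : ∀ p : A[X], 1 ≤ p.natDegree → ∃ (k : ℕ) (s : A[X]),
      C (p.leadingCoeff) ^ k * q = p * s + rem p)
    {C' : Type} [TopologicalSpace C'] [Nonempty C'] {ev : C' → A →+* ℝ}
    (hev : ∀ a, Continuous fun x => ev x a)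
    (hsign : ∀ f ∈ derivative q ::ₘ F, ∀ x y,
      SignType.sign (ev x f.leadingCoeff) = SignType.sign (ev y f.leadingCoeff))
    (hne : ∀ f ∈ q ::ₘ F, 1 ≤ f.natDegree → ∀ x, ev x f.leadingCoeff ≠ 0)
    {Ξ : Finset C(C', ℝ)} (hΞ : Separated Ξ)
    (hF : ∀ f ∈ derivative q ::ₘ F, SignAdapted Ξ fun x => f.map (ev x))
    (hR : ∀ p ∈ derivative q ::ₘ F, 1 ≤ p.natDegree → SignAdapted Ξ fun x => (rem p).map (ev x)) :
    ∃ Ξ' : Finset C(C', ℝ), Separated Ξ' ∧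
      ∀ f ∈ q ::ₘ F, SignAdapted Ξ' fun x => f.map (ev x) := by
  have hdeg : ∀ x, (q.map (ev x)).natDegree = q.natDegree := fun x =>
    natDegree_map_of_leadingCoeff_ne_zero _ (hne q (Multiset.mem_cons_self _ _) hq x)
  have hd0 : ∀ x, (derivative q).map (ev x) ≠ 0 := fun x e => by
    rw [← derivative_map] at e
    have := derivative_eq_zero.1 e
    have := hdeg x
    omega
  have hdlc : ∀ x, ev x (derivative q).leadingCoeff ≠ 0 := fun x e => by
    have h1 := natDegree_derivative_le q
    have h2 : ((derivative q).map (ev x)).natDegree = q.natDegree - 1 := by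
      rw [← derivative_map, natDegree_derivative, hdeg]
    have h3 := natDegree_map_le (f := ev x) (p := derivative q)
    have h4 : ((derivative q).map (ev x)).natDegree = (derivative q).natDegree := by omega
    apply hd0 x
    rw [← leadingCoeff_eq_zero, leadingCoeff, h4, coeff_map]
    exact e
  -- The polynomials whose zeros are kept as graphs. Their leading coefficients vanish nowhere, so
  -- they are nonzero over every base point.
  set I : Set A[X] := {f | f = derivative q ∨ (f ∈ F ∧ 1 ≤ f.natDegree)} with hI
  have hImem : ∀ f ∈ I, f ∈ derivative q ::ₘ F := by
    rintro f (rfl | hf)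
    · exact Multiset.mem_cons_self _ _
    · exact Multiset.mem_cons_of_mem hf.1
  have hIlc : ∀ f ∈ I, ∀ x, ev x f.leadingCoeff ≠ 0 := by
    rintro f (rfl | hf) x
    · exact hdlc x
    · exact hne f (Multiset.mem_cons_of_mem hf.1) hf.2 x
  have hI0 : ∀ f ∈ I, ∀ x, f.map (ev x) ≠ 0 := fun f hf x e => hIlc f hf x (by
    have := congrArg (fun g => g.coeff f.natDegree) e
    simpa using this)
  -- Every remaining graph is a zero of some `f` in `I`, and there a pseudo-remainder controls `q`.
  -- Arbitrary graphs of `Ξ` would carry no information on `q`.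
  obtain ⟨Ξ₁, hsub, hroot, hoff, hadapt⟩ := exists_discard I (P := fun f x => f.map (ev x)) hΞ
    (fun f hf => hF f (hImem f hf)) hI0
  have hΞ₁ := hΞ.mono hsub
  have hdq : derivative q ∈ I := Or.inl rfl
  have hD : DerivAdapted Ξ₁ fun x => q.map (ev x) := by
    refine ⟨hΞ₁, fun x => ?_, fun ξ hξ x y => ?_, fun p hp => ?_, ?_⟩
    · rw [← natDegree_pos_iff_degree_pos, hdeg]
      exact hq
    · obtain ⟨f, hf, hf0⟩ := hroot ξ hξ
      have hfdeg : 1 ≤ f.natDegree := by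
        by_contra hlt
        have h0 : f.natDegree = 0 := by omega
        have h1 := hf0 x
        have h2 := hIlc f hf x
        rw [eq_C_of_natDegree_eq_zero h0, map_C, eval_C] at h1
        rw [leadingCoeff, h0] at h2
        exact h2 h1
      obtain ⟨k, s, hks⟩ := hrem f hfdeg
      have h1 := sign_eval_of_pseudo_remainder hks (hf0 x)
      have h2 := sign_eval_of_pseudo_remainder hks (hf0 y)
      have h3 := hR f (hImem f hf) hfdeg _ _ (hΞ.samePosition (hsub hξ) x y)
      simp only at h3
      rw [← h1, ← h2, hsign f (hImem f hf) x y] at h3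
      exact sign_mul_cancel (pow_ne_zero _ (sign_ne_zero.2 (hIlc f hf y))) h3
    · rw [derivative_map]
      exact hoff _ hdq p hp
    · simp only [derivative_map]
      exact hadapt _ hdq
  obtain ⟨Ξ₂, hsub₂, hΞ₂, hq₂⟩ := hD.exists_slices (continuous_eval_map hev q)
  refine ⟨Ξ₂, hΞ₂, fun f hf => ?_⟩
  rcases Multiset.mem_cons.1 hf with rfl | hf
  · exact hq₂
  · by_cases hfd : f.natDegree = 0
    · exact signAdapted_of_natDegree_eq_zero hfd (hsign f (Multiset.mem_cons_of_mem hf)) _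
    · intro p p' hp
      exact hadapt f (Or.inr ⟨hf, by omega⟩) p p' (hp.mono hsub₂)

/-- Induction on the multiset of degrees in the Dershowitz-Manna order, where one polynomial may be
replaced by any number of lower degree. If a leading coefficient vanishes, drop that term. Otherwise
replace a polynomial `q` of maximal degree by its derivative and its pseudo-remainders modulo the
other nonconstant polynomials and the derivative. -/
theorem exists_slicedBy (F : Multiset A[X]) : ∃ G : Finset A, SlicedBy F G := by
  classical
  induction hM : F.map natDegree using
    (Multiset.wellFounded_isDershowitzMannaLT (α := ℕ)).induction generalizing F with
  | _ M ih =>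
    subst hM
    by_cases h0 : ∀ f ∈ F, f.natDegree = 0
    · refine ⟨(F.map leadingCoeff).toFinset, fun C _ ev _ hG => ⟨∅, by simp [Separated], ?_⟩⟩
      intro f hf
      exact signAdapted_of_natDegree_eq_zero (h0 f hf)
        (hG _ (Multiset.mem_toFinset.2 (Multiset.mem_map_of_mem _ hf))) _
    push Not at h0
    obtain ⟨f₀, hf₀, hf₀'⟩ := h0
    obtain ⟨q, hqF, hmax⟩ := F.toFinset.exists_max_image natDegree ⟨f₀, Multiset.mem_toFinset.2 hf₀⟩
    rw [Multiset.mem_toFinset] at hqF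
    have hmax' : ∀ f ∈ F, f.natDegree ≤ q.natDegree := fun f hf => hmax f (Multiset.mem_toFinset.2 hf)
    have hq : 1 ≤ q.natDegree := by
      have := hmax' f₀ hf₀
      omega
    -- vanishing leading coefficients
    have h1 : ∀ f, ∃ G : Finset A, f ∈ F → 1 ≤ f.natDegree → SlicedBy (f.eraseLead ::ₘ F.erase f) G := by
      intro f
      by_cases hf : f ∈ F ∧ 1 ≤ f.natDegree
      · have hlt : Multiset.IsDershowitzMannaLT ((f.eraseLead ::ₘ F.erase f).map natDegree)
            (F.map natDegree) := by
          refine ⟨(F.erase f).map natDegree, {f.eraseLead.natDegree}, {f.natDegree}, by simp, ?_, ?_, ?_⟩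
          · rw [Multiset.map_cons, ← Multiset.singleton_add, add_comm]
          · conv_lhs => rw [← Multiset.cons_erase hf.1]
            rw [Multiset.map_cons, ← Multiset.singleton_add, add_comm]
          · intro y hy
            refine ⟨f.natDegree, Multiset.mem_singleton_self _, ?_⟩
            rw [Multiset.mem_singleton.1 hy]
            have := f.eraseLead_natDegree_le
            omega
        obtain ⟨G, hG⟩ := ih _ hlt _ rfl
        exact ⟨G, fun _ _ => hG⟩
      · exact ⟨∅, fun h1 h2 => absurd ⟨h1, h2⟩ hf⟩
    choose G₁ hG₁ using h1
    -- derivative and pseudo-remainders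
    have h2 : ∀ p : A[X], ∃ r : A[X], 1 ≤ p.natDegree → (∃ (k : ℕ) (s : A[X]),
        C (p.leadingCoeff) ^ k * q = p * s + r) ∧ r.natDegree < p.natDegree := by
      intro p
      by_cases hp : 1 ≤ p.natDegree
      · obtain ⟨k, s, r, h, h'⟩ := exists_pseudo_remainder p q hp
        exact ⟨r, fun _ => ⟨⟨k, s, h⟩, h'⟩⟩
      · exact ⟨0, fun h => absurd h hp⟩
    choose rem hrem using h2
    set F₀ := F.erase q with hF₀
    have hF : F = q ::ₘ F₀ := (Multiset.cons_erase hqF).symm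
    have hF₀F : ∀ f ∈ F₀, f ∈ F := fun f hf => Multiset.mem_of_mem_erase hf
    set D := derivative q ::ₘ F₀ with hD
    have hdq : (derivative q).natDegree < q.natDegree := natDegree_derivative_lt (by omega)
    -- All members of `N` have degree below that of `q`, which they replace.
    set N := derivative q ::ₘ (D.filter fun p => 1 ≤ p.natDegree).map rem with hN
    obtain ⟨G₂, hG₂⟩ := ih ((F₀ + N).map natDegree) (by
      refine ⟨F₀.map natDegree, N.map natDegree, {q.natDegree}, by simp, Multiset.map_add _ _ _, ?_, ?_⟩
      · rw [hF, Multiset.map_cons, ← Multiset.singleton_add, add_comm]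
      · intro y hy
        refine ⟨q.natDegree, Multiset.mem_singleton_self _, ?_⟩
        obtain ⟨f, hf, rfl⟩ := Multiset.mem_map.1 hy
        rcases Multiset.mem_cons.1 hf with rfl | hf
        · exact hdq
        · obtain ⟨p, hp, rfl⟩ := Multiset.mem_map.1 hf
          rw [Multiset.mem_filter] at hp
          refine ((hrem p hp.2).2).trans_le ?_
          rcases Multiset.mem_cons.1 hp.1 with rfl | hp'
          · exact hdq.le
          · exact hmax' p (hF₀F p hp')) _ rfl
    refine ⟨((derivative q ::ₘ F).map leadingCoeff).toFinset ∪ F.toFinset.biUnion G₁ ∪ G₂, ?_⟩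
    intro C' _ ev hev hG
    have hlc : ∀ f ∈ derivative q ::ₘ F, ∀ x y,
        SignType.sign (ev x f.leadingCoeff) = SignType.sign (ev y f.leadingCoeff) := fun f hf =>
      hG _ (Finset.mem_union_left _ (Finset.mem_union_left _
        (Multiset.mem_toFinset.2 (Multiset.mem_map_of_mem _ hf))))
    rcases isEmpty_or_nonempty C' with hC | hC
    · exact ⟨∅, by simp [Separated], fun f _ p => isEmptyElim p.1⟩
    -- Leading coefficients have constant sign on the base, so one that vanishes at a point vanishes
    -- identically. The case distinction is therefore uniform, and `G` serves all cases at once.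
    by_cases hv : ∃ f ∈ F, 1 ≤ f.natDegree ∧ ∃ x, ev x f.leadingCoeff = 0
    · obtain ⟨f, hf, hfd, x, hx⟩ := hv
      have hz : ∀ y, ev y f.leadingCoeff = 0 := fun y => by
        have := hlc f (Multiset.mem_cons_of_mem hf) x y
        rwa [hx, sign_zero, eq_comm, sign_eq_zero_iff] at this
      obtain ⟨Ξ, hΞ, H⟩ := hG₁ f hf hfd C' ev hev fun g hg => hG g (Finset.mem_union_left _
        (Finset.mem_union_right _ (Finset.mem_biUnion.2 ⟨f, Multiset.mem_toFinset.2 hf, hg⟩)))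
      refine ⟨Ξ, hΞ, fun f' hf' => ?_⟩
      rw [← Multiset.cons_erase hf] at hf'
      rcases Multiset.mem_cons.1 hf' with rfl | hf'
      · have e : ∀ x, f'.map (ev x) = f'.eraseLead.map (ev x) := fun x => by
          conv_lhs => rw [← f'.eraseLead_add_monomial_natDegree_leadingCoeff]
          rw [Polynomial.map_add, map_monomial, hz x, monomial_zero_right, add_zero]
        simp only [e]
        exact H _ (Multiset.mem_cons_self _ _)
      · exact H _ (Multiset.mem_cons_of_mem hf')
    · push Not at hv
      obtain ⟨Ξ, hΞ, H⟩ := hG₂ C' ev hev fun g hg => hG g (Finset.mem_union_right _ hg)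
      have HD : ∀ f ∈ D, SignAdapted Ξ fun x => f.map (ev x) := by
        intro f hf
        rcases Multiset.mem_cons.1 hf with rfl | hf
        · exact H _ (Multiset.mem_add.2 (Or.inr (Multiset.mem_cons_self _ _)))
        · exact H _ (Multiset.mem_add.2 (Or.inl hf))
      rw [hF]
      refine exists_slicedBy_cons hq (fun p hp => (hrem p hp).1) hev
        (fun f hf => hlc f ?_) (fun f hf => hv f (hF ▸ hf)) hΞ HD fun p hp hpd => ?_
      · rcases Multiset.mem_cons.1 hf with rfl | hf
        · exact Multiset.mem_cons_self _ _
        · exact Multiset.mem_cons_of_mem (hF₀F f hf)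
      · exact H _ (Multiset.mem_add.2 (Or.inr (Multiset.mem_cons_of_mem
          (Multiset.mem_map_of_mem _ (Multiset.mem_filter.2 ⟨hp, hpd⟩)))))

end Slicing

/-! ### Locally closed semialgebraic sets are tame -/

theorem isLocallyClosed_sign_eq {X : Type*} [TopologicalSpace X] {h : X → ℝ} (hh : Continuous h)
    (τ : SignType) : IsLocallyClosed {x | SignType.sign (h x) = τ} := by
  rcases τ with _ | _ | _
  · have : {x | SignType.sign (h x) = SignType.zero} = {x | h x = 0} := by
      ext x; exact sign_eq_zero_iff
    rw [this]
    exact (isClosed_eq hh continuous_const).isLocallyClosed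
  · have : {x | SignType.sign (h x) = SignType.neg} = {x | h x < 0} := by
      ext x; exact sign_eq_neg_one_iff
    rw [this]
    exact (isOpen_lt hh continuous_const).isLocallyClosed
  · have : {x | SignType.sign (h x) = SignType.pos} = {x | 0 < h x} := by
      ext x; exact sign_eq_one_iff
    rw [this]
    exact (isOpen_lt continuous_const hh).isLocallyClosed

theorem isLocallyClosed_signs {X ι : Type*} [TopologicalSpace X] {h : ι → X → ℝ} (s : Finset ι)
    (hh : ∀ i ∈ s, Continuous (h i)) (σ : ι → SignType) :
    IsLocallyClosed {x | ∀ i ∈ s, SignType.sign (h i x) = σ i} := by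
  classical
  induction s using Finset.induction_on with
  | empty => simpa using isOpen_univ.isLocallyClosed
  | insert i s _ ih =>
    have e : {x | ∀ j ∈ insert i s, SignType.sign (h j x) = σ j} =
        {x | SignType.sign (h i x) = σ i} ∩ {x | ∀ j ∈ s, SignType.sign (h j x) = σ j} := by
      ext x
      simp
    rw [e]
    exact (isLocallyClosed_sign_eq (hh i (Finset.mem_insert_self i s)) _).inter
      (ih fun j hj => hh j (Finset.mem_insert_of_mem hj))

/-- Cylindrical decomposition, by induction on the number of variables: the first variable is sliced
over sign cells in the remaining ones. Only locally closed sets are admitted, since the pieces must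
be locally compact. -/
theorem tame_of_mvPolynomial (N : ℕ) (G : Finset (MvPolynomial (Fin N) ℝ)) {S : Set (Fin N → ℝ)}
    (hS : IsLocallyClosed S)
    (h : ∀ x y, (∀ g ∈ G, SignType.sign (MvPolynomial.eval x g) =
      SignType.sign (MvPolynomial.eval y g)) → x ∈ S → y ∈ S) : Tame S := by
  classical
  induction N with
  | zero =>
    rcases S.eq_empty_or_nonempty with rfl | ⟨x, hx⟩
    · exact tame_of_isEmpty
    · let _ : Unique S := ⟨⟨⟨x, hx⟩⟩, fun y => Subtype.ext (Subsingleton.elim _ _)⟩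
      exact tame_of_unique
  | succ N ih =>
    obtain ⟨G', hG'⟩ := exists_slicedBy
      (G.val.map (MvPolynomial.finSuccEquiv ℝ N) : Multiset (Polynomial (MvPolynomial (Fin N) ℝ)))
    refine tame_of_signs G' (h := fun g x => MvPolynomial.eval (fun i : Fin N => x i.succ) g)
      (fun g _ => (MvPolynomial.continuous_eval g).comp (by fun_prop)) hS fun σ => ?_
    set C : Set (Fin N → ℝ) := {x | ∀ g ∈ G', SignType.sign (MvPolynomial.eval x g) = σ g} with hC
    have hCl : IsLocallyClosed C :=
      isLocallyClosed_signs G' (fun g _ => MvPolynomial.continuous_eval g) σ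
    have hCt : Tame C := ih G' hCl fun x y hxy hx g hg => (hxy g hg).symm.trans (hx g hg)
    obtain ⟨Ξ, hΞ, H⟩ := hG' C (fun x => MvPolynomial.eval x.1)
      (fun a => (MvPolynomial.continuous_eval a).comp continuous_subtype_val)
      (fun g hg x y => (x.2 g hg).trans (y.2 g hg).symm)
    set T : Set (C × ℝ) := {p | (Fin.cons p.2 p.1.1 : Fin (N + 1) → ℝ) ∈ S} with hT
    have hcons : Continuous fun p : C × ℝ => (Fin.cons p.2 p.1.1 : Fin (N + 1) → ℝ) := by
      refine continuous_pi fun i => ?_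
      refine Fin.cases ?_ (fun j => ?_) i
      · simpa using continuous_snd
      · exact (continuous_apply j).comp (continuous_subtype_val.comp continuous_fst)
    -- The base cell is tame by induction, and membership in `S` depends only on the position
    -- relative to the graphs.
    have hTt : Tame T := by
      refine hCt.of_slices hΞ (hS.preimage hcons) fun p q hpq hp => h _ _ (fun g hg => ?_) hp
      rw [MvPolynomial.eval_eq_eval_mv_eval', MvPolynomial.eval_eq_eval_mv_eval']
      exact H _ (Multiset.mem_map_of_mem _ hg) p q hpq
    set U := S ∩ {x | ∀ g ∈ G', SignType.sign (MvPolynomial.eval (fun i : Fin N => x i.succ) g) = σ g}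
      with hU
    have hto : ∀ p : T, (Fin.cons p.1.2 p.1.1.1 : Fin (N + 1) → ℝ) ∈ U := fun p =>
      ⟨p.2, fun g hg => by simpa using p.1.1.2 g hg⟩
    have hinv : ∀ x : U, ((⟨fun i => x.1 i.succ, x.2.2⟩, x.1 0) : C × ℝ) ∈ T := fun x => by
      have := x.2.1
      rw [← Fin.cons_self_tail x.1] at this
      exact this
    exact hTt.congr
      { toFun := fun p => ⟨_, hto p⟩
        invFun := fun x => ⟨_, hinv x⟩
        left_inv := fun p => rfl
        right_inv := fun x => Subtype.ext (Fin.cons_self_tail x.1)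
        continuous_toFun := (hcons.comp continuous_subtype_val).subtype_mk _
        continuous_invFun := Continuous.subtype_mk (Continuous.prodMk (Continuous.subtype_mk
          (continuous_pi fun i => (continuous_apply i.succ).comp continuous_subtype_val) _)
          ((continuous_apply 0).comp continuous_subtype_val)) _ }

/-! ### Coordinate-free polynomial functions and tameness in finite-dimensional spaces. -/

section PolynomialFunctions

variable (V : Type) [AddCommGroup V] [Module ℝ V]

/-- Polynomial functions on a real vector space. -/
def polyFun : Subalgebra ℝ (V → ℝ) :=
  Algebra.adjoin ℝ (Set.range fun φ : V →ₗ[ℝ] ℝ => (φ : V → ℝ))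

variable {V}

theorem linearMap_mem_polyFun (φ : V →ₗ[ℝ] ℝ) : (φ : V → ℝ) ∈ polyFun V :=
  Algebra.subset_adjoin ⟨φ, rfl⟩

theorem comp_mem_polyFun {W : Type} [AddCommGroup W] [Module ℝ W] (e : W →ₗ[ℝ] V) {h : V → ℝ}
    (hh : h ∈ polyFun V) : h ∘ e ∈ polyFun W := by
  induction hh using Algebra.adjoin_induction with
  | mem x hx =>
    obtain ⟨φ, rfl⟩ := hx
    exact linearMap_mem_polyFun (φ.comp e)
  | algebraMap r => exact (polyFun W).algebraMap_mem r
  | add x y _ _ hx hy => exact (polyFun W).add_mem hx hy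
  | mul x y _ _ hx hy => exact (polyFun W).mul_mem hx hy

theorem exists_mvPolynomial_eval_eq {N : ℕ} {h : (Fin N → ℝ) → ℝ} (hh : h ∈ polyFun (Fin N → ℝ)) :
    ∃ g : MvPolynomial (Fin N) ℝ, ∀ x, MvPolynomial.eval x g = h x := by
  induction hh using Algebra.adjoin_induction with
  | mem x hx =>
    obtain ⟨φ, rfl⟩ := hx
    refine ⟨∑ i, MvPolynomial.C (φ (Pi.single i 1)) * MvPolynomial.X i, fun x => ?_⟩
    change _ = φ x
    rw [LinearMap.pi_apply_eq_sum_univ φ x, map_sum]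
    refine Finset.sum_congr rfl fun i _ => ?_
    have : (fun j => if i = j then (1 : ℝ) else 0) = Pi.single i 1 := by
      funext j
      simp [Pi.single_apply, eq_comm]
    rw [this]
    simp [mul_comm]
  | algebraMap r => exact ⟨MvPolynomial.C r, fun x => by simp⟩
  | add x y _ _ hx hy =>
    obtain ⟨p, hp⟩ := hx
    obtain ⟨q, hq⟩ := hy
    exact ⟨p + q, fun x => by simp [hp, hq]⟩
  | mul x y _ _ hx hy =>
    obtain ⟨p, hp⟩ := hx
    obtain ⟨q, hq⟩ := hy
    exact ⟨p * q, fun x => by simp [hp, hq]⟩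

variable [TopologicalSpace V] [IsTopologicalAddGroup V] [ContinuousSMul ℝ V] [T2Space V]
  [FiniteDimensional ℝ V]

theorem continuous_of_mem_polyFun {h : V → ℝ} (hh : h ∈ polyFun V) : Continuous h := by
  induction hh using Algebra.adjoin_induction with
  | mem x hx =>
    obtain ⟨φ, rfl⟩ := hx
    exact φ.continuous_of_finiteDimensional
  | algebraMap r => exact continuous_const
  | add x y _ _ hx hy => exact hx.add hy
  | mul x y _ _ hx hy => exact hx.mul hy

theorem tame_of_polyFun (G : Finset (V → ℝ)) (hG : ∀ g ∈ G, g ∈ polyFun V) {S : Set V}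
    (hS : IsLocallyClosed S)
    (h : ∀ x y, (∀ g ∈ G, SignType.sign (g x) = SignType.sign (g y)) → x ∈ S → y ∈ S) :
    Tame S := by
  classical
  have e : V ≃L[ℝ] (Fin (Module.finrank ℝ V) → ℝ) :=
    ContinuousLinearEquiv.ofFinrankEq (by simp)
  have H : ∀ g : V → ℝ, ∃ p : MvPolynomial (Fin (Module.finrank ℝ V)) ℝ,
      g ∈ G → ∀ x, MvPolynomial.eval x p = g (e.symm x) := by
    intro g
    by_cases hg : g ∈ G
    · obtain ⟨p, hp⟩ := exists_mvPolynomial_eval_eq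
        (comp_mem_polyFun (e.symm : (Fin (Module.finrank ℝ V) → ℝ) →ₗ[ℝ] V) (hG g hg))
      exact ⟨p, fun _ => hp⟩
    · exact ⟨0, fun h => absurd h hg⟩
  choose p hp using H
  have ht : Tame (e.symm ⁻¹' S : Set (Fin (Module.finrank ℝ V) → ℝ)) := by
    refine tame_of_mvPolynomial _ (G.image p) (hS.preimage e.symm.continuous)
      fun x y hxy hx => h _ _ (fun g hg => ?_) hx
    rw [← hp g hg, ← hp g hg]
    exact hxy _ (Finset.mem_image_of_mem _ hg)
  exact ht.congr (e.symm.toHomeomorph.sets rfl)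

end PolynomialFunctions

/-! ### Taylor polynomials and leading terms -/

section Taylor

open Polynomial Asymptotics

/-- Compare limits at `0`, then divide by `t`. The punctured neighbourhood makes the division
legitimate and is preserved by the induction. -/
theorem coeff_eq_of_eval_eq {P : ℝ[X]} {m : ℕ} {w : ℝ → ℝ} (hw : ContinuousAt w 0)
    (h : ∀ᶠ t in 𝓝[≠] (0 : ℝ), P.eval t = t ^ m * w t) :
    (∀ j < m, P.coeff j = 0) ∧ P.coeff m = w 0 := by
  have hlim : P.coeff 0 = 0 ^ m * w 0 := by
    have h1 : Tendsto (fun t => P.eval t) (𝓝[≠] (0 : ℝ)) (𝓝 (P.eval 0)) :=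
      P.continuous.continuousAt.tendsto.mono_left nhdsWithin_le_nhds
    have h2 : Tendsto (fun t => t ^ m * w t) (𝓝[≠] (0 : ℝ)) (𝓝 (0 ^ m * w 0)) :=
      (((continuous_pow m).continuousAt).mul hw).tendsto.mono_left nhdsWithin_le_nhds
    rw [coeff_zero_eq_eval_zero]
    exact tendsto_nhds_unique (h1.congr' h) h2
  induction m generalizing P with
  | zero => exact ⟨fun j hj => absurd hj (Nat.not_lt_zero j), by simpa using hlim⟩
  | succ m ih =>
    have h0 : P.coeff 0 = 0 := by simpa using hlim
    have h' : ∀ᶠ t in 𝓝[≠] (0 : ℝ), P.divX.eval t = t ^ m * w t := by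
      filter_upwards [h, self_mem_nhdsWithin] with t ht ht0
      have e := P.divX_mul_X_add
      rw [h0, C_0, add_zero] at e
      rw [← e, eval_mul, eval_X, pow_succ] at ht
      refine mul_right_cancel₀ (ht0 : t ≠ 0) (ht.trans ?_)
      ring
    have hlim' : P.divX.coeff 0 = 0 ^ m * w 0 := by
      have h1 : Tendsto (fun t => P.divX.eval t) (𝓝[≠] (0 : ℝ)) (𝓝 (P.divX.eval 0)) :=
        P.divX.continuous.continuousAt.tendsto.mono_left nhdsWithin_le_nhds
      have h2 : Tendsto (fun t => t ^ m * w t) (𝓝[≠] (0 : ℝ)) (𝓝 (0 ^ m * w 0)) :=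
        (((continuous_pow m).continuousAt).mul hw).tendsto.mono_left nhdsWithin_le_nhds
      rw [coeff_zero_eq_eval_zero]
      exact tendsto_nhds_unique (h1.congr' h') h2
    obtain ⟨h1, h2⟩ := ih h' hlim'
    refine ⟨fun j hj => ?_, by rw [← h2, coeff_divX]⟩
    rcases j with _ | j
    · exact h0
    · rw [← coeff_divX]
      exact h1 j (by omega)

/-- One factor `t` is split off at a time: as long as the bound leaves a spare power, the analytic
quotient vanishes at `0`. -/
theorem exists_eq_pow_mul_of_isBigO {r : ℝ → ℝ} (hr : AnalyticAt ℝ r 0) {N : ℕ}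
    (h : r =O[𝓝 0] fun t : ℝ => t ^ N) :
    ∃ v : ℝ → ℝ, AnalyticAt ℝ v 0 ∧ ∀ᶠ t in 𝓝 (0 : ℝ), r t = t ^ N * v t := by
  induction N with
  | zero => exact ⟨r, hr, by simp⟩
  | succ N ih =>
    obtain ⟨v, hv, hrv⟩ := ih (h.trans (isBigO_iff.2 ⟨1, by
      filter_upwards [Metric.closedBall_mem_nhds (0 : ℝ) one_pos] with t ht
      rw [mem_closedBall_zero_iff] at ht
      rw [pow_succ, norm_mul, one_mul]
      exact mul_le_of_le_one_right (norm_nonneg _) ht⟩))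
    have hv0 : v 0 = 0 := by
      obtain ⟨c, hc⟩ := isBigO_iff.1 h
      have h1 : ∀ᶠ t in 𝓝[≠] (0 : ℝ), ‖v t‖ ≤ c * ‖t‖ := by
        filter_upwards [nhdsWithin_le_nhds hc, nhdsWithin_le_nhds hrv, self_mem_nhdsWithin]
          with t h1 h2 h3
        rw [h2, norm_mul, pow_succ, norm_mul, mul_left_comm] at h1
        exact le_of_mul_le_mul_left h1 (norm_pos_iff.2 (pow_ne_zero _ h3))
      have h2 : Tendsto (fun t => ‖v t‖) (𝓝[≠] (0 : ℝ)) (𝓝 ‖v 0‖) :=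
        hv.continuousAt.norm.tendsto.mono_left nhdsWithin_le_nhds
      have h3 : Tendsto (fun t : ℝ => c * ‖t‖) (𝓝[≠] (0 : ℝ)) (𝓝 (c * ‖(0 : ℝ)‖)) :=
        (Continuous.tendsto (by fun_prop) _).mono_left nhdsWithin_le_nhds
      have := le_of_tendsto_of_tendsto h2 h3 h1
      simpa using this
    obtain ⟨u, hu, huv⟩ := (natCast_le_analyticOrderAt hv (n := 1)).1 (by
      rw [Nat.cast_one, Order.one_le_iff_ne_zero]
      exact analyticOrderAt_ne_zero.2 ⟨hv, hv0⟩)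
    refine ⟨u, hu, ?_⟩
    filter_upwards [hrv, huv] with t h1 h2
    rw [h1, h2, sub_zero, pow_one, smul_eq_mul, pow_succ, mul_assoc]

/-- An error of order `n + 1` cannot affect coefficients of index `m ≤ n`. A condition on germs
becomes finitely many conditions on polynomial coefficients. -/
theorem hasLeadingTerm_iff {h : ℝ → ℝ} (hh : AnalyticAt ℝ h 0) {P : ℝ[X]} {n m : ℕ} (hm : m ≤ n)
    (hP : (fun t => h t - P.eval t) =O[𝓝 0] fun t : ℝ => t ^ (n + 1)) {c : ℝ} :
    HasLeadingTerm h m c ↔ (∀ j < m, P.coeff j = 0) ∧ P.coeff m = c := by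
  have hPa : AnalyticAt ℝ (fun t => P.eval t) 0 := by
    simpa [aeval_def] using AnalyticAt.aeval_polynomial (analyticAt_id (𝕜 := ℝ) (z := (0 : ℝ))) P
  obtain ⟨v, hv, hPv⟩ := exists_eq_pow_mul_of_isBigO (hh.sub hPa) hP
  have hpow : ∀ t : ℝ, t ^ (n + 1) = t ^ m * t ^ (n + 1 - m) := fun t => by
    rw [← pow_add]
    congr 1
    omega
  have h0 : (0 : ℝ) ^ (n + 1 - m) = 0 := zero_pow (by omega)
  constructor
  · rintro ⟨u, hu, rfl, hut⟩
    have := coeff_eq_of_eval_eq (P := P) (m := m) (w := fun t => u t - t ^ (n + 1 - m) * v t)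
      (hu.continuousAt.sub ((continuous_pow _).continuousAt.mul hv.continuousAt)) (by
        filter_upwards [nhdsWithin_le_nhds hut, nhdsWithin_le_nhds hPv] with t h1 h2
        have h2' : h t - P.eval t = t ^ (n + 1) * v t := h2
        rw [hpow t, h1] at h2'
        linear_combination -h2')
    simpa [h0] using this
  · rintro ⟨h1, rfl⟩
    obtain ⟨q, rfl⟩ := X_pow_dvd_iff.2 h1
    have hqa : AnalyticAt ℝ (fun t => q.eval t) 0 := by
      simpa [aeval_def] using AnalyticAt.aeval_polynomial (analyticAt_id (𝕜 := ℝ) (z := (0 : ℝ))) q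
    refine ⟨fun t => q.eval t + t ^ (n + 1 - m) * v t, ?_, ?_, ?_⟩
    · exact hqa.add ((analyticAt_id.pow _).mul hv)
    · simp only [h0, zero_mul, add_zero]
      rw [coeff_X_pow_mul', if_pos le_rfl, Nat.sub_self, coeff_zero_eq_eval_zero]
    · filter_upwards [hPv] with t h2
      have h2' : h t - (X ^ m * q).eval t = t ^ (n + 1) * v t := h2
      rw [hpow t, eval_mul, eval_pow, eval_X] at h2'
      linear_combination h2'

/-- Expanding the multilinear terms of the power series on the standard basis turns its partial sum
into a polynomial. -/
theorem exists_mvPolynomial_isBigO {d : ℕ} {f : (Fin d → ℝ) → ℝ} (hf : AnalyticAt ℝ f 0) (n : ℕ) :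
    ∃ F : MvPolynomial (Fin d) ℝ,
      (fun y => f y - MvPolynomial.eval y F) =O[𝓝 0] fun y => ‖y‖ ^ (n + 1) := by
  classical
  obtain ⟨p, hp⟩ := hf
  have H := hp.isBigO_sub_partialSum_pow (n + 1)
  refine ⟨∑ k ∈ Finset.range (n + 1), ∑ r : Fin k → Fin d,
    MvPolynomial.C (p k fun i => Pi.single (r i) 1) * ∏ i, MvPolynomial.X (r i), ?_⟩
  refine H.congr_left fun y => ?_
  rw [zero_add]
  congr 1
  rw [FormalMultilinearSeries.partialSum, map_sum]
  refine Finset.sum_congr rfl fun k _ => ?_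
  have hy : y = ∑ l, y l • (Pi.single l 1 : Fin d → ℝ) := by
    conv_lhs => rw [← Finset.univ_sum_single y]
    exact Finset.sum_congr rfl fun l _ => by rw [← Pi.single_smul, smul_eq_mul, mul_one]
  conv_lhs => rw [hy]
  rw [ContinuousMultilinearMap.map_sum, map_sum]
  refine Finset.sum_congr rfl fun r _ => ?_
  rw [ContinuousMultilinearMap.map_smul_univ, map_mul, MvPolynomial.eval_C, map_prod]
  simp [mul_comm]

end Taylor

/-! ### The coefficients of `F(γ(t))` as polynomial functions of the truncated arc. -/

section Jets

open Polynomial Asymptotics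

variable {d k : ℕ}

/-- The components of a truncated arc as polynomials. -/
noncomputable def arcPoly (a : TruncArc k d) (l : Fin d) : ℝ[X] :=
  ∑ r : Fin k, C (a r l) * X ^ ((r : ℕ) + 1)

theorem eval_arcPoly (a : TruncArc k d) (t : ℝ) (l : Fin d) : (arcPoly a l).eval t = arc a t l := by
  simp only [arcPoly, arc, eval_finsetSum, eval_mul, eval_C, eval_pow, eval_X, Finset.sum_apply,
    Pi.smul_apply, smul_eq_mul]
  exact Finset.sum_congr rfl fun r _ => mul_comm _ _

/-- The polynomial `F(γ(t))`. -/
noncomputable def jet (F : MvPolynomial (Fin d) ℝ) (a : TruncArc k d) : ℝ[X] :=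
  MvPolynomial.aeval (arcPoly a) F

theorem eval_jet (F : MvPolynomial (Fin d) ℝ) (a : TruncArc k d) (t : ℝ) :
    (jet F a).eval t = MvPolynomial.eval (arc a t) F := by
  have h : (Polynomial.evalRingHom t).comp (MvPolynomial.aeval (arcPoly a)).toRingHom =
      MvPolynomial.eval (arc a t) := by
    refine MvPolynomial.ringHom_ext (fun r => ?_) fun l => ?_
    · simp
    · simp [eval_arcPoly]
  exact congrArg (fun φ => φ F) h

theorem arc_zero (a : TruncArc k d) : arc a 0 = 0 := by simp [arc]

theorem analyticAt_arc (a : TruncArc k d) : AnalyticAt ℝ (arc a) 0 := by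
  unfold arc
  exact Finset.analyticAt_fun_sum _ fun r _ => (analyticAt_id.pow _).smul analyticAt_const

theorem isBigO_jet {f : (Fin d → ℝ) → ℝ} {F : MvPolynomial (Fin d) ℝ} {n : ℕ}
    (h : (fun y => f y - MvPolynomial.eval y F) =O[𝓝 0] fun y => ‖y‖ ^ (n + 1)) (a : TruncArc k d) :
    (fun t => f (arc a t) - (jet F a).eval t) =O[𝓝 0] fun t : ℝ => t ^ (n + 1) := by
  simp only [eval_jet]
  have ht : Tendsto (arc a) (𝓝 0) (𝓝 0) := by
    have := (analyticAt_arc a).continuousAt.tendsto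
    rwa [arc_zero] at this
  refine (h.comp_tendsto ht).trans ?_
  have h1 : (arc a) =O[𝓝 0] fun t : ℝ => t := by
    have := (analyticAt_arc a).differentiableAt.isBigO_sub
    simpa [arc_zero] using this
  exact (h1.norm_left.pow (n + 1))

theorem analyticAt_comp_arc {f : (Fin d → ℝ) → ℝ} (hf : AnalyticAt ℝ f 0) (a : TruncArc k d) :
    AnalyticAt ℝ (fun t => f (arc a t)) 0 :=
  AnalyticAt.comp (g := f) (by rwa [arc_zero]) (analyticAt_arc a)

theorem jet_coeff_zero {F : MvPolynomial (Fin d) ℝ} (hF : MvPolynomial.eval 0 F = 0)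
    (a : TruncArc k d) : (jet F a).coeff 0 = 0 := by
  rw [coeff_zero_eq_eval_zero, eval_jet, arc_zero, hF]

theorem eval_zero_of_isBigO {f : (Fin d → ℝ) → ℝ} (hf0 : f 0 = 0) {F : MvPolynomial (Fin d) ℝ} {n : ℕ}
    (h : (fun y => f y - MvPolynomial.eval y F) =O[𝓝 0] fun y => ‖y‖ ^ (n + 1)) :
    MvPolynomial.eval 0 F = 0 := by
  obtain ⟨c, hc⟩ := isBigO_iff.1 h
  have := hc.self_of_nhds
  simpa [hf0] using this

theorem jet_coeff_mem_polyFun (F : MvPolynomial (Fin d) ℝ) (j : ℕ) :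
    (fun a : TruncArc k d => (jet F a).coeff j) ∈ polyFun (TruncArc k d) := by
  induction F using MvPolynomial.induction_on generalizing j with
  | C r =>
    simp only [jet, MvPolynomial.algHom_C, ← C_eq_algebraMap, coeff_C]
    exact (polyFun (TruncArc k d)).algebraMap_mem (if j = 0 then r else 0)
  | add p q hp hq =>
    simp only [jet, map_add, coeff_add]
    exact (polyFun (TruncArc k d)).add_mem (hp j) (hq j)
  | mul_X p l hp =>
    have hl : ∀ i, (fun a : TruncArc k d => (arcPoly a l).coeff i) ∈ polyFun (TruncArc k d) := by
      intro i
      simp only [arcPoly, finsetSum_coeff, coeff_C_mul]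
      have : (fun a : TruncArc k d => ∑ r : Fin k, a r l * (X ^ ((r : ℕ) + 1) : ℝ[X]).coeff i) =
          ∑ r : Fin k, (X ^ ((r : ℕ) + 1) : ℝ[X]).coeff i •
            (fun a : TruncArc k d => a r l) := by
        funext a
        rw [Finset.sum_apply]
        exact Finset.sum_congr rfl fun r _ => mul_comm _ _
      rw [this]
      refine Subalgebra.sum_mem _ fun r _ => Subalgebra.smul_mem _ ?_ _
      exact linearMap_mem_polyFun ((LinearMap.proj l).comp (LinearMap.proj r :
        TruncArc k d →ₗ[ℝ] (Fin d → ℝ)))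
    have e : (fun a : TruncArc k d => (jet (p * MvPolynomial.X l) a).coeff j) =
        ∑ x ∈ Finset.HasAntidiagonal.antidiagonal j, (fun a : TruncArc k d => (jet p a).coeff x.1) *
          fun a : TruncArc k d => (arcPoly a l).coeff x.2 := by
      funext a
      simp [jet, coeff_mul, Finset.sum_apply]
    rw [e]
    exact Subalgebra.sum_mem _ fun x _ => Subalgebra.mul_mem _ (hp _) (hl _)

/-- Congruence modulo a power of `t` passes through `F`, so low coefficients of `F(γ(t))` see only
low terms of `γ`. -/
theorem aeval_sub_dvd (F : MvPolynomial (Fin d) ℝ) {u v : Fin d → ℝ[X]} {N : ℕ}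
    (h : ∀ l, X ^ N ∣ u l - v l) :
    X ^ N ∣ MvPolynomial.aeval u F - MvPolynomial.aeval v F := by
  induction F using MvPolynomial.induction_on with
  | C r => simp
  | add p q hp hq =>
    simp only [map_add, add_sub_add_comm]
    exact dvd_add hp hq
  | mul_X p l hp =>
    simp only [map_mul, MvPolynomial.aeval_X]
    have : MvPolynomial.aeval u p * u l - MvPolynomial.aeval v p * v l =
        (MvPolynomial.aeval u p - MvPolynomial.aeval v p) * u l +
          MvPolynomial.aeval v p * (u l - v l) := by ring
    rw [this]
    exact dvd_add (hp.mul_right _) ((h l).mul_left _)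

theorem coeff_eq_of_dvd_sub {p q : ℝ[X]} {N : ℕ} (h : X ^ N ∣ p - q) {j : ℕ} (hj : j < N) :
    p.coeff j = q.coeff j := by
  have := X_pow_dvd_iff.1 h j hj
  rwa [coeff_sub, sub_eq_zero] at this

end Jets

/-! ### Reparametrization of arcs -/

section Substitution

open Polynomial

theorem coeff_comp_of_lower {p φ : ℝ[X]} (hφ : φ.coeff 0 = 0) {j : ℕ} (h : ∀ i < j, p.coeff i = 0) :
    (p.comp φ).coeff j = φ.coeff 1 ^ j * p.coeff j := by
  obtain ⟨q, rfl⟩ := X_pow_dvd_iff.2 h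
  obtain ⟨ψ, rfl⟩ := X_dvd_iff.2 hφ
  have e1 : (X * ψ).coeff 1 = ψ.coeff 0 := coeff_X_mul ψ 0
  have e2 : (X ^ j * q).coeff j = q.coeff 0 := by simpa using coeff_X_pow_mul q j 0
  have e3 : (X ^ j * q).comp (X * ψ) = X ^ j * (ψ ^ j * q.comp (X * ψ)) := by
    rw [mul_comp, pow_comp, X_comp, mul_pow, mul_assoc]
  have e4 : (X ^ j * (ψ ^ j * q.comp (X * ψ))).coeff j = (ψ ^ j * q.comp (X * ψ)).coeff 0 := by
    simpa using coeff_X_pow_mul (ψ ^ j * q.comp (X * ψ)) j 0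
  rw [e1, e2, e3, e4]
  simp [coeff_zero_eq_eval_zero, eval_comp]

theorem coeff_comp_eq_zero_iff {p φ : ℝ[X]} (hφ : φ.coeff 0 = 0) (hφ1 : φ.coeff 1 ≠ 0) {i : ℕ} :
    (∀ j < i, (p.comp φ).coeff j = 0) ↔ ∀ j < i, p.coeff j = 0 := by
  induction i with
  | zero => simp
  | succ i ih =>
    rw [Nat.forall_lt_succ_right, Nat.forall_lt_succ_right, ih]
    refine and_congr_right fun h => ?_
    rw [coeff_comp_of_lower hφ h]
    simp [hφ1]

theorem sq_dvd_one_add_pow_sub (u : ℝ[X]) (i : ℕ) : u ^ 2 ∣ (1 + u) ^ i - (1 + (i : ℝ[X]) * u) := by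
  induction i with
  | zero => simp
  | succ i ih =>
    have : (1 + u) ^ (i + 1) - (1 + ((i + 1 : ℕ) : ℝ[X]) * u) =
        ((1 + u) ^ i - (1 + (i : ℝ[X]) * u)) * (1 + u) + u ^ 2 * (i : ℝ[X]) := by
      push_cast
      ring
    rw [this]
    exact dvd_add (ih.mul_right _) (dvd_mul_right _ _)

theorem dvd_comp_sub (p φ : ℝ[X]) : φ - X ∣ p.comp φ - p := by
  have := sub_dvd_eval_sub φ X (p.map C)
  rw [eval_map, eval_map] at this
  change φ - X ∣ p.comp φ - p.comp X at this
  rwa [comp_X] at this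

/-- For `p = t^i q`, the substitution multiplies `t^i` by `(1 + s t^m)^i`, which is `1 + i s t^m`
modulo `t^(m+1)`, and it alters `q` only from order `m + 1` on. The first coefficient to change has
index `i + m`, and it moves linearly in `s`. -/
theorem coeff_comp_X_add {p : ℝ[X]} {i m : ℕ} (hm : 1 ≤ m) (h : ∀ j < i, p.coeff j = 0) (s : ℝ)
    {j : ℕ} (hj : j ≤ i + m) :
    (p.comp (X + C s * X ^ (m + 1))).coeff j =
      p.coeff j + if j = i + m then s * i * p.coeff i else 0 := by
  obtain ⟨q, rfl⟩ := X_pow_dvd_iff.2 h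
  set φ : ℝ[X] := X + C s * X ^ (m + 1) with hφ
  set u : ℝ[X] := C s * X ^ m with hu
  have hφu : φ = X * (1 + u) := by
    rw [hφ, hu]
    ring
  have h1 : X ^ (m + 1) ∣ (1 + u) ^ i - (1 + (i : ℝ[X]) * u) := by
    refine dvd_trans ?_ (sq_dvd_one_add_pow_sub u i)
    rw [hu, mul_pow, ← pow_mul]
    exact (pow_dvd_pow X (by omega)).mul_left _
  have h2 : X ^ (m + 1) ∣ q.comp φ - q := by
    refine dvd_trans ?_ (dvd_comp_sub q φ)
    rw [hφ, add_sub_cancel_left]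
    exact dvd_mul_left _ _
  have h3 : X ^ (m + 1) ∣ u * q - C (s * q.coeff 0) * X ^ m := by
    have e : q = C (q.coeff 0) + X * q.divX := by
      conv_lhs => rw [← q.divX_mul_X_add]
      ring
    refine ⟨C s * q.divX, ?_⟩
    conv_lhs => rw [e]
    rw [hu]
    simp only [C_mul, coeff_add, coeff_C_zero, mul_coeff_zero, coeff_X_zero, zero_mul, add_zero]
    ring
  have e : (X ^ i * q).comp φ - (X ^ i * q + C (s * i * q.coeff 0) * X ^ (i + m)) =
      X ^ i * (((1 + u) ^ i - (1 + (i : ℝ[X]) * u)) * q.comp φ +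
        (1 + (i : ℝ[X]) * u) * (q.comp φ - q) +
        (i : ℝ[X]) * (u * q - C (s * q.coeff 0) * X ^ m)) := by
    rw [mul_comp, pow_comp, X_comp, hφu, C_mul, C_mul, C_mul, mul_pow, pow_add, C_eq_natCast]
    ring
  have hd : X ^ (i + m + 1) ∣
      (X ^ i * q).comp φ - (X ^ i * q + C (s * i * q.coeff 0) * X ^ (i + m)) := by
    rw [e, add_assoc, pow_add]
    exact mul_dvd_mul_left _ (dvd_add (dvd_add (h1.mul_right _) (h2.mul_left _)) (h3.mul_left _))
  rw [coeff_eq_of_dvd_sub hd (by omega), coeff_add, coeff_C_mul, coeff_X_pow]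
  have e2 : (X ^ i * q).coeff i = q.coeff 0 := by simpa using coeff_X_pow_mul q i 0
  rw [e2]
  split_ifs <;> simp

variable {n d : ℕ}

theorem coeff_arcPoly (a : TruncArc n d) (l : Fin d) (k : Fin n) :
    (arcPoly a l).coeff (k + 1) = a k l := by
  simp only [arcPoly, finsetSum_coeff, coeff_C_mul, coeff_X_pow]
  rw [Finset.sum_eq_single k]
  · simp
  · intro r _ hr
    rw [if_neg (fun h => hr (Fin.ext (by omega))), mul_zero]
  · simp

theorem coeff_arcPoly_zero (a : TruncArc n d) (l : Fin d) : (arcPoly a l).coeff 0 = 0 := by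
  simp [arcPoly, finsetSum_coeff, coeff_X_pow]

theorem arcPoly_add (a b : TruncArc n d) (l : Fin d) :
    arcPoly (a + b) l = arcPoly a l + arcPoly b l := by
  simp [arcPoly, add_mul, Finset.sum_add_distrib]

theorem arcPoly_smul (c : ℝ) (a : TruncArc n d) (l : Fin d) :
    arcPoly (c • a) l = C c * arcPoly a l := by
  simp [arcPoly, Finset.mul_sum, mul_assoc]

/-- Substitution of a polynomial into a truncated arc. -/
noncomputable def substArc (φ : ℝ[X]) : TruncArc n d →ₗ[ℝ] TruncArc n d where
  toFun a := fun k l => ((arcPoly a l).comp φ).coeff (k + 1)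
  map_add' a b := by
    funext k l
    simp [arcPoly_add]
  map_smul' c a := by
    funext k l
    simp [arcPoly_smul]

theorem dvd_arcPoly_substArc {φ : ℝ[X]} (hφ : φ.coeff 0 = 0) (a : TruncArc n d) (l : Fin d) :
    X ^ (n + 1) ∣ arcPoly (substArc φ a) l - (arcPoly a l).comp φ := by
  refine X_pow_dvd_iff.2 fun j hj => ?_
  rw [coeff_sub, sub_eq_zero]
  rcases j with _ | j
  · rw [coeff_arcPoly_zero, coeff_comp_of_lower hφ (by simp), coeff_arcPoly_zero, mul_zero]
  · exact coeff_arcPoly (substArc φ a) l ⟨j, by omega⟩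

/-- Truncating the reparametrized arc discards only orders above `n`. -/
theorem coeff_jet_substArc (G : MvPolynomial (Fin d) ℝ) {φ : ℝ[X]} (hφ : φ.coeff 0 = 0)
    (a : TruncArc n d) {j : ℕ} (hj : j ≤ n) :
    (jet G (substArc φ a)).coeff j = ((jet G a).comp φ).coeff j := by
  have e : (jet G a).comp φ = MvPolynomial.aeval (fun l => (arcPoly a l).comp φ) G := by
    have h : (compRingHom φ).comp (MvPolynomial.aeval (arcPoly a)).toRingHom =
        (MvPolynomial.aeval (fun l => (arcPoly a l).comp φ) :
          MvPolynomial (Fin d) ℝ →ₐ[ℝ] ℝ[X]).toRingHom := by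
      refine MvPolynomial.ringHom_ext (fun r => ?_) fun l => ?_
      · simp
      · simp
    exact congrArg (fun ψ => ψ G) h
  rw [e]
  exact coeff_eq_of_dvd_sub (aeval_sub_dvd G (dvd_arcPoly_substArc hφ a)) (by omega)

theorem substArc_injective {φ : ℝ[X]} (hφ : φ.coeff 0 = 0) (hφ1 : φ.coeff 1 ≠ 0) :
    Function.Injective (substArc φ : TruncArc n d →ₗ[ℝ] TruncArc n d) := by
  rw [← LinearMap.ker_eq_bot, LinearMap.ker_eq_bot']
  intro a ha
  funext k l
  have h1 : ∀ j < n + 1, ((arcPoly a l).comp φ).coeff j = 0 := by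
    intro j hj
    rw [← coeff_eq_of_dvd_sub (dvd_arcPoly_substArc hφ a l) hj, ha]
    simp [arcPoly]
  rw [← coeff_arcPoly a l k]
  exact (coeff_comp_eq_zero_iff hφ hφ1).1 h1 _ (by omega)

theorem continuous_coeff_pow {S : Type*} [TopologicalSpace S] {φ : S → ℝ[X]}
    (h : ∀ j, Continuous fun s => (φ s).coeff j) (r j : ℕ) :
    Continuous fun s => (φ s ^ r).coeff j := by
  induction r generalizing j with
  | zero => simpa using continuous_const
  | succ r ih =>
    simp only [pow_succ, coeff_mul]
    exact continuous_finsetSum _ fun x _ => (ih _).mul (h _)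

theorem continuous_substArc {S : Type*} [TopologicalSpace S] {φ : S → ℝ[X]}
    (h : ∀ j, Continuous fun s => (φ s).coeff j) (a : TruncArc n d) :
    Continuous fun s => substArc (φ s) a := by
  refine continuous_pi fun k => continuous_pi fun l => ?_
  change Continuous fun s => ((arcPoly a l).comp (φ s)).coeff (k + 1)
  have e : ∀ s, ((arcPoly a l).comp (φ s)).coeff (k + 1) =
      ∑ r : Fin n, a r l * (φ s ^ ((r : ℕ) + 1)).coeff (k + 1) := fun s => by
    simp [arcPoly, finsetSum_coeff, Polynomial.sum_comp]
  simp only [e]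
  exact continuous_finsetSum _ fun r _ => continuous_const.mul (continuous_coeff_pow h _ _)

end Substitution

/-- Reparametrization is linear in the arc, so it is inverted by linear algebra, and operator
inversion is continuous. No inverse substitution or group law in `s` is needed. -/
theorem exists_continuous_inverse {W : Type*} [NormedAddCommGroup W] [NormedSpace ℝ W]
    [FiniteDimensional ℝ W] {T : ℝ → W →ₗ[ℝ] W} (hT : ∀ y, Continuous fun s => T s y)
    (hinj : ∀ s, Function.Injective (T s)) :
    ∃ R : ℝ → W → W, Continuous (fun p : ℝ × W => T p.1 p.2) ∧
      Continuous (fun p : ℝ × W => R p.1 p.2) ∧ ∀ s y, T s (R s y) = y := by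
  have := FiniteDimensional.complete ℝ W
  set L : ℝ → W →L[ℝ] W := fun s => (T s).toContinuousLinearMap with hL
  have hLc : Continuous L := continuous_clm_apply.2 hT
  have hu : ∀ s, IsUnit (L s) := fun s =>
    ((LinearMap.isUnit_iff_ker_eq_bot (T s)).2 (LinearMap.ker_eq_bot.2 (hinj s))).map
      (Module.End.toContinuousLinearMap W)
  have hRc : Continuous fun s => Ring.inverse (L s) := continuous_iff_continuousAt.2 fun s => by
    obtain ⟨u, hu⟩ := hu s
    have := NormedRing.inverse_continuousAt u
    rw [hu] at this
    exact this.comp hLc.continuousAt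
  refine ⟨fun s y => Ring.inverse (L s) y, ?_, ?_, fun s y => ?_⟩
  · exact (hLc.comp continuous_fst).clm_apply continuous_snd
  · exact (hRc.comp continuous_fst).clm_apply continuous_snd
  · exact congrArg (fun A : W →L[ℝ] W => A y) (Ring.mul_inverse_cancel _ (hu s))

/-! ### Spaces with a transversal flow -/

section Flow

variable {X : Type} [TopologicalSpace X]

/-- A space with a flow along which a function grows with unit speed splits as a product. -/
def flowHomeomorph {S : Set X} {τ : X → ℝ} (hτ : ContinuousOn τ S) {Φ Ψ : ℝ → X → X}
    (hΦ : Continuous fun p : ℝ × X => Φ p.1 p.2) (hΨ : Continuous fun p : ℝ × X => Ψ p.1 p.2)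
    (h1 : ∀ s x, Φ s (Ψ s x) = x) (h2 : ∀ s x, Ψ s (Φ s x) = x) (hS : ∀ s x, Φ s x ∈ S ↔ x ∈ S)
    (hτΦ : ∀ s, ∀ x ∈ S, τ (Φ s x) = τ x + s) (J : Set ℝ) :
    (S ∩ {x | τ x = 0} : Set X) × J ≃ₜ (S ∩ {x | τ x ∈ J} : Set X) where
  toFun p := ⟨Φ p.2 p.1, (hS _ _).2 p.1.2.1, by
    have h : τ p.1.1 = 0 := p.1.2.2
    simp [hτΦ _ _ p.1.2.1, h]⟩
  invFun x := (⟨Ψ (τ x.1) x.1, by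
    have h : Ψ (τ x.1) x.1 ∈ S := (hS (τ x.1) _).1 (by rw [h1]; exact x.2.1)
    refine ⟨h, ?_⟩
    have := hτΦ (τ x.1) _ h
    rw [h1] at this
    change τ (Ψ (τ x.1) x.1) = 0
    linarith⟩, ⟨τ x.1, x.2.2⟩)
  left_inv p := by
    have h : τ p.1.1 = 0 := p.1.2.2
    have h3 : τ (Φ p.2 p.1.1) = p.2 := by rw [hτΦ _ _ p.1.2.1, h, zero_add]
    refine Prod.ext (Subtype.ext ?_) (Subtype.ext h3)
    change Ψ (τ (Φ p.2 p.1.1)) (Φ p.2 p.1.1) = p.1.1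
    rw [h3, h2]
  right_inv x := Subtype.ext (h1 _ _)
  continuous_toFun := by
    refine Continuous.subtype_mk (hΦ.comp (Continuous.prodMk ?_ ?_)) _ <;> fun_prop
  continuous_invFun := by
    have hc : Continuous fun x : (S ∩ {x | τ x ∈ J} : Set X) => τ x.1 :=
      (hτ.mono Set.inter_subset_left).domRestrict
    exact Continuous.prodMk (Continuous.subtype_mk (hΨ.comp (hc.prodMk continuous_subtype_val)) _)
      (hc.subtype_mk _)

/-- `S` is the zero level times `ℝ`, and its positive part is the zero level times `(0, ∞)`. Both
factors have Euler characteristic `-1`. -/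
theorem eulerCharC_flow {S : Set X} {τ : X → ℝ} (hτ : ContinuousOn τ S) {Φ Ψ : ℝ → X → X}
    (hΦ : Continuous fun p : ℝ × X => Φ p.1 p.2) (hΨ : Continuous fun p : ℝ × X => Ψ p.1 p.2)
    (h1 : ∀ s x, Φ s (Ψ s x) = x) (h2 : ∀ s x, Ψ s (Φ s x) = x) (hS : ∀ s x, Φ s x ∈ S ↔ x ∈ S)
    (hτΦ : ∀ s, ∀ x ∈ S, τ (Φ s x) = τ x + s) (h0 : Tame (S ∩ {x | τ x = 0} : Set X)) :
    eulerCharC S = -eulerCharC (S ∩ {x | τ x = 0} : Set X) ∧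
      eulerCharC (S ∩ {x | 0 < τ x} : Set X) = -eulerCharC (S ∩ {x | τ x = 0} : Set X) := by
  have key : ∀ J : Set ℝ, (ℝ ≃ₜ J) → eulerCharC (S ∩ {x | τ x ∈ J} : Set X) =
      -eulerCharC (S ∩ {x | τ x = 0} : Set X) := fun J e => by
    rw [← eulerCharC_congr (flowHomeomorph hτ hΦ hΨ h1 h2 hS hτΦ J),
      (h0.prod (tame_real.1.congr e)).2, ← eulerCharC_congr e, tame_real.2]
    ring
  constructor
  · have := key Set.univ (Homeomorph.Set.univ ℝ).symm
    have e : S ∩ {x | τ x ∈ (Set.univ : Set ℝ)} = S := by simp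
    rwa [e] at this
  · exact key (Set.Ioi 0) Real.expOrderIso.toHomeomorph

end Flow

/-! ### Cancelling leading terms -/

section Crossing

open Polynomial

variable {V : Type} [TopologicalSpace V] {n d : ℕ}

/-- The coefficient of `t^j` in `G(γ(t))`. -/
noncomputable def jetCoeff (G : MvPolynomial (Fin d) ℝ) (j : ℕ) (y : TruncArc n d) : ℝ :=
  (jet G y).coeff j

theorem jetCoeff_mem_polyFun (G : MvPolynomial (Fin d) ℝ) (j : ℕ) :
    (jetCoeff G j : TruncArc n d → ℝ) ∈ polyFun (TruncArc n d) :=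
  jet_coeff_mem_polyFun G j

theorem continuous_jetCoeff (G : MvPolynomial (Fin d) ℝ) (j : ℕ) :
    Continuous (jetCoeff G j : TruncArc n d → ℝ) :=
  continuous_of_mem_polyFun (jetCoeff_mem_polyFun G j)

theorem exists_inverse_substArc {φ : ℝ → ℝ[X]} (hφ : ∀ j, Continuous fun s => (φ s).coeff j)
    (hφ0 : ∀ s, (φ s).coeff 0 = 0) (hφ1 : ∀ s, (φ s).coeff 1 ≠ 0) :
    ∃ R : ℝ → TruncArc n d → TruncArc n d,
      Continuous (fun p : ℝ × TruncArc n d => substArc (φ p.1) p.2) ∧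
      Continuous (fun p : ℝ × TruncArc n d => R p.1 p.2) ∧
      (∀ s y, substArc (φ s) (R s y) = y) ∧ ∀ s y, R s (substArc (φ s) y) = y := by
  have hinj := fun s => substArc_injective (n := n) (d := d) (hφ0 s) (hφ1 s)
  obtain ⟨R, hT, hR, hTR⟩ := exists_continuous_inverse
    (T := fun s => (substArc (φ s) : TruncArc n d →ₗ[ℝ] TruncArc n d)) (continuous_substArc hφ) hinj
  exact ⟨R, hT, hR, hTR, fun s y => hinj s (hTR s _)⟩

/-- The time `τ` grows with unit speed but need not be polynomial. The function `h` has the same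
sign and defines the cut algebraically. -/
theorem eulerCharC_fiberwise_flow {W : Type} [TopologicalSpace W] {S : Set (V × W)}
    {T R : ℝ → W → W} (hT : Continuous fun p : ℝ × W => T p.1 p.2)
    (hR : Continuous fun p : ℝ × W => R p.1 p.2) (hTR : ∀ s y, T s (R s y) = y)
    (hRT : ∀ s y, R s (T s y) = y) {τ h : V × W → ℝ} (hτ : ContinuousOn τ S)
    (hS : ∀ s x y, (x, T s y) ∈ S ↔ (x, y) ∈ S)
    (hτT : ∀ s x y, (x, y) ∈ S → τ (x, T s y) = τ (x, y) + s)
    (hsign : ∀ z ∈ S, SignType.sign (τ z) = SignType.sign (h z))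
    (h0 : Tame (S ∩ {z | h z = 0} : Set (V × W))) :
    eulerCharC S = -eulerCharC (S ∩ {z | h z = 0} : Set (V × W)) ∧
      eulerCharC (S ∩ {z | 0 < h z} : Set (V × W)) = eulerCharC S := by
  have e0 : S ∩ {z | h z = 0} = S ∩ {z | τ z = 0} := by
    ext z
    refine and_congr_right fun hz => ?_
    change h z = 0 ↔ τ z = 0
    rw [← sign_eq_zero_iff, ← hsign z hz, sign_eq_zero_iff]
  have e1 : S ∩ {z | 0 < h z} = S ∩ {z | 0 < τ z} := by
    ext z
    refine and_congr_right fun hz => ?_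
    change 0 < h z ↔ 0 < τ z
    rw [← sign_eq_one_iff, ← hsign z hz, sign_eq_one_iff]
  rw [e0] at h0 ⊢
  rw [e1]
  have hΦ : Continuous fun p : ℝ × (V × W) => (p.2.1, T p.1 p.2.2) :=
    continuous_snd.fst.prodMk (hT.comp (continuous_fst.prodMk continuous_snd.snd))
  have hΨ : Continuous fun p : ℝ × (V × W) => (p.2.1, R p.1 p.2.2) :=
    continuous_snd.fst.prodMk (hR.comp (continuous_fst.prodMk continuous_snd.snd))
  have H := eulerCharC_flow hτ (Φ := fun s z => (z.1, T s z.2))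
    (Ψ := fun s z => (z.1, R s z.2)) hΦ hΨ (fun s z => by rw [hTR]) (fun s z => by rw [hRT])
    (fun s z => hS s z.1 z.2) (fun s z hz => hτT s z.1 z.2 hz) h0
  exact ⟨H.1, H.2.trans H.1.symm⟩

theorem eulerCharC_of_substArc {S : Set (V × TruncArc n d)} {φ : ℝ → ℝ[X]}
    (hφ : ∀ j, Continuous fun s => (φ s).coeff j) (hφ0 : ∀ s, (φ s).coeff 0 = 0)
    (hφ1 : ∀ s, (φ s).coeff 1 ≠ 0) {τ h : V × TruncArc n d → ℝ} (hτ : ContinuousOn τ S)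
    (hS : ∀ s x y, (x, substArc (φ s) y) ∈ S ↔ (x, y) ∈ S)
    (hτφ : ∀ s x y, (x, y) ∈ S → τ (x, substArc (φ s) y) = τ (x, y) + s)
    (hsign : ∀ z ∈ S, SignType.sign (τ z) = SignType.sign (h z))
    (h0 : Tame (S ∩ {z | h z = 0} : Set (V × TruncArc n d))) :
    eulerCharC S = -eulerCharC (S ∩ {z | h z = 0} : Set (V × TruncArc n d)) ∧
      eulerCharC (S ∩ {z | 0 < h z} : Set (V × TruncArc n d)) = eulerCharC S := by
  obtain ⟨R, hT, hR, hTR, hRT⟩ := exists_inverse_substArc (n := n) (d := d) hφ hφ0 hφ1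
  exact eulerCharC_fiberwise_flow (T := fun s y => substArc (φ s) y) hT hR hTR hRT hτ hS hτφ hsign h0

/-- Pairs of arcs along which the leading terms, of order `i`, have opposite signs and cancel
up to order `k`. -/
def crossing {V W : Type} (P : ℕ → V → ℝ) (Q : ℕ → W → ℝ) (i k : ℕ) : Set (V × W) :=
  {z | (∀ j < i, P j z.1 = 0 ∧ Q j z.2 = 0) ∧ 0 < P i z.1 ∧ Q i z.2 < 0 ∧
    ∀ j, i ≤ j → j < k → P j z.1 + Q j z.2 = 0}

theorem crossing_succ {V W : Type} (P : ℕ → V → ℝ) (Q : ℕ → W → ℝ) {i k : ℕ} (hk : i ≤ k) :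
    crossing P Q i (k + 1) = crossing P Q i k ∩ {z | P k z.1 + Q k z.2 = 0} := by
  ext z
  constructor
  · rintro ⟨h1, h2, h3, h4⟩
    exact ⟨⟨h1, h2, h3, fun j hj hjk => h4 j hj (by omega)⟩, h4 k hk (by omega)⟩
  · rintro ⟨⟨h1, h2, h3, h4⟩, h5⟩
    refine ⟨h1, h2, h3, fun j hj hjk => ?_⟩
    rcases Nat.lt_succ_iff_lt_or_eq.1 hjk with h | rfl
    · exact h4 j hj h
    · exact h5

/-- Reparametrizing the second arc moves `P k + Q k` strictly monotonically through all real values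
when `k > i`, and moves the ratio of the leading terms through all positive values when `k = i`. The
earlier conditions are preserved, and exactly one parameter achieves cancellation at order `k`. -/
theorem eulerCharC_crossing_step {P : ℕ → V → ℝ} (hP : ∀ j, Continuous (P j))
    (G : MvPolynomial (Fin d) ℝ) {i k : ℕ} (hi : 1 ≤ i) (hik : i ≤ k) (hkn : k ≤ n)
    (h0 : Tame (crossing P (jetCoeff G : ℕ → TruncArc n d → ℝ) i (k + 1))) :
    eulerCharC (crossing P (jetCoeff G : ℕ → TruncArc n d → ℝ) i k) =
        -eulerCharC (crossing P (jetCoeff G : ℕ → TruncArc n d → ℝ) i (k + 1)) ∧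
      eulerCharC (crossing P (jetCoeff G : ℕ → TruncArc n d → ℝ) i k ∩
        {z | 0 < P k z.1 + jetCoeff G k z.2} : Set (V × TruncArc n d)) =
        eulerCharC (crossing P (jetCoeff G : ℕ → TruncArc n d → ℝ) i k) := by
  set Q : ℕ → TruncArc n d → ℝ := jetCoeff G with hQ
  have hQc : ∀ j, Continuous (Q j) := fun j => continuous_jetCoeff G j
  have hi' : (0 : ℝ) < i := by exact_mod_cast hi
  rw [crossing_succ P Q hik] at h0 ⊢
  -- the lower coefficients of a reparametrized arc vanish simultaneously
  have hlow : ∀ {φ : ℝ[X]}, φ.coeff 0 = 0 → φ.coeff 1 ≠ 0 → ∀ y : TruncArc n d,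
      (∀ j < i, Q j (substArc φ y) = 0) ↔ ∀ j < i, Q j y = 0 := by
    intro φ hφ hφ1 y
    have := coeff_comp_eq_zero_iff (p := jet G y) hφ hφ1 (i := i)
    refine Iff.trans (forall₂_congr fun j hj => ?_) this
    rw [← coeff_jet_substArc G hφ y (by omega : j ≤ n)]
    rfl
  rcases hik.eq_or_lt with rfl | hlt
  · -- scaling
    -- Scaling `t` by `exp (-s)` multiplies `Q i` by `exp (-i s)`, so `log (P i / -Q i) / i` grows
    -- with unit speed and vanishes exactly when the leading terms cancel.
    set φ : ℝ → ℝ[X] := fun s => C (Real.exp (-s)) * X with hφ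
    have hφ0 : ∀ s, (φ s).coeff 0 = 0 := fun s => by simp [hφ]
    have hφ1 : ∀ s, (φ s).coeff 1 ≠ 0 := fun s => by simp [hφ, Real.exp_ne_zero]
    have hQφ : ∀ s y, Q i (substArc (φ s) y) = Q i y * Real.exp (-s) ^ i := fun s y => by
      change (jet G (substArc (φ s) y)).coeff i = _
      rw [coeff_jet_substArc G (hφ0 s) y hkn]
      exact comp_C_mul_X_coeff
    refine eulerCharC_of_substArc (φ := φ) (τ := fun z => Real.log (P i z.1 / -Q i z.2) / i)
      (h := fun z => P i z.1 + Q i z.2) (fun j => ?_) hφ0 hφ1 ?_ (fun s x y => ?_)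
      (fun s x y hz => ?_) (fun z hz => ?_) h0
    · simp only [hφ, coeff_C_mul]
      fun_prop
    · refine ContinuousOn.div_const (ContinuousOn.log (ContinuousOn.div ?_ ?_ ?_) ?_) _
      · exact ((hP i).comp continuous_fst).continuousOn
      · exact ((hQc i).comp continuous_snd).neg.continuousOn
      · exact fun z hz => (neg_pos.2 hz.2.2.1).ne'
      · exact fun z hz => (div_pos hz.2.1 (neg_pos.2 hz.2.2.1)).ne'
    · have h1 := hlow (hφ0 s) (hφ1 s) y
      have h2 : Q i (substArc (φ s) y) < 0 ↔ Q i y < 0 := by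
        rw [hQφ]
        have := pow_pos (Real.exp_pos (-s)) i
        exact ⟨fun h => by nlinarith, fun h => mul_neg_of_neg_of_pos h this⟩
      exact ⟨fun ⟨a1, a2, a3, _⟩ => ⟨fun j hj => ⟨(a1 j hj).1, h1.1 (fun j hj => (a1 j hj).2) j hj⟩,
          a2, h2.1 a3, fun j hj hj' => absurd hj' (not_lt.2 hj)⟩,
        fun ⟨a1, a2, a3, _⟩ => ⟨fun j hj => ⟨(a1 j hj).1, h1.2 (fun j hj => (a1 j hj).2) j hj⟩,
          a2, h2.2 a3, fun j hj hj' => absurd hj' (not_lt.2 hj)⟩⟩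
    · have hp := hz.2.1
      have hq : 0 < -Q i y := neg_pos.2 hz.2.2.1
      simp only
      rw [hQφ, ← neg_mul, ← div_div, Real.log_div (div_pos hp hq).ne'
        (pow_pos (Real.exp_pos _) _).ne', Real.log_pow, Real.log_exp]
      field_simp
      ring
    · have hp := hz.2.1
      have hq : 0 < -Q i z.2 := neg_pos.2 hz.2.2.1
      have e : P i z.1 + Q i z.2 = P i z.1 - -Q i z.2 := by ring
      rw [e]
      rcases lt_trichotomy (P i z.1) (-Q i z.2) with h | h | h
      · rw [sign_neg (sub_neg.2 h), sign_neg (div_neg_of_neg_of_pos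
          (Real.log_neg (div_pos hp hq) ((div_lt_one hq).2 h)) hi')]
      · rw [h, div_self hq.ne', sub_self, Real.log_one, zero_div]
      · rw [sign_pos (sub_pos.2 h), sign_pos (div_pos (Real.log_pos ((one_lt_div hq).2 h)) hi')]
  · -- higher reparametrization
    obtain ⟨m, rfl⟩ := Nat.exists_eq_add_of_lt hlt
    -- Here `k - i = m + 1`. The substitution adds `-s i (Q i)` to `Q k` and leaves the lower
    -- coefficients alone; dividing by `i * -Q i > 0` normalizes the speed.
    set φ : ℝ → ℝ[X] := fun s => X + C (-s) * X ^ (m + 1 + 1) with hφ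
    have hφ0 : ∀ s, (φ s).coeff 0 = 0 := fun s => by simp [hφ]
    have hφ1 : ∀ s, (φ s).coeff 1 ≠ 0 := fun s => by simp [hφ, coeff_X_pow]
    have hQφ : ∀ s y, (∀ j < i, Q j y = 0) → ∀ j ≤ i + m + 1, Q j (substArc (φ s) y) =
        Q j y + if j = i + (m + 1) then -s * i * Q i y else 0 := fun s y hy j hj => by
      change (jet G (substArc (φ s) y)).coeff j = _
      rw [coeff_jet_substArc G (hφ0 s) y (by omega)]
      exact coeff_comp_X_add (by omega) hy (-s) (by omega)
    refine eulerCharC_of_substArc (φ := φ)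
      (τ := fun z => (P (i + m + 1) z.1 + Q (i + m + 1) z.2) / (i * -Q i z.2))
      (h := fun z => P (i + m + 1) z.1 + Q (i + m + 1) z.2) (fun j => ?_) hφ0 hφ1 ?_
      (fun s x y => ?_) (fun s x y hz => ?_) (fun z hz => ?_) h0
    · simp only [hφ, coeff_add, coeff_C_mul]
      fun_prop
    · refine ContinuousOn.div ?_ ?_ fun z hz => ?_
      · exact (((hP _).comp continuous_fst).add ((hQc _).comp continuous_snd)).continuousOn
      · exact (continuous_const.mul ((hQc i).comp continuous_snd).neg).continuousOn
      · exact (mul_pos hi' (neg_pos.2 hz.2.2.1)).ne'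
    · have h1 := hlow (hφ0 s) (hφ1 s) y
      have e : (∀ j < i, Q j y = 0) → ∀ j < i + m + 1, Q j (substArc (φ s) y) = Q j y :=
        fun hy j hj => by rw [hQφ s y hy j hj.le, if_neg (by omega), add_zero]
      constructor
      · rintro ⟨a1, a2, a3, a4⟩
        have hy := h1.1 fun j hj => (a1 j hj).2
        refine ⟨fun j hj => ⟨(a1 j hj).1, hy j hj⟩, a2, ?_, fun j hj hjk => ?_⟩
        · rw [← e hy i (by omega)]
          exact a3
        · rw [← e hy j hjk]
          exact a4 j hj hjk
      · rintro ⟨a1, a2, a3, a4⟩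
        have hy := fun j hj => (a1 j hj).2
        refine ⟨fun j hj => ⟨(a1 j hj).1, h1.2 hy j hj⟩, a2, ?_, fun j hj hjk => ?_⟩
        · rw [e hy i (by omega)]
          exact a3
        · rw [e hy j hjk]
          exact a4 j hj hjk
    · have hq : 0 < -Q i y := neg_pos.2 hz.2.2.1
      simp only
      rw [hQφ s y (fun j hj => (hz.1 j hj).2) _ le_rfl, if_pos (by omega),
        hQφ s y (fun j hj => (hz.1 j hj).2) i (by omega), if_neg (by omega), add_zero]
      have hq0 : Q i y ≠ 0 := (neg_pos.1 hq).ne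
      field_simp
      ring
    · have hq : 0 < i * -Q i z.2 := mul_pos hi' (neg_pos.2 hz.2.2.1)
      rw [div_eq_mul_inv, sign_mul, sign_pos (inv_pos.2 hq), mul_one]

end Crossing

/-! ### Decomposition of the arcs of a sum -/

section Semialgebraic

variable {V W : Type} [AddCommGroup V] [Module ℝ V] [TopologicalSpace V]
  [AddCommGroup W] [Module ℝ W] [TopologicalSpace W]

/-- The predicate defines a locally closed set and depends on the signs of finitely many
polynomial functions. -/
def SignDefinable (p : V → Prop) : Prop :=
  IsLocallyClosed {x | p x} ∧ ∃ G : Finset (V → ℝ), (∀ g ∈ G, g ∈ polyFun V) ∧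
    ∀ x y, (∀ g ∈ G, SignType.sign (g x) = SignType.sign (g y)) → p x → p y

theorem SignDefinable.and {p q : V → Prop} (hp : SignDefinable p) (hq : SignDefinable q) :
    SignDefinable fun x => p x ∧ q x := by
  classical
  obtain ⟨hp, G, hG, h⟩ := hp
  obtain ⟨hq, G', hG', h'⟩ := hq
  refine ⟨hp.inter hq, G ∪ G', fun g hg => (Finset.mem_union.1 hg).elim (hG g) (hG' g),
    fun x y hxy hx => ⟨h x y (fun g hg => hxy g (Finset.mem_union_left _ hg)) hx.1,
      h' x y (fun g hg => hxy g (Finset.mem_union_right _ hg)) hx.2⟩⟩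

theorem signDefinable_const (a : Prop) : SignDefinable fun _ : V => a :=
  ⟨by by_cases h : a <;> simp [h, isOpen_univ.isLocallyClosed, isOpen_empty.isLocallyClosed],
    ∅, by simp, fun _ _ _ h => h⟩

theorem SignDefinable.imp {a : Prop} {p : V → Prop} (hp : a → SignDefinable p) :
    SignDefinable fun x => a → p x := by
  by_cases h : a
  · simpa [h] using hp h
  · simpa [h] using signDefinable_const True

theorem SignDefinable.forall_lt {i : ℕ} {p : ℕ → V → Prop} (h : ∀ j < i, SignDefinable (p j)) :
    SignDefinable fun x => ∀ j < i, p j x := by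
  induction i with
  | zero => simpa using signDefinable_const True
  | succ i ih =>
    simp only [Nat.forall_lt_succ_right]
    exact (ih fun j hj => h j (by omega)).and (h i (by omega))

variable [IsTopologicalAddGroup V] [ContinuousSMul ℝ V] [T2Space V] [FiniteDimensional ℝ V]

theorem signDefinable_sign_eq {g : V → ℝ} (hg : g ∈ polyFun V) (τ : SignType) :
    SignDefinable fun x => SignType.sign (g x) = τ :=
  ⟨isLocallyClosed_sign_eq (continuous_of_mem_polyFun hg) τ, {g}, by simpa using hg,
    fun x y h hx => (h g (Finset.mem_singleton_self g)).symm.trans hx⟩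

theorem signDefinable_eq_zero {g : V → ℝ} (hg : g ∈ polyFun V) : SignDefinable fun x => g x = 0 := by
  simpa only [sign_eq_zero_iff] using signDefinable_sign_eq hg 0

theorem signDefinable_pos {g : V → ℝ} (hg : g ∈ polyFun V) : SignDefinable fun x => 0 < g x := by
  simpa only [sign_eq_one_iff] using signDefinable_sign_eq hg 1

theorem signDefinable_neg {g : V → ℝ} (hg : g ∈ polyFun V) : SignDefinable fun x => g x < 0 := by
  simpa only [sign_eq_neg_one_iff] using signDefinable_sign_eq hg (-1)

theorem SignDefinable.tame {p : V → Prop} (hp : SignDefinable p) : Tame {x | p x} := by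
  obtain ⟨hp, G, hG, h⟩ := hp
  exact tame_of_polyFun G hG hp h

end Semialgebraic

/-! ### Sets of arcs with prescribed order and sign of the leading coefficient. -/

section Order

variable {V W : Type}

/-- All coefficients below `i` vanish. -/
def ordGE (P : ℕ → V → ℝ) (i : ℕ) : Set V := {x | ∀ j < i, P j x = 0}

/-- The leading coefficient has index `i` and is positive. -/
def ordPos (P : ℕ → V → ℝ) (i : ℕ) : Set V := {x | (∀ j < i, P j x = 0) ∧ 0 < P i x}

/-- The leading coefficient has index `i` and is negative. -/
def ordNeg (P : ℕ → V → ℝ) (i : ℕ) : Set V := {x | (∀ j < i, P j x = 0) ∧ P i x < 0}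

/-- The sums of the coefficients. -/
def sumCoeff (P : ℕ → V → ℝ) (Q : ℕ → W → ℝ) (j : ℕ) (z : V × W) : ℝ := P j z.1 + Q j z.2

variable [AddCommGroup V] [Module ℝ V] [AddCommGroup W] [Module ℝ W]
  {P : ℕ → V → ℝ} {Q : ℕ → W → ℝ}

theorem fst_mem_polyFun (hP : ∀ j, P j ∈ polyFun V) (j : ℕ) :
    (fun z : V × W => P j z.1) ∈ polyFun (V × W) :=
  comp_mem_polyFun (LinearMap.fst ℝ V W) (hP j)

theorem snd_mem_polyFun (hQ : ∀ j, Q j ∈ polyFun W) (j : ℕ) :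
    (fun z : V × W => Q j z.2) ∈ polyFun (V × W) :=
  comp_mem_polyFun (LinearMap.snd ℝ V W) (hQ j)

theorem sumCoeff_mem_polyFun (hP : ∀ j, P j ∈ polyFun V) (hQ : ∀ j, Q j ∈ polyFun W) (j : ℕ) :
    sumCoeff P Q j ∈ polyFun (V × W) :=
  (polyFun (V × W)).add_mem (fst_mem_polyFun hP j) (snd_mem_polyFun hQ j)

variable [TopologicalSpace V] [IsTopologicalAddGroup V] [ContinuousSMul ℝ V] [T2Space V]
  [FiniteDimensional ℝ V] [TopologicalSpace W] [IsTopologicalAddGroup W] [ContinuousSMul ℝ W]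
  [T2Space W] [FiniteDimensional ℝ W]

theorem signDefinable_ordGE (hP : ∀ j, P j ∈ polyFun V) (i : ℕ) :
    SignDefinable fun x => ∀ j < i, P j x = 0 :=
  SignDefinable.forall_lt fun j _ => signDefinable_eq_zero (hP j)

theorem tame_ordGE (hP : ∀ j, P j ∈ polyFun V) (i : ℕ) : Tame (ordGE P i) :=
  (signDefinable_ordGE hP i).tame

theorem signDefinable_ordPos (hP : ∀ j, P j ∈ polyFun V) (i : ℕ) :
    SignDefinable fun x => (∀ j < i, P j x = 0) ∧ 0 < P i x :=
  (signDefinable_ordGE hP i).and (signDefinable_pos (hP i))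

theorem signDefinable_ordNeg (hP : ∀ j, P j ∈ polyFun V) (i : ℕ) :
    SignDefinable fun x => (∀ j < i, P j x = 0) ∧ P i x < 0 :=
  (signDefinable_ordGE hP i).and (signDefinable_neg (hP i))

theorem tame_ordPos (hP : ∀ j, P j ∈ polyFun V) (i : ℕ) : Tame (ordPos P i) :=
  (signDefinable_ordPos hP i).tame

theorem tame_ordNeg (hP : ∀ j, P j ∈ polyFun V) (i : ℕ) : Tame (ordNeg P i) :=
  (signDefinable_ordNeg hP i).tame

theorem signDefinable_crossing (hP : ∀ j, P j ∈ polyFun V) (hQ : ∀ j, Q j ∈ polyFun W) (i k : ℕ) :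
    SignDefinable fun z : V × W => (∀ j < i, P j z.1 = 0 ∧ Q j z.2 = 0) ∧ 0 < P i z.1 ∧
      Q i z.2 < 0 ∧ ∀ j, i ≤ j → j < k → P j z.1 + Q j z.2 = 0 := by
  refine (SignDefinable.forall_lt fun j _ => (signDefinable_eq_zero (fst_mem_polyFun hP j)).and
    (signDefinable_eq_zero (snd_mem_polyFun hQ j))).and ((signDefinable_pos (fst_mem_polyFun hP i)).and
    ((signDefinable_neg (snd_mem_polyFun hQ i)).and ?_))
  have e : (fun z : V × W => ∀ j, i ≤ j → j < k → P j z.1 + Q j z.2 = 0) =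
      fun z => ∀ j < k, i ≤ j → P j z.1 + Q j z.2 = 0 := by
    funext z
    exact propext ⟨fun h j hj hi => h j hi hj, fun h j hi hj => h j hj hi⟩
  rw [e]
  exact SignDefinable.forall_lt fun j _ =>
    SignDefinable.imp fun _ => signDefinable_eq_zero (sumCoeff_mem_polyFun hP hQ j)

theorem tame_crossing (hP : ∀ j, P j ∈ polyFun V) (hQ : ∀ j, Q j ∈ polyFun W) (i k : ℕ) :
    Tame (crossing P Q i k) :=
  (signDefinable_crossing hP hQ i k).tame

end Order

theorem tame_setProd {V W : Type} [TopologicalSpace V] [TopologicalSpace W] {S : Set V} {T : Set W}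
    (hS : Tame S) (hT : Tame T) :
    Tame (S ×ˢ T : Set (V × W)) ∧ eulerCharC (S ×ˢ T : Set (V × W)) = eulerCharC S * eulerCharC T :=
  ⟨(hS.prod hT).1.congr (Homeomorph.Set.prod S T).symm, by
    rw [eulerCharC_congr (Homeomorph.Set.prod S T), (hS.prod hT).2]⟩

theorem crossing_self {V W : Type} (P : ℕ → V → ℝ) (Q : ℕ → W → ℝ) (i : ℕ) :
    crossing P Q i i = ordPos P i ×ˢ ordNeg Q i := by
  ext z
  constructor
  · rintro ⟨h1, h2, h3, -⟩
    exact ⟨⟨fun j hj => (h1 j hj).1, h2⟩, ⟨fun j hj => (h1 j hj).2, h3⟩⟩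
  · rintro ⟨⟨h1, h2⟩, h3, h4⟩
    exact ⟨fun j hj => ⟨h1 j hj, h3 j hj⟩, h2, h4, fun j hj hj' => absurd hj' (not_lt.2 hj)⟩

section Arcs

variable {n d₁ d₂ : ℕ} (F : MvPolynomial (Fin d₁) ℝ) (G : MvPolynomial (Fin d₂) ℝ)

/-- Starting from the product of `ordPos` and `ordNeg` at `k = i`, each further cancelled order
contributes `-1`; the final positivity condition contributes nothing. The first factor is kept
abstract so that the lemma applies with the two arcs in either role. -/
theorem eulerCharC_crossing {V : Type} [AddCommGroup V] [Module ℝ V] [TopologicalSpace V]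
    [IsTopologicalAddGroup V] [ContinuousSMul ℝ V] [T2Space V] [FiniteDimensional ℝ V]
    {P : ℕ → V → ℝ} (hP : ∀ j, P j ∈ polyFun V) {i k : ℕ} (hi : 1 ≤ i) (hik : i ≤ k) (hkn : k ≤ n) :
    eulerCharC (crossing P (jetCoeff G : ℕ → TruncArc n d₂ → ℝ) i k ∩
      {z | 0 < P k z.1 + jetCoeff G k z.2} : Set (V × TruncArc n d₂)) =
      (-1) ^ (k - i) * (eulerCharC (ordPos P i) *
        eulerCharC (ordNeg (jetCoeff G : ℕ → TruncArc n d₂ → ℝ) i)) := by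
  have hQ := jetCoeff_mem_polyFun (n := n) G
  have step := fun k (h : i ≤ k) (h' : k ≤ n) => eulerCharC_crossing_step (n := n)
    (fun j => continuous_of_mem_polyFun (hP j)) G hi h h' (tame_crossing hP hQ i (k + 1))
  rw [(step k hik hkn).2]
  induction k, hik using Nat.le_induction with
  | base =>
    rw [crossing_self, (tame_setProd (tame_ordPos hP i) (tame_ordNeg hQ i)).2]
    simp
  | succ k hik ih =>
    have h1 := (step k hik (by omega)).1
    rw [ih (by omega)] at h1
    rw [Nat.succ_sub hik, pow_succ]
    linarith

end Arcs

/-! ### The Euler characteristic of the arcs of a sum -/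

/-- Exchange of the factors, on subsets. -/
def swapHomeomorph {V W : Type} [TopologicalSpace V] [TopologicalSpace W] {S : Set (V × W)}
    {T : Set (W × V)} (h : ∀ x y, (x, y) ∈ S ↔ (y, x) ∈ T) : S ≃ₜ T :=
  (Homeomorph.prodComm V W).sets (by ext ⟨x, y⟩; exact h x y)

/-- The arcs of the sum of order `n` with positive leading coefficient whose components have
order at least `i`. -/
def sumStratum {d₁ d₂ : ℕ} (F : MvPolynomial (Fin d₁) ℝ) (G : MvPolynomial (Fin d₂) ℝ) (n i : ℕ) :
    Set (TruncArc n d₁ × TruncArc n d₂) :=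
  {z | ((∀ j < n, sumCoeff (jetCoeff F) (jetCoeff G) j z = 0) ∧
    0 < sumCoeff (jetCoeff F) (jetCoeff G) n z) ∧ ∀ j < i, jetCoeff F j z.1 = 0}

section Sum

variable {n d₁ d₂ : ℕ} (F : MvPolynomial (Fin d₁) ℝ) (G : MvPolynomial (Fin d₂) ℝ)

local notation "P" => (jetCoeff F : ℕ → TruncArc n d₁ → ℝ)
local notation "Q" => (jetCoeff G : ℕ → TruncArc n d₂ → ℝ)

theorem signDefinable_sumStratum (i : ℕ) : SignDefinable fun z : TruncArc n d₁ × TruncArc n d₂ =>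
    ((∀ j < n, sumCoeff P Q j z = 0) ∧ 0 < sumCoeff P Q n z) ∧ ∀ j < i, P j z.1 = 0 :=
  (signDefinable_ordPos (sumCoeff_mem_polyFun (jetCoeff_mem_polyFun F) (jetCoeff_mem_polyFun G)) n).and
    (SignDefinable.forall_lt fun j _ =>
      signDefinable_eq_zero (fst_mem_polyFun (jetCoeff_mem_polyFun F) j))

/-- A negative `P i` forces `Q i` to be positive, by cancellation for `i < n` and by positivity of
the sum for `i = n`. Exchanging the factors gives a crossing. -/
theorem eulerCharC_sumStratum_neg {i : ℕ} (hi : 1 ≤ i) (hin : i ≤ n) :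
    eulerCharC (sumStratum F G n i ∩ {z | P i z.1 < 0} : Set (TruncArc n d₁ × TruncArc n d₂)) =
      (-1) ^ (n - i) * (eulerCharC (ordNeg P i) * eulerCharC (ordPos Q i)) := by
  have hQ := jetCoeff_mem_polyFun (n := n) G
  have e : ∀ x y, (x, y) ∈ sumStratum F G n i ∩ {z | P i z.1 < 0} ↔
      (y, x) ∈ crossing Q P i n ∩ {z | 0 < Q n z.1 + P n z.2} := by
    intro x y
    simp only [sumStratum, crossing, sumCoeff, Set.mem_inter_iff, Set.mem_ofPred_eq]
    constructor
    · rintro ⟨⟨⟨h1, h2⟩, h3⟩, h4⟩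
      have h5 : 0 < Q i y := by
        rcases hin.eq_or_lt with rfl | h
        · linarith
        · have := h1 i h
          linarith
      refine ⟨⟨fun j hj => ⟨?_, h3 j hj⟩, h5, h4, fun j _ hj => ?_⟩, by linarith⟩
      · have := h1 j (by omega)
        have := h3 j hj
        linarith
      · have := h1 j hj
        linarith
    · rintro ⟨⟨h1, h2, h3, h4⟩, h5⟩
      refine ⟨⟨⟨fun j hj => ?_, by linarith⟩, fun j hj => (h1 j hj).2⟩, h3⟩
      rcases lt_or_ge j i with h | h
      · rw [(h1 j h).1, (h1 j h).2, add_zero]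
      · have := h4 j h hj
        linarith
  rw [eulerCharC_congr (swapHomeomorph e), eulerCharC_crossing F hQ hi hin le_rfl]
  ring

/-- Here `i < n` is essential: at `i = n` a positive `P n` leaves the sign of `Q n` free, and that
case is treated separately. -/
theorem eulerCharC_sumStratum_pos {i : ℕ} (hi : 1 ≤ i) (hin : i < n) :
    eulerCharC (sumStratum F G n i ∩ {z | 0 < P i z.1} : Set (TruncArc n d₁ × TruncArc n d₂)) =
      (-1) ^ (n - i) * (eulerCharC (ordPos P i) * eulerCharC (ordNeg Q i)) := by
  have hP := jetCoeff_mem_polyFun (n := n) F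
  have e : sumStratum F G n i ∩ {z | 0 < P i z.1} =
      crossing P Q i n ∩ {z | 0 < P n z.1 + Q n z.2} := by
    ext ⟨x, y⟩
    simp only [sumStratum, crossing, sumCoeff, Set.mem_inter_iff, Set.mem_ofPred_eq]
    constructor
    · rintro ⟨⟨⟨h1, h2⟩, h3⟩, h4⟩
      refine ⟨⟨fun j hj => ⟨h3 j hj, ?_⟩, h4, ?_, fun j _ hj => h1 j hj⟩, h2⟩
      · have := h1 j (by omega)
        have := h3 j hj
        linarith
      · have := h1 i hin
        linarith
    · rintro ⟨⟨h1, h2, h3, h4⟩, h5⟩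
      refine ⟨⟨⟨fun j hj => ?_, h5⟩, fun j hj => (h1 j hj).1⟩, h2⟩
      rcases lt_or_ge j i with h | h
      · rw [(h1 j h).1, (h1 j h).2, add_zero]
      · exact h4 j h hj
  rw [e, eulerCharC_crossing G hP hi hin.le le_rfl]

theorem sumStratum_succ {i : ℕ} :
    sumStratum F G n i ∩ {z | P i z.1 = 0} = sumStratum F G n (i + 1) := by
  ext z
  simp only [sumStratum, Set.mem_inter_iff, Set.mem_ofPred_eq, Nat.forall_lt_succ_right, and_assoc]

theorem eulerCharC_sumStratum_split (i : ℕ) :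
    eulerCharC (sumStratum F G n i) = eulerCharC (sumStratum F G n (i + 1)) +
      eulerCharC (sumStratum F G n i ∩ {z | 0 < P i z.1} : Set (TruncArc n d₁ × TruncArc n d₂)) +
      eulerCharC (sumStratum F G n i ∩ {z | P i z.1 < 0} : Set (TruncArc n d₁ × TruncArc n d₂)) := by
  have hP := jetCoeff_mem_polyFun (n := n) F
  have H := Tame.of_sign (signDefinable_sumStratum F G i).1
    ((continuous_jetCoeff F i).comp continuous_fst) (h := fun z => P i z.1)
    ((signDefinable_sumStratum F G i).and (signDefinable_eq_zero (fst_mem_polyFun hP i))).tame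
    ((signDefinable_sumStratum F G i).and (signDefinable_pos (fst_mem_polyFun hP i))).tame
    ((signDefinable_sumStratum F G i).and (signDefinable_neg (fst_mem_polyFun hP i))).tame
  rw [← sumStratum_succ]
  exact H.2

/-- With `P n` positive, a zero, positive or negative `Q n` gives the three summands; in the first
two, positivity of the sum is automatic. -/
theorem eulerCharC_sumStratum_self_pos :
    eulerCharC (sumStratum F G n n ∩ {z | 0 < P n z.1} : Set (TruncArc n d₁ × TruncArc n d₂)) =
      eulerCharC (ordPos P n) * eulerCharC (ordGE Q (n + 1)) +
      eulerCharC (ordPos P n) * eulerCharC (ordPos Q n) +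
      eulerCharC (crossing P Q n n ∩ {z | 0 < P n z.1 + Q n z.2} :
        Set (TruncArc n d₁ × TruncArc n d₂)) := by
  have hP := jetCoeff_mem_polyFun (n := n) F
  have hQ := jetCoeff_mem_polyFun (n := n) G
  have hS := (signDefinable_sumStratum (n := n) F G n).and (signDefinable_pos (fst_mem_polyFun hP n))
  have H := Tame.of_sign hS.1 ((continuous_jetCoeff G n).comp continuous_snd) (h := fun z => Q n z.2)
    (hS.and (signDefinable_eq_zero (snd_mem_polyFun hQ n))).tame
    (hS.and (signDefinable_pos (snd_mem_polyFun hQ n))).tame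
    (hS.and (signDefinable_neg (snd_mem_polyFun hQ n))).tame
  have e1 : sumStratum F G n n ∩ {z | 0 < P n z.1} ∩ {z | Q n z.2 = 0} =
      ordPos P n ×ˢ ordGE Q (n + 1) := by
    ext ⟨x, y⟩
    simp only [sumStratum, ordPos, ordGE, sumCoeff, Set.mem_inter_iff, Set.mem_ofPred_eq, Set.mem_prod,
      Nat.forall_lt_succ_right]
    constructor
    · rintro ⟨⟨⟨⟨h1, h2⟩, h3⟩, h4⟩, h5⟩
      exact ⟨⟨h3, h4⟩, fun j hj => by simpa [h3 j hj] using h1 j hj, h5⟩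
    · rintro ⟨⟨h1, h2⟩, h3, h4⟩
      exact ⟨⟨⟨⟨fun j hj => by rw [h1 j hj, h3 j hj, add_zero], by linarith⟩, h1⟩, h2⟩, h4⟩
  have e2 : sumStratum F G n n ∩ {z | 0 < P n z.1} ∩ {z | 0 < Q n z.2} =
      ordPos P n ×ˢ ordPos Q n := by
    ext ⟨x, y⟩
    simp only [sumStratum, ordPos, sumCoeff, Set.mem_inter_iff, Set.mem_ofPred_eq, Set.mem_prod]
    constructor
    · rintro ⟨⟨⟨⟨h1, h2⟩, h3⟩, h4⟩, h5⟩
      exact ⟨⟨h3, h4⟩, fun j hj => by simpa [h3 j hj] using h1 j hj, h5⟩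
    · rintro ⟨⟨h1, h2⟩, h3, h4⟩
      exact ⟨⟨⟨⟨fun j hj => by rw [h1 j hj, h3 j hj, add_zero], by linarith⟩, h1⟩, h2⟩, h4⟩
  have e3 : sumStratum F G n n ∩ {z | 0 < P n z.1} ∩ {z | Q n z.2 < 0} =
      crossing P Q n n ∩ {z | 0 < P n z.1 + Q n z.2} := by
    ext ⟨x, y⟩
    simp only [sumStratum, crossing, sumCoeff, Set.mem_inter_iff, Set.mem_ofPred_eq]
    constructor
    · rintro ⟨⟨⟨⟨h1, h2⟩, h3⟩, h4⟩, h5⟩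
      exact ⟨⟨fun j hj => ⟨h3 j hj, by simpa [h3 j hj] using h1 j hj⟩, h4, h5,
        fun j hj hj' => absurd hj' (not_lt.2 hj)⟩, h2⟩
    · rintro ⟨⟨h1, h2, h3, h4⟩, h5⟩
      exact ⟨⟨⟨⟨fun j hj => by rw [(h1 j hj).1, (h1 j hj).2, add_zero], h5⟩,
        fun j hj => (h1 j hj).1⟩, h2⟩, h3⟩
  rw [← (tame_setProd (tame_ordPos hP n) (tame_ordGE hQ (n + 1))).2,
    ← (tame_setProd (tame_ordPos hP n) (tame_ordPos hQ n)).2, ← e1, ← e2, ← e3]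
  exact H.2

theorem eulerCharC_sumStratum_last :
    eulerCharC (sumStratum F G n (n + 1)) =
      eulerCharC (ordGE P (n + 1)) * eulerCharC (ordPos Q n) := by
  have hP := jetCoeff_mem_polyFun (n := n) F
  have hQ := jetCoeff_mem_polyFun (n := n) G
  have e : sumStratum F G n (n + 1) = ordGE P (n + 1) ×ˢ ordPos Q n := by
    ext ⟨x, y⟩
    simp only [sumStratum, ordPos, ordGE, sumCoeff, Set.mem_ofPred_eq, Set.mem_prod]
    constructor
    · rintro ⟨⟨h1, h2⟩, h3⟩
      exact ⟨h3, fun j hj => by simpa [h3 j (by omega)] using h1 j hj,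
        by simpa [h3 n (by omega)] using h2⟩
    · rintro ⟨h1, h2, h3⟩
      refine ⟨⟨fun j hj => by rw [h1 j (by omega), h2 j hj, add_zero], ?_⟩, h1⟩
      rw [h1 n (by omega), zero_add]
      exact h3
  rw [e, (tame_setProd (tame_ordGE hP (n + 1)) (tame_ordPos hQ n)).2]

theorem eulerCharC_sumStratum_top (hn : 1 ≤ n) :
    eulerCharC (sumStratum F G n n) =
      eulerCharC (ordPos P n) * eulerCharC (ordPos Q n) +
      eulerCharC (ordPos P n) * eulerCharC (ordGE Q (n + 1)) +
      eulerCharC (ordGE P (n + 1)) * eulerCharC (ordPos Q n) +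
      (eulerCharC (ordPos P n) * eulerCharC (ordNeg Q n) +
        eulerCharC (ordNeg P n) * eulerCharC (ordPos Q n)) := by
  rw [eulerCharC_sumStratum_split, eulerCharC_sumStratum_last, eulerCharC_sumStratum_self_pos,
    eulerCharC_sumStratum_neg F G hn le_rfl, eulerCharC_crossing G (jetCoeff_mem_polyFun F) hn le_rfl le_rfl,
    Nat.sub_self, pow_zero]
  ring

/-- Peel off the pairs whose first component has order `1, 2, …, n - 1`. Each order contributes its
two mixed products, and the stratum of order at least `n` contributes the remaining terms, including
the mixed ones for `i = n`. -/
theorem eulerCharC_ordPos_sumCoeff (hF : MvPolynomial.eval 0 F = 0) (hn : 1 ≤ n) :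
    eulerCharC (ordPos (sumCoeff P Q) n) =
      eulerCharC (ordPos P n) * eulerCharC (ordPos Q n) +
      eulerCharC (ordPos P n) * eulerCharC (ordGE Q (n + 1)) +
      eulerCharC (ordGE P (n + 1)) * eulerCharC (ordPos Q n) +
      ∑ i ∈ Finset.Icc 1 n, (-1) ^ (n - i) * (eulerCharC (ordPos P i) * eulerCharC (ordNeg Q i) +
        eulerCharC (ordNeg P i) * eulerCharC (ordPos Q i)) := by
  -- The strata start at `1` because the constant coefficient of `F(γ(t))` is always zero.
  have e : ordPos (sumCoeff P Q) n = sumStratum F G n 1 := by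
    ext z
    refine (and_iff_left ?_).symm
    intro j hj
    obtain rfl : j = 0 := by omega
    exact jet_coeff_zero hF z.1
  rw [e]
  have key : ∀ k, 1 ≤ k → k ≤ n → eulerCharC (sumStratum F G n 1) = eulerCharC (sumStratum F G n k) +
      ∑ i ∈ Finset.Ico 1 k, (-1) ^ (n - i) * (eulerCharC (ordPos P i) * eulerCharC (ordNeg Q i) +
        eulerCharC (ordNeg P i) * eulerCharC (ordPos Q i)) := by
    intro k hk
    induction k, hk using Nat.le_induction with
    | base => simp
    | succ k hk ih =>
      intro hkn
      rw [ih (by omega), Finset.sum_Ico_succ_top hk, eulerCharC_sumStratum_split F G k,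
        eulerCharC_sumStratum_pos F G hk (by omega), eulerCharC_sumStratum_neg F G hk (by omega)]
      ring
  rw [key n hn le_rfl, eulerCharC_sumStratum_top F G hn, ← Finset.Ico_succ_right_eq_Icc,
    Nat.succ_eq_succ, Nat.succ_eq_add_one, Finset.sum_Ico_succ_top hn, Nat.sub_self, pow_zero]
  ring

end Sum

/-! ### Coefficients of the zeta functions -/

section Order

variable {V : Type} [AddCommGroup V] [Module ℝ V] [TopologicalSpace V] [IsTopologicalAddGroup V]
  [ContinuousSMul ℝ V] [T2Space V] [FiniteDimensional ℝ V] {P : ℕ → V → ℝ}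

variable (V) in
theorem tame_vectorSpace : Tame V := by
  have : Tame {_x : V | True} := (signDefinable_const True).tame
  exact this.congr (Homeomorph.Set.univ V)

/-- The leading coefficient has index `i`. -/
def ordEq (P : ℕ → V → ℝ) (i : ℕ) : Set V := {x | (∀ j < i, P j x = 0) ∧ P i x ≠ 0}

theorem ordEq_tame (hP : ∀ j, P j ∈ polyFun V) (i : ℕ) :
    Tame (ordEq P i) ∧ eulerCharC (ordEq P i) = eulerCharC (ordPos P i) + eulerCharC (ordNeg P i) := by
  have := (tame_vectorSpace V).locallyCompact
  have := (tame_vectorSpace V).metrizable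
  have hloc : IsLocallyClosed (ordEq P i) := (signDefinable_ordGE hP i).1.inter
    (isOpen_ne_fun (continuous_of_mem_polyFun (hP i)) continuous_const).isLocallyClosed
  have e0 : ordEq P i ∩ {x | P i x = 0} = ∅ := by
    ext x
    simp only [ordEq, Set.mem_inter_iff, Set.mem_ofPred_eq, Set.mem_empty_iff_false, iff_false]
    exact fun h => h.1.2 h.2
  have e1 : ordEq P i ∩ {x | 0 < P i x} = ordPos P i := by
    ext x
    exact ⟨fun h => ⟨h.1.1, h.2⟩, fun h => ⟨⟨h.1, h.2.ne'⟩, h.2⟩⟩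
  have e2 : ordEq P i ∩ {x | P i x < 0} = ordNeg P i := by
    ext x
    exact ⟨fun h => ⟨h.1.1, h.2⟩, fun h => ⟨⟨h.1, h.2.ne⟩, h.2⟩⟩
  have H := Tame.of_sign hloc (continuous_of_mem_polyFun (hP i)) (by rw [e0]; exact tame_of_isEmpty)
    (by rw [e1]; exact tame_ordPos hP i) (by rw [e2]; exact tame_ordNeg hP i)
  refine ⟨H.1, ?_⟩
  rw [H.2, e0, e1, e2, (hasEulerCharC_of_isEmpty (X := (∅ : Set V))).2, zero_add]

theorem eulerCharC_ordGE_succ (hP : ∀ j, P j ∈ polyFun V) (i : ℕ) :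
    eulerCharC (ordGE P i) =
      eulerCharC (ordGE P (i + 1)) + eulerCharC (ordPos P i) + eulerCharC (ordNeg P i) := by
  have := (tame_vectorSpace V).locallyCompact
  have := (tame_vectorSpace V).metrizable
  have e0 : ordGE P (i + 1) = ordGE P i ∩ {x | P i x = 0} := by
    ext x
    exact Nat.forall_lt_succ_right
  rw [e0]
  exact (Tame.of_sign (signDefinable_ordGE hP i).1 (continuous_of_mem_polyFun (hP i))
    (e0 ▸ tame_ordGE hP (i + 1)) (tame_ordPos hP i) (tame_ordNeg hP i)).2

/-- The arcs of order greater than `n` are what is left of the whole space after removing those of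
orders `1, …, n`. This is the origin of `A n` and `B n`. -/
theorem eulerCharC_ordGE (hP : ∀ j, P j ∈ polyFun V) (h0 : ∀ x, P 0 x = 0) (n : ℕ) :
    eulerCharC (ordGE P (n + 1)) = eulerCharC V -
      ∑ i ∈ Finset.Icc 1 n, (eulerCharC (ordPos P i) + eulerCharC (ordNeg P i)) := by
  induction n with
  | zero =>
    have e : ordGE P (0 + 1) = Set.univ := by
      ext x
      simp [ordGE, h0]
    rw [e, eulerCharC_congr (Homeomorph.Set.univ V)]
    simp
  | succ n ih =>
    rw [Finset.sum_Icc_succ_top (by omega)]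
    have := eulerCharC_ordGE_succ hP (n + 1)
    linarith

end Order

/-! ### Dependence on the truncation level, and change of sign. -/

section Level

open Polynomial

variable {d : ℕ}

theorem eulerCharC_truncArc (r d : ℕ) :
    Tame (TruncArc r d) ∧ eulerCharC (TruncArc r d) = (-1) ^ (r * d) := by
  have e : TruncArc r d ≃L[ℝ] (Fin (r * d) → ℝ) := ContinuousLinearEquiv.ofFinrankEq (by
    simp [Module.finrank_pi_fintype])
  exact ⟨(tame_pi (r * d)).1.congr e.toHomeomorph.symm, by
    rw [eulerCharC_congr e.toHomeomorph, (tame_pi (r * d)).2]⟩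

theorem jetCoeff_append (F : MvPolynomial (Fin d) ℝ) {i r : ℕ} (a : TruncArc i d) (b : TruncArc r d)
    {j : ℕ} (hj : j ≤ i) :
    jetCoeff F j (Fin.append a b : TruncArc (i + r) d) = jetCoeff F j a := by
  refine coeff_eq_of_dvd_sub (N := i + 1) (aeval_sub_dvd F fun l => ?_) (by omega)
  have : arcPoly (Fin.append a b : TruncArc (i + r) d) l - arcPoly a l =
      ∑ k : Fin r, C (b k l) * X ^ (i + k + 1) := by
    simp [arcPoly, Fin.sum_univ_add]
  rw [this]
  exact Finset.dvd_sum fun k _ => (pow_dvd_pow X (by omega)).mul_left _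

/-- The coefficients of index at most `i` see only the first `i` vectors of the arc; the other `r`
vectors are a free factor `ℝ^(rd)`. -/
theorem eulerCharC_ordPos_level (F : MvPolynomial (Fin d) ℝ) (i r : ℕ) :
    eulerCharC (ordPos (jetCoeff F : ℕ → TruncArc (i + r) d → ℝ) i) =
      (-1) ^ (r * d) * eulerCharC (ordPos (jetCoeff F : ℕ → TruncArc i d → ℝ) i) := by
  have ht := tame_ordPos (jetCoeff_mem_polyFun (n := i) F) i
  have e : ordPos (jetCoeff F : ℕ → TruncArc i d → ℝ) i ×ˢ (Set.univ : Set (TruncArc r d)) =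
      Fin.appendHomeomorph i r ⁻¹' ordPos (jetCoeff F : ℕ → TruncArc (i + r) d → ℝ) i := by
    ext ⟨a, b⟩
    have h : ∀ j ≤ i, jetCoeff F j (Fin.appendHomeomorph (X := Fin d → ℝ) i r (a, b)) =
      jetCoeff F j a := fun j hj => jetCoeff_append F a b hj
    simp only [ordPos, Set.mem_prod, Set.mem_univ, and_true, Set.mem_preimage, Set.mem_ofPred_eq,
      h i le_rfl]
    exact and_congr_left' (forall₂_congr fun j hj => by rw [h j hj.le])
  have hu : Tame (Set.univ : Set (TruncArc r d)) :=
    (eulerCharC_truncArc r d).1.congr (Homeomorph.Set.univ _).symm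
  rw [← eulerCharC_congr ((Fin.appendHomeomorph (X := Fin d → ℝ) i r).sets e),
    (tame_setProd ht hu).2, eulerCharC_congr (Homeomorph.Set.univ (TruncArc r d)),
    (eulerCharC_truncArc r d).2, mul_comm]

/-- Negation exchanges the positive and negative sets, so only the positive formula requires a
geometric proof. -/
theorem jetCoeff_neg {n : ℕ} (F : MvPolynomial (Fin d) ℝ) (j : ℕ) (a : TruncArc n d) :
    jetCoeff (-F) j a = -jetCoeff F j a := by
  simp [jetCoeff, jet]

theorem ordPos_jetCoeff_neg {n : ℕ} (F : MvPolynomial (Fin d) ℝ) (i : ℕ) :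
    ordPos (jetCoeff (-F) : ℕ → TruncArc n d → ℝ) i = ordNeg (jetCoeff F) i := by
  ext a
  simp [ordPos, ordNeg, jetCoeff_neg]

theorem ordNeg_jetCoeff_neg {n : ℕ} (F : MvPolynomial (Fin d) ℝ) (i : ℕ) :
    ordNeg (jetCoeff (-F) : ℕ → TruncArc n d → ℝ) i = ordPos (jetCoeff F) i := by
  ext a
  simp [ordPos, ordNeg, jetCoeff_neg]

theorem ordGE_jetCoeff_neg {n : ℕ} (F : MvPolynomial (Fin d) ℝ) (i : ℕ) :
    ordGE (jetCoeff (-F) : ℕ → TruncArc n d → ℝ) i = ordGE (jetCoeff F) i := by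
  ext a
  simp [ordGE, jetCoeff_neg]

theorem eulerCharC_ordNeg_level (F : MvPolynomial (Fin d) ℝ) (i r : ℕ) :
    eulerCharC (ordNeg (jetCoeff F : ℕ → TruncArc (i + r) d → ℝ) i) =
      (-1) ^ (r * d) * eulerCharC (ordNeg (jetCoeff F : ℕ → TruncArc i d → ℝ) i) := by
  rw [← ordPos_jetCoeff_neg, ← ordPos_jetCoeff_neg, eulerCharC_ordPos_level]

end Level

/-! ### Zeta coefficients read off in a single truncated arc space. -/

section Zeta

open Asymptotics

variable {d : ℕ} {f : (Fin d → ℝ) → ℝ}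

/-- `F` is a Taylor polynomial of `f` of order `n` at the origin. -/
def IsTaylor (f : (Fin d → ℝ) → ℝ) (n : ℕ) (F : MvPolynomial (Fin d) ℝ) : Prop :=
  (fun y => f y - MvPolynomial.eval y F) =O[𝓝 0] fun y => ‖y‖ ^ (n + 1)

theorem hasLeadingTerm_arc_iff (hf : AnalyticAt ℝ f 0) {n : ℕ} {F : MvPolynomial (Fin d) ℝ}
    (hF : IsTaylor f n F) {m : ℕ} (hm : m ≤ n) {k : ℕ} (a : TruncArc k d) {c : ℝ} :
    HasLeadingTerm (fun t => f (arc a t)) m c ↔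
      (∀ j < m, jetCoeff F j a = 0) ∧ jetCoeff F m a = c :=
  hasLeadingTerm_iff (analyticAt_comp_arc hf a) hm (isBigO_jet hF a)

theorem arcsPos_eq (hf : AnalyticAt ℝ f 0) {n : ℕ} {F : MvPolynomial (Fin d) ℝ}
    (hF : IsTaylor f n F) {m : ℕ} (hm : m ≤ n) : arcsPos f m = ordPos (jetCoeff F) m := by
  ext a
  simp only [arcsPos, hasLeadingTerm_arc_iff hf hF hm, ordPos, Set.mem_ofPred_eq]
  exact ⟨fun ⟨c, hc, h1, h2⟩ => ⟨h1, h2 ▸ hc⟩, fun ⟨h1, h2⟩ => ⟨_, h2, h1, rfl⟩⟩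

theorem arcsNeg_eq (hf : AnalyticAt ℝ f 0) {n : ℕ} {F : MvPolynomial (Fin d) ℝ}
    (hF : IsTaylor f n F) {m : ℕ} (hm : m ≤ n) : arcsNeg f m = ordNeg (jetCoeff F) m := by
  ext a
  simp only [arcsNeg, hasLeadingTerm_arc_iff hf hF hm, ordNeg, Set.mem_ofPred_eq]
  exact ⟨fun ⟨c, hc, h1, h2⟩ => ⟨h1, h2 ▸ hc⟩, fun ⟨h1, h2⟩ => ⟨_, h2, h1, rfl⟩⟩

theorem arcsAll_eq (hf : AnalyticAt ℝ f 0) {n : ℕ} {F : MvPolynomial (Fin d) ℝ}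
    (hF : IsTaylor f n F) {m : ℕ} (hm : m ≤ n) : arcsAll f m = ordEq (jetCoeff F) m := by
  ext a
  simp only [arcsAll, hasLeadingTerm_arc_iff hf hF hm, ordEq, Set.mem_ofPred_eq]
  exact ⟨fun ⟨c, hc, h1, h2⟩ => ⟨h1, h2 ▸ hc⟩, fun ⟨h1, h2⟩ => ⟨_, h2, h1, rfl⟩⟩

theorem zetaDefined_of_analyticAt (hf : AnalyticAt ℝ f 0) : ZetaDefined f := by
  intro n _
  obtain ⟨F, hF⟩ := exists_mvPolynomial_isBigO hf n
  have hP := jetCoeff_mem_polyFun (n := n) F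
  rw [arcsPos_eq hf hF le_rfl, arcsNeg_eq hf hF le_rfl, arcsAll_eq hf hF le_rfl]
  exact ⟨(tame_ordPos hP n).hasEulerCharC, (tame_ordNeg hP n).hasEulerCharC,
    (ordEq_tame hP n).1.hasEulerCharC⟩

theorem coeff_arcSeries (S : (n : ℕ) → Set (TruncArc n d)) {i : ℕ} (hi : 1 ≤ i) :
    PowerSeries.coeff i (arcSeries S) = (-1) ^ (i * d) * eulerCharC (S i) := by
  rw [arcSeries, PowerSeries.coeff_mk, if_neg (by omega)]

theorem neg_one_pow_level {i n : ℕ} (hin : i ≤ n) (d : ℕ) (x : ℤ) :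
    (-1) ^ (i * d) * x = (-1) ^ (n * d) * ((-1) ^ ((n - i) * d) * x) := by
  obtain ⟨r, rfl⟩ := Nat.exists_eq_add_of_le hin
  rw [Nat.add_sub_cancel_left, add_mul, pow_add, ← mul_assoc, mul_assoc ((-1) ^ (i * d)),
    ← mul_pow, neg_one_mul, neg_neg, one_pow, mul_one]

/-- The sign `(-1)^(id)` in the zeta function compensates the free factor of the level change. All
coefficients of index at most `n` can thus be computed in arcs of length `n`. -/
theorem coeff_zetaPos (hf : AnalyticAt ℝ f 0) {n : ℕ} {F : MvPolynomial (Fin d) ℝ}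
    (hF : IsTaylor f n F) {i : ℕ} (hi : 1 ≤ i) (hin : i ≤ n) :
    PowerSeries.coeff i (zetaPos f) =
      (-1) ^ (n * d) * eulerCharC (ordPos (jetCoeff F : ℕ → TruncArc n d → ℝ) i) := by
  rw [zetaPos, coeff_arcSeries _ hi, arcsPos_eq hf hF hin, neg_one_pow_level hin]
  obtain ⟨r, rfl⟩ := Nat.exists_eq_add_of_le hin
  rw [Nat.add_sub_cancel_left, eulerCharC_ordPos_level]

theorem coeff_zetaNeg (hf : AnalyticAt ℝ f 0) {n : ℕ} {F : MvPolynomial (Fin d) ℝ}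
    (hF : IsTaylor f n F) {i : ℕ} (hi : 1 ≤ i) (hin : i ≤ n) :
    PowerSeries.coeff i (zetaNeg f) =
      (-1) ^ (n * d) * eulerCharC (ordNeg (jetCoeff F : ℕ → TruncArc n d → ℝ) i) := by
  rw [zetaNeg, coeff_arcSeries _ hi, arcsNeg_eq hf hF hin, neg_one_pow_level hin]
  obtain ⟨r, rfl⟩ := Nat.exists_eq_add_of_le hin
  rw [Nat.add_sub_cancel_left, eulerCharC_ordNeg_level]

theorem coeff_zeta (hf : AnalyticAt ℝ f 0) {i : ℕ} (hi : 1 ≤ i) :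
    PowerSeries.coeff i (zeta f) =
      PowerSeries.coeff i (zetaPos f) + PowerSeries.coeff i (zetaNeg f) := by
  obtain ⟨F, hF⟩ := exists_mvPolynomial_isBigO hf i
  rw [zeta, zetaPos, zetaNeg, coeff_arcSeries _ hi, coeff_arcSeries _ hi, coeff_arcSeries _ hi,
    arcsAll_eq hf hF le_rfl, arcsPos_eq hf hF le_rfl, arcsNeg_eq hf hF le_rfl,
    (ordEq_tame (jetCoeff_mem_polyFun F) i).2, mul_add]

/-- The constant `1` is the normalized Euler characteristic of the whole arc space, so `A n`
measures the arcs along which `f` has order greater than `n`. -/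
theorem partialCoeff_eq (hf : AnalyticAt ℝ f 0) (hf0 : f 0 = 0) {n : ℕ}
    {F : MvPolynomial (Fin d) ℝ} (hF : IsTaylor f n F) :
    partialCoeff f n =
      (-1) ^ (n * d) * eulerCharC (ordGE (jetCoeff F : ℕ → TruncArc n d → ℝ) (n + 1)) := by
  rw [eulerCharC_ordGE (jetCoeff_mem_polyFun F) (jet_coeff_zero (eval_zero_of_isBigO hf0 hF)),
    (eulerCharC_truncArc n d).2, mul_sub, ← mul_pow, neg_one_mul, neg_neg, one_pow, Finset.mul_sum,
    partialCoeff]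
  congr 1
  refine Finset.sum_congr rfl fun i hi => ?_
  obtain ⟨h1, h2⟩ := Finset.mem_Icc.1 hi
  rw [coeff_zeta hf h1, coeff_zetaPos hf hF h1 h2, coeff_zetaNeg hf hF h1 h2, mul_add]

end Zeta

/-! ### The zeta functions of the sum, through the splitting of arcs into two components. -/

section Product

open Asymptotics

variable {d₁ d₂ : ℕ} {f : (Fin d₁ → ℝ) → ℝ} {g : (Fin d₂ → ℝ) → ℝ}

theorem analyticAt_thomSebastianiSum (hf : AnalyticAt ℝ f 0) (hg : AnalyticAt ℝ g 0) :
    AnalyticAt ℝ (thomSebastianiSum f g) 0 := by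
  have h1 : AnalyticAt ℝ (fun (z : Fin (d₁ + d₂) → ℝ) (i : Fin d₁) => z (Fin.castAdd d₂ i)) 0 :=
    AnalyticAt.pi fun i => (ContinuousLinearMap.proj (R := ℝ) (φ := fun _ => ℝ)
      (Fin.castAdd d₂ i)).analyticAt 0
  have h2 : AnalyticAt ℝ (fun (z : Fin (d₁ + d₂) → ℝ) (j : Fin d₂) => z (Fin.natAdd d₁ j)) 0 :=
    AnalyticAt.pi fun j => (ContinuousLinearMap.proj (R := ℝ) (φ := fun _ => ℝ)
      (Fin.natAdd d₁ j)).analyticAt 0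
  exact (AnalyticAt.comp_of_eq hf h1 rfl).add (AnalyticAt.comp_of_eq hg h2 rfl)

/-- The components of an arc in a product. -/
def splitArc (n d₁ d₂ : ℕ) : TruncArc n (d₁ + d₂) ≃ₜ TruncArc n d₁ × TruncArc n d₂ where
  toFun c := (fun k i => c k (Fin.castAdd d₂ i), fun k j => c k (Fin.natAdd d₁ j))
  invFun z := fun k => Fin.append (z.1 k) (z.2 k)
  left_inv c := by
    funext k
    exact Fin.append_castAdd_natAdd
  right_inv z := by
    simp
  continuous_toFun := by fun_prop
  continuous_invFun := continuous_pi fun k =>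
    (Fin.appendHomeomorph (X := ℝ) d₁ d₂).continuous.comp
      (f := fun z : TruncArc n d₁ × TruncArc n d₂ => (z.1 k, z.2 k)) (by fun_prop)

/-- The sum of the two jets approximates the composite to order `n`, so no Taylor polynomial in `d₁
+ d₂` variables is needed. -/
theorem hasLeadingTerm_sum_iff (hf : AnalyticAt ℝ f 0) (hg : AnalyticAt ℝ g 0) {n : ℕ}
    {F : MvPolynomial (Fin d₁) ℝ} {G : MvPolynomial (Fin d₂) ℝ} (hF : IsTaylor f n F)
    (hG : IsTaylor g n G) (a : TruncArc n (d₁ + d₂)) {c : ℝ} :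
    HasLeadingTerm (fun t => thomSebastianiSum f g (arc a t)) n c ↔
      (∀ j < n, sumCoeff (jetCoeff F) (jetCoeff G) j (splitArc n d₁ d₂ a) = 0) ∧
        sumCoeff (jetCoeff F) (jetCoeff G) n (splitArc n d₁ d₂ a) = c := by
  have e : (fun t => thomSebastianiSum f g (arc a t)) = fun t =>
      f (arc (splitArc n d₁ d₂ a).1 t) + g (arc (splitArc n d₁ d₂ a).2 t) := by
    funext t
    refine congrArg₂ (fun x y => f x + g y) ?_ ?_ <;> funext i <;> simp [arc, splitArc]
  have ha : AnalyticAt ℝ (fun t => f (arc (splitArc n d₁ d₂ a).1 t) +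
      g (arc (splitArc n d₁ d₂ a).2 t)) 0 :=
    (analyticAt_comp_arc hf _).add (analyticAt_comp_arc hg _)
  rw [e, hasLeadingTerm_iff (P := jet F (splitArc n d₁ d₂ a).1 + jet G (splitArc n d₁ d₂ a).2)
    ha (le_refl n) ?_]
  · simp only [Polynomial.coeff_add, sumCoeff, jetCoeff]
  · refine ((isBigO_jet hF (splitArc n d₁ d₂ a).1).add
      (isBigO_jet hG (splitArc n d₁ d₂ a).2)).congr_left fun t => ?_
    rw [Polynomial.eval_add]
    ring

variable {n : ℕ} {F : MvPolynomial (Fin d₁) ℝ} {G : MvPolynomial (Fin d₂) ℝ}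

theorem coeff_zetaPos_sum (hf : AnalyticAt ℝ f 0) (hg : AnalyticAt ℝ g 0) (hn : 1 ≤ n)
    (hF : IsTaylor f n F) (hG : IsTaylor g n G) :
    PowerSeries.coeff n (zetaPos (thomSebastianiSum f g)) = (-1) ^ (n * (d₁ + d₂)) *
      eulerCharC (ordPos (sumCoeff (jetCoeff F) (jetCoeff G) :
        ℕ → TruncArc n d₁ × TruncArc n d₂ → ℝ) n) := by
  have e : arcsPos (thomSebastianiSum f g) n =
      splitArc n d₁ d₂ ⁻¹' ordPos (sumCoeff (jetCoeff F) (jetCoeff G)) n := by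
    ext a
    simp only [arcsPos, hasLeadingTerm_sum_iff hf hg hF hG, ordPos, Set.mem_ofPred_eq,
      Set.mem_preimage]
    exact ⟨fun ⟨c, hc, h1, h2⟩ => ⟨h1, h2 ▸ hc⟩, fun ⟨h1, h2⟩ => ⟨_, h2, h1, rfl⟩⟩
  rw [zetaPos, coeff_arcSeries _ hn, eulerCharC_congr ((splitArc n d₁ d₂).sets e)]

theorem coeff_zetaNeg_sum (hf : AnalyticAt ℝ f 0) (hg : AnalyticAt ℝ g 0) (hn : 1 ≤ n)
    (hF : IsTaylor f n F) (hG : IsTaylor g n G) :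
    PowerSeries.coeff n (zetaNeg (thomSebastianiSum f g)) = (-1) ^ (n * (d₁ + d₂)) *
      eulerCharC (ordPos (sumCoeff (jetCoeff (-F)) (jetCoeff (-G)) :
        ℕ → TruncArc n d₁ × TruncArc n d₂ → ℝ) n) := by
  have e : arcsNeg (thomSebastianiSum f g) n =
      splitArc n d₁ d₂ ⁻¹' ordPos (sumCoeff (jetCoeff (-F)) (jetCoeff (-G))) n := by
    ext a
    have h : ∀ j, sumCoeff (jetCoeff (-F)) (jetCoeff (-G)) j (splitArc n d₁ d₂ a) =
        -sumCoeff (jetCoeff F) (jetCoeff G) j (splitArc n d₁ d₂ a) := fun j => by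
      simp only [sumCoeff, jetCoeff_neg]
      ring
    simp only [arcsNeg, hasLeadingTerm_sum_iff hf hg hF hG, ordPos, Set.mem_ofPred_eq,
      Set.mem_preimage, h, neg_eq_zero, Left.neg_pos_iff]
    exact ⟨fun ⟨c, hc, h1, h2⟩ => ⟨h1, h2 ▸ hc⟩, fun ⟨h1, h2⟩ => ⟨_, h2, h1, rfl⟩⟩
  rw [zetaNeg, coeff_arcSeries _ hn, eulerCharC_congr ((splitArc n d₁ d₂).sets e)]

theorem thomSebastiani_coeff (hf : AnalyticAt ℝ f 0) (hf0 : f 0 = 0) (hg : AnalyticAt ℝ g 0)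
    (hg0 : g 0 = 0) (hn : 1 ≤ n) :
    PowerSeries.coeff n (zetaPos (thomSebastianiSum f g)) =
        PowerSeries.coeff n (zetaPos f) * PowerSeries.coeff n (zetaPos g) +
        PowerSeries.coeff n (zetaPos f) * partialCoeff g n +
        partialCoeff f n * PowerSeries.coeff n (zetaPos g) +
        ∑ i ∈ Finset.Icc 1 n, (-1) ^ (n - i) *
          (PowerSeries.coeff i (zetaPos f) * PowerSeries.coeff i (zetaNeg g) +
            PowerSeries.coeff i (zetaNeg f) * PowerSeries.coeff i (zetaPos g)) ∧
      PowerSeries.coeff n (zetaNeg (thomSebastianiSum f g)) =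
        PowerSeries.coeff n (zetaNeg f) * PowerSeries.coeff n (zetaNeg g) +
        PowerSeries.coeff n (zetaNeg f) * partialCoeff g n +
        partialCoeff f n * PowerSeries.coeff n (zetaNeg g) +
        ∑ i ∈ Finset.Icc 1 n, (-1) ^ (n - i) *
          (PowerSeries.coeff i (zetaPos f) * PowerSeries.coeff i (zetaNeg g) +
            PowerSeries.coeff i (zetaNeg f) * PowerSeries.coeff i (zetaPos g)) := by
  obtain ⟨F, hF⟩ := exists_mvPolynomial_isBigO hf n
  obtain ⟨G, hG⟩ := exists_mvPolynomial_isBigO hg n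
  have hF0 := eval_zero_of_isBigO hf0 hF
  have hS : ∑ i ∈ Finset.Icc 1 n, (-1) ^ (n - i) *
      (PowerSeries.coeff i (zetaPos f) * PowerSeries.coeff i (zetaNeg g) +
        PowerSeries.coeff i (zetaNeg f) * PowerSeries.coeff i (zetaPos g)) =
      (-1) ^ (n * (d₁ + d₂)) * ∑ i ∈ Finset.Icc 1 n, (-1) ^ (n - i) *
        (eulerCharC (ordPos (jetCoeff F : ℕ → TruncArc n d₁ → ℝ) i) *
            eulerCharC (ordNeg (jetCoeff G : ℕ → TruncArc n d₂ → ℝ) i) +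
          eulerCharC (ordNeg (jetCoeff F : ℕ → TruncArc n d₁ → ℝ) i) *
            eulerCharC (ordPos (jetCoeff G : ℕ → TruncArc n d₂ → ℝ) i)) := by
    rw [Finset.mul_sum]
    refine Finset.sum_congr rfl fun i hi => ?_
    obtain ⟨h1, h2⟩ := Finset.mem_Icc.1 hi
    rw [coeff_zetaPos hf hF h1 h2, coeff_zetaNeg hf hF h1 h2, coeff_zetaPos hg hG h1 h2,
      coeff_zetaNeg hg hG h1 h2, mul_add n, pow_add]
    ring
  rw [hS, coeff_zetaPos_sum hf hg hn hF hG, coeff_zetaNeg_sum hf hg hn hF hG,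
    coeff_zetaPos hf hF hn le_rfl, coeff_zetaNeg hf hF hn le_rfl, coeff_zetaPos hg hG hn le_rfl,
    coeff_zetaNeg hg hG hn le_rfl, partialCoeff_eq hf hf0 hF, partialCoeff_eq hg hg0 hG,
    eulerCharC_ordPos_sumCoeff F G hF0 hn,
    eulerCharC_ordPos_sumCoeff (-F) (-G) (by rw [map_neg, hF0, neg_zero]) hn]
  have n1 : ∀ {d : ℕ} (H : MvPolynomial (Fin d) ℝ) (i : ℕ),
      eulerCharC (ordPos (jetCoeff (-H) : ℕ → TruncArc n d → ℝ) i) =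
        eulerCharC (ordNeg (jetCoeff H : ℕ → TruncArc n d → ℝ) i) := fun H i => by
    rw [ordPos_jetCoeff_neg]
  have n2 : ∀ {d : ℕ} (H : MvPolynomial (Fin d) ℝ) (i : ℕ),
      eulerCharC (ordNeg (jetCoeff (-H) : ℕ → TruncArc n d → ℝ) i) =
        eulerCharC (ordPos (jetCoeff H : ℕ → TruncArc n d → ℝ) i) := fun H i => by
    rw [ordNeg_jetCoeff_neg]
  have n3 : ∀ {d : ℕ} (H : MvPolynomial (Fin d) ℝ) (i : ℕ),
      eulerCharC (ordGE (jetCoeff (-H) : ℕ → TruncArc n d → ℝ) i) =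
        eulerCharC (ordGE (jetCoeff H : ℕ → TruncArc n d → ℝ) i) := fun H i => by
    rw [ordGE_jetCoeff_neg]
  simp only [n1, n2, n3]
  constructor
  · rw [mul_add n, pow_add]
    ring
  -- Negation exchanges the two mixed products in each summand.
  · rw [Finset.sum_congr rfl fun i _ => congrArg ((-1) ^ (n - i) * ·) (add_comm _ _)]
    rw [mul_add n, pow_add]
    ring

end Product

end ThomSebastiani

theorem mainTheorem6 (d₁ d₂ : ℕ) (f : (Fin d₁ → ℝ) → ℝ) (g : (Fin d₂ → ℝ) → ℝ)
    (hf : AnalyticAt ℝ f 0) (hf0 : f 0 = 0) (hg : AnalyticAt ℝ g 0) (hg0 : g 0 = 0)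
    (a aPos aNeg b bPos bNeg c cPos cNeg A B : ℕ → ℤ)
    (ha : ∀ i, a i = PowerSeries.coeff i (ThomSebastiani.zeta f))
    (haPos : ∀ i, aPos i = PowerSeries.coeff i (ThomSebastiani.zetaPos f))
    (haNeg : ∀ i, aNeg i = PowerSeries.coeff i (ThomSebastiani.zetaNeg f))
    (hb : ∀ i, b i = PowerSeries.coeff i (ThomSebastiani.zeta g))
    (hbPos : ∀ i, bPos i = PowerSeries.coeff i (ThomSebastiani.zetaPos g))
    (hbNeg : ∀ i, bNeg i = PowerSeries.coeff i (ThomSebastiani.zetaNeg g))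
    (hc : ∀ i, c i =
      PowerSeries.coeff i (ThomSebastiani.zeta (ThomSebastiani.thomSebastianiSum f g)))
    (hcPos : ∀ i, cPos i =
      PowerSeries.coeff i (ThomSebastiani.zetaPos (ThomSebastiani.thomSebastianiSum f g)))
    (hcNeg : ∀ i, cNeg i =
      PowerSeries.coeff i (ThomSebastiani.zetaNeg (ThomSebastiani.thomSebastianiSum f g)))
    (hA : ∀ n, A n = ThomSebastiani.partialCoeff f n)
    (hB : ∀ n, B n = ThomSebastiani.partialCoeff g n) :
    (ThomSebastiani.ZetaDefined f ∧ ThomSebastiani.ZetaDefined g ∧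
      ThomSebastiani.ZetaDefined (ThomSebastiani.thomSebastianiSum f g)) ∧
    ∀ n : ℕ, 1 ≤ n →
      cPos n = aPos n * bPos n + aPos n * B n + A n * bPos n +
          ∑ i ∈ Finset.Icc 1 n, (-1) ^ (n - i) * (aPos i * bNeg i + aNeg i * bPos i) ∧
      cNeg n = aNeg n * bNeg n + aNeg n * B n + A n * bNeg n +
          ∑ i ∈ Finset.Icc 1 n, (-1) ^ (n - i) * (aPos i * bNeg i + aNeg i * bPos i) ∧
      c n = aPos n * bPos n + aNeg n * bNeg n + a n * B n + A n * b n +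
          2 * ∑ i ∈ Finset.Icc 1 n, (-1) ^ (n - i) * (aPos i * bNeg i + aNeg i * bPos i) := by
  have hfg := ThomSebastiani.analyticAt_thomSebastianiSum hf hg
  refine ⟨⟨ThomSebastiani.zetaDefined_of_analyticAt hf, ThomSebastiani.zetaDefined_of_analyticAt hg,
    ThomSebastiani.zetaDefined_of_analyticAt hfg⟩, fun n hn => ?_⟩
  obtain ⟨h1, h2⟩ := ThomSebastiani.thomSebastiani_coeff hf hf0 hg hg0 hn
  simp only [← haPos, ← haNeg, ← hbPos, ← hbNeg, ← hcPos, ← hcNeg, ← hA, ← hB] at h1 h2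
  have h3 := ThomSebastiani.coeff_zeta hf hn
  have h4 := ThomSebastiani.coeff_zeta hg hn
  have h5 := ThomSebastiani.coeff_zeta hfg hn
  rw [← ha, ← haPos, ← haNeg] at h3
  rw [← hb, ← hbPos, ← hbNeg] at h4
  rw [← hc, ← hcPos, ← hcNeg] at h5
  refine ⟨h1, h2, ?_⟩
  rw [h5, h1, h2, h3, h4]
  ring
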